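/- Let $X$ be a nonsingular projective 3-fold over $\mathbb{C}$ with a fixed ample line bundle $L$, and write $F(k)=F\otimes L^{k}$. A \emph{pair} $(F,s)$ consists of a coherent sheaf $F$ on $X$ whose support has dimension $1$ and a nonzero section $s:\mathcal{O}_X\to F$. The sheaf $F$ is \emph{pure} if every nonzero coherent subsheaf of $F$ has support of dimension $1$. For a coherent sheaf $G$ with support of dimension at most $1$, let $r(G)$ be the coefficient of $k$ in the Hilbert polynomial $\chi(G(k))=r(G)k+c$. A \emph{proper} subsheaf $G\subset F$ is a coherent subsheaf which is nonzero and not equal to $F$. Let $q\in\mathbb{Q}[k]$ have positive leading coefficient. The pair $(F,s)$ is \emph{$q$-stable} if $F$ is pure, for every proper subsheaf $G\subset F$ $$\frac{\chi(G(k))}{r(G)}<\frac{\chi(F(k))+q(k)}{r(F)}\qquad (k\gg 0),$$ and for every proper subsheaf $G\subset F$ through which $s$ factors $$\frac{\chi(G(k))+q(k)}{r(G)}<\frac{\chi(F(k))+q(k)}{r(F)}\qquad (k\gg 0).$$ It is \emph{$q$-semistable} if the same holds with $\le$ in place of $<$. The pair is \emph{limit stable} (respectively \emph{limit semistable}) if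 it is $q$-stable (respectively $q$-semistable) for $q(k)=ak+b$ for all sufficiently large $a,b\in\mathbb{Q}$. Then a pair $(F,s)$ is limit semistable if and only if it is limit stable, and it is limit stable if and only if (i) the sheaf $F$ is pure, and (ii) the section $s:\mathcal{O}_X\to F$ has $0$-dimensional (possibly zero) cokernel. Moreover, the limit is reached uniformly: for all sufficiently large $a,b$, with $q(k)=ak+b$, and for every pair $(F,s)$ on $X$, $q$-semistability, $q$-stability, and the conjunction of (i) and (ii) are equivalent. The same equivalences hold for every pair and every $q\in\mathbb{Q}[k]$ of degree at least $2$ with positive leading coefficient. -/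

import Mathlib

open CategoryTheory CategoryTheory.Limits AlgebraicGeometry TopologicalSpace Filter
open scoped Polynomial

noncomputable section

namespace LimitPairs

/-! ### Projective schemes over `ℂ` -/

attribute [local instance] MvPolynomial.gradedAlgebra

/-- Projective space `ℙⁿ` over `ℂ`, as `Proj` of the polynomial ring in `n + 1` variables. -/
abbrev projSpace (n : ℕ) : Scheme.{0} :=
  Proj (MvPolynomial.homogeneousSubmodule (Fin (n + 1)) ℂ)

/-- The structure morphism `ℙⁿ ⟶ Spec ℂ`. -/
def projSpaceToSpec (n : ℕ) : projSpace n ⟶ Spec (CommRingCat.of ℂ) :=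
  Proj.toSpecZero (MvPolynomial.homogeneousSubmodule (Fin (n + 1)) ℂ) ≫
    Spec.map (CommRingCat.ofHom
      (algebraMap ℂ (MvPolynomial.homogeneousSubmodule (Fin (n + 1)) ℂ 0)))

/-- `X` is projective over `ℂ`: it is a closed subscheme of some `ℙⁿ`, over `ℂ`. -/
def IsProjective {X : Scheme.{0}} (f : X ⟶ Spec (CommRingCat.of ℂ)) : Prop :=
  ∃ (n : ℕ) (i : X ⟶ projSpace n), IsClosedImmersion i ∧ i ≫ projSpaceToSpec n = f

variable {X : Scheme.{0}}

/-! ### Sheaves of modules: tensor products, coherence, support, purity -/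

/-- The structure sheaf `𝒪_X` as an `𝒪_X`-module. -/
def structureSheaf (X : Scheme.{0}) : X.Modules :=
  SheafOfModules.unit X.ringCatSheaf

/-- The tensor product of `𝒪_X`-modules: the sheaf associated with
`U ↦ Γ(M, U) ⊗ Γ(N, U)`. -/
def tensor (M N : X.Modules) : X.Modules :=
  (PresheafOfModules.sheafification (𝟙 X.ringCatSheaf.obj)).obj
    (PresheafOfModules.Monoidal.tensorObj (R := X.sheaf.obj) M.val N.val)

/-- The tensor powers `Lᵏ`, `k ≥ 0`. -/
def tensorPow (L : X.Modules) : ℕ → X.Modules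
  | 0 => structureSheaf X
  | k + 1 => tensor (tensorPow L k) L

/-- The twist `F(k) = F ⊗ Lᵏ`. -/
def twist (L F : X.Modules) (k : ℕ) : X.Modules :=
  tensor F (tensorPow L k)

/-- Restriction of sections. -/
def res (M : X.Modules) {U V : X.Opens} (h : V ≤ U) (t : Γ(M, U)) : Γ(M, V) :=
  M.presheaf.map (homOfLE h).op t

/-- `t` freely generates `M` over `U`: multiplication by `t` is an isomorphism
`𝒪_U ⟶ M|_U`. -/
def IsGenerator (M : X.Modules) {U : X.Opens} (t : Γ(M, U)) : Prop :=
  ∀ (V : X.Opens) (h : V ≤ U), Function.Bijective (fun a : Γ(X, V) => a • res M h t)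

/-- `M` is an invertible sheaf (a line bundle): locally isomorphic to `𝒪_X`. -/
def IsInvertible (M : X.Modules) : Prop :=
  ∀ x : X, ∃ (U : X.Opens) (_ : x ∈ U) (t : Γ(M, U)), IsGenerator M t

/-- The open set `X_s` on which a global section `s` generates `M`; for an invertible sheaf
this is the complement of the zero locus of `s`. -/
def nonvanishing (M : X.Modules) (s : Γ(M, ⊤)) : X.Opens :=
  sSup {U : X.Opens | IsGenerator M (res M (le_top : U ≤ ⊤) s)}

/-- Ample invertible sheaves (on a quasi-compact scheme): the affine open sets of the form
`X_s`, with `s` a section of a positive power of `L`, cover `X`. -/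
def IsAmple (L : X.Modules) : Prop :=
  IsInvertible L ∧ ∀ x : X, ∃ (n : ℕ) (_ : 1 ≤ n) (s : Γ(tensorPow L n, ⊤)),
    x ∈ nonvanishing (tensorPow L n) s ∧ IsAffineOpen (nonvanishing (tensorPow L n) s)

/-- Coherent sheaves on a locally Noetherian scheme: quasi-coherent, with finitely generated
modules of sections over affine open sets. -/
structure IsCoherent (M : X.Modules) : Prop where
  quasicoherent : SheafOfModules.IsQuasicoherent M
  finite : ∀ U : X.Opens, IsAffineOpen U → Module.Finite Γ(X, U) Γ(M, U)

/-- The support of a sheaf: the points with nonzero stalk. -/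
def support (M : X.Modules) : Set X :=
  {x | Nontrivial (M.presheaf.stalk x)}

/-- The dimension of the support (it is `⊥` for the zero sheaf). -/
def dimSupport (M : X.Modules) : WithBot ℕ∞ :=
  topologicalKrullDim (support M)

/-- Purity (in dimension one): every nonzero coherent subsheaf has support of dimension one. -/
def IsPure (F : X.Modules) : Prop :=
  ∀ (G : X.Modules) (i : G ⟶ F), Mono i → IsCoherent G → ¬ IsZero G → dimSupport G = 1

/-! ### Čech cohomology over a finite affine cover and the Euler characteristic -/

/-- The ring map `ℂ → Γ(X, U)` given by the structure morphism. -/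
def scalars (f : X ⟶ Spec (CommRingCat.of ℂ)) (U : X.Opens) : ℂ →+* Γ(X, U) :=
  ((Scheme.ΓSpecIso (CommRingCat.of ℂ)).inv ≫ f.appTop ≫
    X.presheaf.map (homOfLE (le_top : U ≤ ⊤)).op).hom

/-- `Γ(M, U)` as a `ℂ`-vector space. -/
def Sec (_f : X ⟶ Spec (CommRingCat.of ℂ)) (M : X.Modules) (U : X.Opens) : Type :=
  Γ(M, U)

instance (f : X ⟶ Spec (CommRingCat.of ℂ)) (M : X.Modules) (U : X.Opens) :
    AddCommGroup (Sec f M U) :=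
  inferInstanceAs (AddCommGroup Γ(M, U))

instance (f : X ⟶ Spec (CommRingCat.of ℂ)) (M : X.Modules) (U : X.Opens) :
    Module ℂ (Sec f M U) :=
  Module.compHom Γ(M, U) (scalars f U)

lemma map_scalars (f : X ⟶ Spec (CommRingCat.of ℂ)) {U V : X.Opens} (h : V ≤ U) (c : ℂ) :
    X.presheaf.map (homOfLE h).op (scalars f U c) = scalars f V c := by
  simp only [scalars, CommRingCat.hom_comp, RingHom.comp_apply]
  rw [← CommRingCat.comp_apply, ← X.presheaf.map_comp]
  rfl

/-- Restriction of sections, as a `ℂ`-linear map. -/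
def resLin (f : X ⟶ Spec (CommRingCat.of ℂ)) (M : X.Modules) {U V : X.Opens} (h : V ≤ U) :
    Sec f M U →ₗ[ℂ] Sec f M V where
  toFun t := res M h t
  map_add' a b := map_add (M.presheaf.map (homOfLE h).op).hom a b
  map_smul' c t := by
    have key : ∀ x : Γ(M, U), M.presheaf.map (homOfLE h).op (scalars f U c • x) =
        scalars f V c • M.presheaf.map (homOfLE h).op x := fun x => by
      rw [Scheme.Modules.map_smul, map_scalars]
    exact key t

/-- `U_{σ 0} ∩ ⋯ ∩ U_{σ p}` for `σ 0 < ⋯ < σ p`. -/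
def inter {m : ℕ} (U : Fin m → X.Opens) {p : ℕ} (σ : Fin (p + 1) ↪o Fin m) : X.Opens :=
  ⨅ j, U (σ j)

/-- Omit the `j`-th index. -/
def face {m p : ℕ} (σ : Fin (p + 2) ↪o Fin m) (j : Fin (p + 2)) : Fin (p + 1) ↪o Fin m :=
  (Fin.succAboveOrderEmb j).trans σ

lemma inter_le_face {m : ℕ} (U : Fin m → X.Opens) {p : ℕ} (σ : Fin (p + 2) ↪o Fin m)
    (j : Fin (p + 2)) : inter U σ ≤ inter U (face σ j) :=
  le_iInf fun i => iInf_le (fun l => U (σ l)) (Fin.succAbove j i)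

/-- The (ordered) Čech cochains
`Cᵖ(U, M) = ∏_{i₀ < ⋯ < i_p} Γ(M, U_{i₀} ∩ ⋯ ∩ U_{i_p})`. -/
abbrev Cochain (f : X ⟶ Spec (CommRingCat.of ℂ)) {m : ℕ} (U : Fin m → X.Opens)
    (M : X.Modules) (p : ℕ) : Type :=
  (σ : Fin (p + 1) ↪o Fin m) → Sec f M (inter U σ)

/-- The Čech differential `(d t)_σ = ∑_j (-1)^j t_{σ without its j-th index}|`. -/
def cechD (f : X ⟶ Spec (CommRingCat.of ℂ)) {m : ℕ} (U : Fin m → X.Opens)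
    (M : X.Modules) (p : ℕ) : Cochain f U M p →ₗ[ℂ] Cochain f U M (p + 1) :=
  LinearMap.pi fun σ => ∑ j : Fin (p + 2),
    ((-1 : ℂ) ^ (j : ℕ)) • (resLin f M (inter_le_face U σ j)).comp (LinearMap.proj (face σ j))

/-- The Čech coboundaries in degree `p`. -/
def coboundaries (f : X ⟶ Spec (CommRingCat.of ℂ)) {m : ℕ} (U : Fin m → X.Opens)
    (M : X.Modules) : (p : ℕ) → Submodule ℂ (Cochain f U M p)
  | 0 => ⊥
  | p + 1 => LinearMap.range (cechD f U M p)

/-- The Čech cohomology `Hᵖ(U, M)`, cocycles modulo coboundaries. For a finite affine open cover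
of a separated scheme and a quasi-coherent sheaf it is the sheaf cohomology `Hᵖ(X, M)`. -/
abbrev CechH (f : X ⟶ Spec (CommRingCat.of ℂ)) {m : ℕ} (U : Fin m → X.Opens)
    (M : X.Modules) (p : ℕ) : Type :=
  LinearMap.ker (cechD f U M p) ⧸
    (coboundaries f U M p).comap (LinearMap.ker (cechD f U M p)).subtype

/-- The Euler characteristic `χ(M) = ∑ (-1)ᵖ dim_ℂ Hᵖ(X, M)`, computed with the cover `U`
(there are no Čech cochains in degrees `p ≥ m`). -/
def eulerChar (f : X ⟶ Spec (CommRingCat.of ℂ)) {m : ℕ} (U : Fin m → X.Opens)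
    (M : X.Modules) : ℤ :=
  ∑ p ∈ Finset.range m, (-1) ^ p * (Module.finrank ℂ (CechH f U M p) : ℤ)

/-- A finite affine open cover. -/
structure IsAffineCover {m : ℕ} (U : Fin m → X.Opens) : Prop where
  affine : ∀ i, IsAffineOpen (U i)
  cover : ⨆ i, U i = ⊤

/-- `χ(G(k))`, as a rational number. -/
def chi (f : X ⟶ Spec (CommRingCat.of ℂ)) {m : ℕ} (U : Fin m → X.Opens)
    (L G : X.Modules) (k : ℕ) : ℚ :=
  (eulerChar f U (twist L G k) : ℚ)

open Classical in
/-- For `G` with support of dimension at most one, the coefficient `r(G)` of `k` in the Hilbert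
polynomial `χ(G(k)) = r(G) k + c`. (The polynomial is determined by its values at large `k`.) -/
def rk (f : X ⟶ Spec (CommRingCat.of ℂ)) {m : ℕ} (U : Fin m → X.Opens)
    (L G : X.Modules) : ℚ :=
  if h : ∃ r c : ℚ, ∀ᶠ k : ℕ in atTop, chi f U L G k = r * k + c then h.choose else 0

/-! ### Pairs and their stability -/

/-- A pair `(F, s)`: a coherent sheaf `F` with support of dimension one and a nonzero section
`s : 𝒪_X ⟶ F`. -/
structure IsPair (F : X.Modules) (s : structureSheaf X ⟶ F) : Prop where
  coherent : IsCoherent F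
  dim_eq : dimSupport F = 1
  ne_zero : s ≠ 0

/-- `i : G ⟶ F` is a proper coherent subsheaf: nonzero and not equal to `F`. -/
structure IsProperSubsheaf {G F : X.Modules} (i : G ⟶ F) : Prop where
  mono : Mono i
  coherent : IsCoherent G
  ne_zero : ¬ IsZero G
  ne_top : ¬ IsIso i

/-- `s` factors through the subsheaf `i : G ⟶ F`. -/
def FactorsThrough {G F : X.Modules} (s : structureSheaf X ⟶ F) (i : G ⟶ F) : Prop :=
  ∃ t : structureSheaf X ⟶ G, t ≫ i = s

/-- `q`-stability of the pair `(F, s)`: `F` is pure, every proper subsheaf `G` satisfies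
`χ(G(k)) / r(G) < (χ(F(k)) + q(k)) / r(F)` for `k ≫ 0`, and every proper subsheaf `G` through
which `s` factors satisfies `(χ(G(k)) + q(k)) / r(G) < (χ(F(k)) + q(k)) / r(F)` for `k ≫ 0`. -/
structure IsStable (f : X ⟶ Spec (CommRingCat.of ℂ)) {m : ℕ} (U : Fin m → X.Opens)
    (L : X.Modules) (q : ℚ[X]) (F : X.Modules) (s : structureSheaf X ⟶ F) : Prop where
  pure : IsPure F
  slope : ∀ (G : X.Modules) (i : G ⟶ F), IsProperSubsheaf i →
    ∀ᶠ k : ℕ in atTop,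
      chi f U L G k / rk f U L G < (chi f U L F k + q.eval (k : ℚ)) / rk f U L F
  slope_section : ∀ (G : X.Modules) (i : G ⟶ F), IsProperSubsheaf i → FactorsThrough s i →
    ∀ᶠ k : ℕ in atTop,
      (chi f U L G k + q.eval (k : ℚ)) / rk f U L G <
        (chi f U L F k + q.eval (k : ℚ)) / rk f U L F

/-- `q`-semistability of the pair `(F, s)`: the same with `≤` in place of `<`. -/
structure IsSemistable (f : X ⟶ Spec (CommRingCat.of ℂ)) {m : ℕ} (U : Fin m → X.Opens)
    (L : X.Modules) (q : ℚ[X]) (F : X.Modules) (s : structureSheaf X ⟶ F) : Prop where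
  pure : IsPure F
  slope : ∀ (G : X.Modules) (i : G ⟶ F), IsProperSubsheaf i →
    ∀ᶠ k : ℕ in atTop,
      chi f U L G k / rk f U L G ≤ (chi f U L F k + q.eval (k : ℚ)) / rk f U L F
  slope_section : ∀ (G : X.Modules) (i : G ⟶ F), IsProperSubsheaf i → FactorsThrough s i →
    ∀ᶠ k : ℕ in atTop,
      (chi f U L G k + q.eval (k : ℚ)) / rk f U L G ≤
        (chi f U L F k + q.eval (k : ℚ)) / rk f U L F

/-- The degree one polynomial `a k + b`. -/
def linearPoly (c : ℚ × ℚ) : ℚ[X] :=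
  Polynomial.C c.1 * Polynomial.X + Polynomial.C c.2

/-- Limit stability: `q`-stability for all `q = a k + b` with `a` and `b` sufficiently large. -/
def IsLimitStable (f : X ⟶ Spec (CommRingCat.of ℂ)) {m : ℕ} (U : Fin m → X.Opens)
    (L F : X.Modules) (s : structureSheaf X ⟶ F) : Prop :=
  ∀ᶠ c : ℚ × ℚ in atTop, IsStable f U L (linearPoly c) F s

/-- Limit semistability: `q`-semistability for all `q = a k + b` with `a` and `b` sufficiently
large. -/
def IsLimitSemistable (f : X ⟶ Spec (CommRingCat.of ℂ)) {m : ℕ} (U : Fin m → X.Opens)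
    (L F : X.Modules) (s : structureSheaf X ⟶ F) : Prop :=
  ∀ᶠ c : ℚ × ℚ in atTop, IsSemistable f U L (linearPoly c) F s

/-- Conditions (i) and (ii): `F` is pure, and the cokernel of `s : 𝒪_X ⟶ F` is zero-dimensional
(possibly zero). -/
def IsPureWithFiniteCokernel (F : X.Modules) (s : structureSheaf X ⟶ F) : Prop :=
  IsPure F ∧ dimSupport (cokernel s) ≤ 0

end LimitPairs

end

/-! Everything rests on the Hilbert polynomial of a coherent sheaf G with support of dimension at
most 1. One has χ(G(k)) = r k + c for all k ≥ 0, where r ≥ 0, and r = 0 exactly when the support has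
dimension at most 0; in that case c ≥ 0, and c = 0 only for G = 0 (`exists_hilbert`). Moreover χ is
additive in short exact sequences (`IsSES.eulerChar_eq_add`).

Granting this, let F be pure and G ⊂ F proper, so that r(G) > 0. Divided by the ranks, the linear
terms of both sides are equal to k, so the first inequality says that q(k) exceeds a constant; this
holds for k ≫ 0 once q has positive degree and positive leading coefficient. If s factors through G
and coker s is 0-dimensional, then so is its quotient F/G; hence r(G) = r(F), q cancels, and the
second inequality says that F/G has positive length. Conversely, if coker s is not 0-dimensional,
then G = im s has r(G) < r(F), and the second inequality would bound q from above. For q = ak + b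
only a > 0 is needed, whatever the pair, whence the uniformity
(`isStable_of_isPureWithFiniteCokernel`, `IsSemistable.isPureWithFiniteCokernel`).

The Hilbert polynomial is obtained by hand. Generic sections σ, τ of powers of the ample sheaf L
give affine open sets V₀ = X_σ and V₁ = X_τ that cover the support and on which L is trivial
(`IsAmple.exists_chart`); products and powers of sections are formed on their coordinates
(`PowSec`). After equalising degrees, x = τ/σ and y = σ/τ play the role of the coordinates of a
projective line: by the valuative criterion the sections over V₀ and V₁ are finitely generated over
ℂ[x] and ℂ[y] (`isFGUnder_mulLin`).

A double complex argument identifies Čech cohomology for the cover U with that of Γ(V₀) ⊕ Γ(V₁) →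
Γ(V₀ ∩ V₁), so χ is the index of a linear map (`eulerChar_eq_index`), and twisting by Lᵏ multiplies
the gluing by uᵏ for a unit u. Linear algebra shows that such a map has finite-dimensional kernel
and cokernel (`IsChart.isFredholm`), that its index is affine in k (`IsChart.index_pow`), and that a
positive multiple of the slope is minus the index of y on Γ(V₁), that is, a rank
(`IsChart.mul_slope`, `IsFGUnder.index_nonpos`). Slope zero forces the sections over V₀ and V₁ to be
finite-dimensional, and then the support has dimension at most 0. -/

noncomputable section

namespace LimitPairs

attribute [local instance] MvPolynomial.gradedAlgebra

variable {X : Scheme.{0}}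

/-! ### Linear maps with finite-dimensional kernel and cokernel -/

section fredholm

variable {K : Type*} [Field K]

/-- The kernel and the cokernel of `f` are finite-dimensional. -/
structure IsFredholm {A N : Type*} [AddCommGroup A] [Module K A] [AddCommGroup N] [Module K N]
    (f : A →ₗ[K] N) : Prop where
  ker : FiniteDimensional K (LinearMap.ker f)
  coker : FiniteDimensional K (N ⧸ LinearMap.range f)

section

variable {A N A₂ N₂ : Type*} [AddCommGroup A] [Module K A] [AddCommGroup N] [Module K N]
  [AddCommGroup A₂] [Module K A₂] [AddCommGroup N₂] [Module K N₂]

lemma index_congr {f : A →ₗ[K] N} {g : A₂ →ₗ[K] N₂} (e : A ≃ₗ[K] A₂) (e' : N ≃ₗ[K] N₂)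
    (h : ∀ a, e' (f a) = g (e a)) : f.index = g.index := by
  have h1 : (LinearMap.ker f).map (e : A →ₗ[K] A₂) = LinearMap.ker g := by
    ext b
    constructor
    · rintro ⟨a, ha, rfl⟩
      have ha : f a = 0 := ha
      change g (e a) = 0
      rw [← h, ha, map_zero]
    · intro hb
      refine ⟨e.symm b, ?_, e.apply_symm_apply b⟩
      have hb : g b = 0 := hb
      change f (e.symm b) = 0
      apply e'.injective
      rw [h, e.apply_symm_apply, hb, map_zero]
  have h2 : (LinearMap.range f).map (e' : N →ₗ[K] N₂) = LinearMap.range g := by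
    ext b
    constructor
    · rintro ⟨_, ⟨a, rfl⟩, rfl⟩
      exact ⟨e a, (h a).symm⟩
    · rintro ⟨a, rfl⟩
      refine ⟨f (e.symm a), ⟨_, rfl⟩, ?_⟩
      exact (h _).trans (by rw [e.apply_symm_apply])
  rw [LinearMap.index, LinearMap.index, (e.submoduleMap (LinearMap.ker f)).finrank_eq, h1,
    (Submodule.Quotient.equiv _ _ e' h2).finrank_eq]

lemma IsFredholm.congr {f : A →ₗ[K] N} {g : A₂ →ₗ[K] N₂} (e : A ≃ₗ[K] A₂) (e' : N ≃ₗ[K] N₂)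
    (h : ∀ a, e' (f a) = g (e a)) (hf : IsFredholm f) : IsFredholm g := by
  have := hf.ker
  have := hf.coker
  constructor
  · let k : LinearMap.ker g →ₗ[K] LinearMap.ker f :=
      ((e.symm : A₂ →ₗ[K] A) ∘ₗ (LinearMap.ker g).subtype).codRestrict _ (by
        rintro ⟨b, hb⟩
        have hb : g b = 0 := hb
        change f (e.symm b) = 0
        apply e'.injective
        rw [h, e.apply_symm_apply, hb, map_zero])
    exact FiniteDimensional.of_injective k fun a b hab =>
      Subtype.ext (e.symm.injective (congrArg Subtype.val hab))
  · let k : (N ⧸ LinearMap.range f) →ₗ[K] (N₂ ⧸ LinearMap.range g) :=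
      Submodule.mapQ _ _ (e' : N →ₗ[K] N₂) (by
        rintro _ ⟨a, rfl⟩
        exact ⟨e a, (h a).symm⟩)
    refine Module.Finite.of_surjective k fun q => ?_
    obtain ⟨n, rfl⟩ := Submodule.mkQ_surjective _ q
    exact ⟨Submodule.Quotient.mk (e'.symm n), by simp [k]⟩

lemma IsFredholm.comp {P : Type*} [AddCommGroup P] [Module K P] {f : A →ₗ[K] N} {g : N →ₗ[K] P}
    (hg : IsFredholm g) (hf : IsFredholm f) : IsFredholm (g ∘ₗ f) := by
  have := hf.ker
  have := hf.coker
  have := hg.ker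
  have := hg.coker
  constructor
  · rw [LinearMap.ker_comp]; infer_instance
  · rw [LinearMap.range_comp]; infer_instance

lemma IsFredholm.index_comp {P : Type*} [AddCommGroup P] [Module K P] {f : A →ₗ[K] N}
    {g : N →ₗ[K] P} (hg : IsFredholm g) (hf : IsFredholm f) :
    (g ∘ₗ f).index = g.index + f.index := by
  have := hf.ker
  have := hf.coker
  have := hg.ker
  have := hg.coker
  exact LinearMap.index_comp g

/-- The kernel of a product map with an identity. -/
lemma isFredholm_prodMap_id {f : A →ₗ[K] N} (hf : IsFredholm f) (B : Type*) [AddCommGroup B]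
    [Module K B] : IsFredholm (f.prodMap (LinearMap.id : B →ₗ[K] B)) ∧
      (f.prodMap (LinearMap.id : B →ₗ[K] B)).index = f.index := by
  let e : LinearMap.ker f ≃ₗ[K] LinearMap.ker (f.prodMap (LinearMap.id : B →ₗ[K] B)) :=
    LinearEquiv.ofBijective
      ((LinearMap.inl K A B ∘ₗ (LinearMap.ker f).subtype).codRestrict _ (by
        rintro ⟨a, ha⟩
        have ha : f a = 0 := ha
        simp [ha])) ⟨fun a b h => Subtype.ext (congrArg (fun z => z.1.1) h), by
          rintro ⟨⟨a, b⟩, h⟩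
          simp only [LinearMap.mem_ker, LinearMap.prodMap_apply, LinearMap.id_coe, id_eq,
            Prod.mk_eq_zero] at h
          exact ⟨⟨a, h.1⟩, by ext <;> simp [h.2]⟩⟩
  let e' : (N ⧸ LinearMap.range f) ≃ₗ[K]
      ((N × B) ⧸ LinearMap.range (f.prodMap (LinearMap.id : B →ₗ[K] B))) :=
    LinearEquiv.ofBijective (Submodule.mapQ _ _ (LinearMap.inl K N B) (by
      rintro _ ⟨a, rfl⟩
      exact ⟨(a, 0), by simp⟩)) ⟨by
        rw [injective_iff_map_eq_zero]
        intro q hq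
        obtain ⟨n, rfl⟩ := Submodule.mkQ_surjective _ q
        simp only [Submodule.mkQ_apply, Submodule.mapQ_apply, Submodule.Quotient.mk_eq_zero] at hq ⊢
        obtain ⟨⟨a, b⟩, h⟩ := hq
        exact ⟨a, congrArg Prod.fst h⟩, by
        intro q
        obtain ⟨⟨n, b⟩, rfl⟩ := Submodule.mkQ_surjective _ q
        refine ⟨Submodule.Quotient.mk n, ?_⟩
        simp only [Submodule.mkQ_apply, Submodule.mapQ_apply]
        rw [Submodule.Quotient.eq]
        exact ⟨(0, -b), by simp⟩⟩
  have := hf.ker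
  have := hf.coker
  exact ⟨⟨e.finiteDimensional, e'.finiteDimensional⟩, by
    rw [LinearMap.index, LinearMap.index, e.finrank_eq, e'.finrank_eq]⟩

lemma isFredholm_id_prodMap {f : A →ₗ[K] N} (hf : IsFredholm f) (B : Type*) [AddCommGroup B]
    [Module K B] : IsFredholm ((LinearMap.id : B →ₗ[K] B).prodMap f) ∧
      ((LinearMap.id : B →ₗ[K] B).prodMap f).index = f.index := by
  have h := isFredholm_prodMap_id hf B
  exact ⟨h.1.congr (LinearEquiv.prodComm K A B) (LinearEquiv.prodComm K N B) fun _ => rfl,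
    (index_congr (LinearEquiv.prodComm K A B) (LinearEquiv.prodComm K N B) fun _ => rfl).symm.trans
      h.2⟩

end

lemma bijective_coprod_of_split {B B₁ B₂ : Type*} [AddCommGroup B] [Module K B]
    [AddCommGroup B₁] [Module K B₁] [AddCommGroup B₂] [Module K B₂] (i : B₁ →ₗ[K] B)
    (p : B →ₗ[K] B₂) (σ : B₂ →ₗ[K] B) (hi : Function.Injective i)
    (hip : ∀ a, p a = 0 ↔ ∃ b, i b = a) (hσ : ∀ a, p (σ a) = a) :
    Function.Bijective (i.coprod σ) := by
  have hpi : ∀ a, p (i a) = 0 := fun a => (hip _).mpr ⟨a, rfl⟩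
  constructor
  · rw [injective_iff_map_eq_zero]
    rintro ⟨a, b⟩ h
    rw [LinearMap.coprod_apply] at h
    have hb : b = 0 := by
      have := congrArg p h
      rwa [map_add, hpi, hσ, zero_add, map_zero] at this
    subst hb
    rw [map_zero, add_zero] at h
    have ha : a = 0 := hi (h.trans (map_zero i).symm)
    rw [ha]
    rfl
  · intro a
    obtain ⟨b, hb⟩ := (hip (a - σ (p a))).mp (by rw [map_sub, hσ, sub_self])
    exact ⟨(b, p a), by rw [LinearMap.coprod_apply, hb, sub_add_cancel]⟩

/-- Additivity of the index. -/
theorem index_add_of_exact {A A₁ A₂ N N₁ N₂ : Type*}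
    [AddCommGroup A] [Module K A] [AddCommGroup N] [Module K N]
    [AddCommGroup A₁] [Module K A₁] [AddCommGroup N₁] [Module K N₁]
    [AddCommGroup A₂] [Module K A₂] [AddCommGroup N₂] [Module K N₂]
    (i : A₁ →ₗ[K] A) (p : A →ₗ[K] A₂) (j : N₁ →ₗ[K] N) (q : N →ₗ[K] N₂)
    (hi : Function.Injective i) (hp : Function.Surjective p) (hip : ∀ a, p a = 0 ↔ ∃ b, i b = a)
    (hj : Function.Injective j) (hq : Function.Surjective q) (hjq : ∀ a, q a = 0 ↔ ∃ b, j b = a)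
    (f₁ : A₁ →ₗ[K] N₁) (f : A →ₗ[K] N) (f₂ : A₂ →ₗ[K] N₂)
    (h₁ : ∀ a, f (i a) = j (f₁ a)) (h₂ : ∀ a, q (f a) = f₂ (p a))
    (hf₁ : IsFredholm f₁) (hf₂ : IsFredholm f₂) : f.index = f₁.index + f₂.index := by
  obtain ⟨σ, hσ⟩ := p.exists_rightInverse_of_surjective (LinearMap.range_eq_top.mpr hp)
  obtain ⟨τ, hτ⟩ := q.exists_rightInverse_of_surjective (LinearMap.range_eq_top.mpr hq)
  have hσ : ∀ a, p (σ a) = a := fun a => LinearMap.congr_fun hσ a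
  have hτ : ∀ a, q (τ a) = a := fun a => LinearMap.congr_fun hτ a
  have hpi : ∀ a, p (i a) = 0 := fun a => (hip _).mpr ⟨a, rfl⟩
  have hqj : ∀ a, q (j a) = 0 := fun a => (hjq _).mpr ⟨a, rfl⟩
  let E := LinearEquiv.ofBijective _ (bijective_coprod_of_split i p σ hi hip hσ)
  let E' := LinearEquiv.ofBijective _ (bijective_coprod_of_split j q τ hj hjq hτ)
  have hE : ∀ a b, E (a, b) = i a + σ b := fun a b => LinearMap.coprod_apply _ _ _
  have hE' : ∀ a b, E' (a, b) = j a + τ b := fun a b => LinearMap.coprod_apply _ _ _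
  -- In the split coordinates `f` is block triangular with diagonal `f₁`, `f₂` and off-diagonal
  -- entry `h`. It is thus `f₁ × id`, followed by the shear `S` along `h`, followed by `id × f₂`,
  -- and indices of composites add up; no snake lemma is needed.
  let h : A₂ →ₗ[K] N₁ := LinearMap.fst K N₁ N₂ ∘ₗ (E'.symm : N →ₗ[K] N₁ × N₂) ∘ₗ f ∘ₗ σ
  have hh : ∀ b, f (σ b) = j (h b) + τ (f₂ b) := by
    intro b
    obtain ⟨⟨u, v⟩, huv⟩ := E'.surjective (f (σ b))
    have h1 : h b = u := by
      change (E'.symm (f (σ b))).1 = u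
      rw [← huv, E'.symm_apply_apply]
    have h2 := congrArg q huv
    rw [hE', map_add, hqj, zero_add, hτ, h₂, hσ] at h2
    rw [← huv, hE', h1, h2]
  let S : (N₁ × A₂) ≃ₗ[K] (N₁ × A₂) :=
    { toFun := fun z => (z.1 + h z.2, z.2)
      invFun := fun z => (z.1 - h z.2, z.2)
      map_add' := fun z w => by ext <;> simp; abel
      map_smul' := fun r z => by ext <;> simp
      left_inv := fun z => by ext <;> simp
      right_inv := fun z => by ext <;> simp }
  have e : f.index = (((LinearMap.id : N₁ →ₗ[K] N₁).prodMap f₂) ∘ₗ ((S : N₁ × A₂ →ₗ[K] N₁ × A₂) ∘ₗ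
      (f₁.prodMap (LinearMap.id : A₂ →ₗ[K] A₂)))).index := by
    symm
    apply index_congr E E'
    rintro ⟨a, b⟩
    rw [hE, map_add, h₁, hh]
    change E' (f₁ a + h b, f₂ b) = _
    rw [hE', map_add]
    abel
  have hS : IsFredholm (S : N₁ × A₂ →ₗ[K] N₁ × A₂) := by
    constructor
    · rw [LinearEquiv.ker]; infer_instance
    · rw [LinearEquiv.range]
      exact Module.Finite.of_finite
  rw [e, (isFredholm_id_prodMap hf₂ N₁).1.index_comp (hS.comp (isFredholm_prodMap_id hf₁ A₂).1),
    hS.index_comp (isFredholm_prodMap_id hf₁ A₂).1, (isFredholm_id_prodMap hf₂ N₁).2,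
    (isFredholm_prodMap_id hf₁ A₂).2, LinearEquiv.index_eq_zero]
  ring

end fredholm

/-! ### Finitely generated modules over a polynomial ring in one variable -/

section generation

variable {K : Type*} [Field K] {A : Type*} [AddCommGroup A] [Module K A]

/-- `A` is finitely generated as a module over `K[x]`. -/
def IsFGUnder (x : A →ₗ[K] A) : Prop :=
  ∃ s : Finset A, ∀ S : Submodule K A, (s : Set A) ⊆ S → (∀ a ∈ S, x a ∈ S) → S = ⊤

/-- `IsFGUnder` speaks of invariant subspaces in order to stay with `K`-linear maps. This
translation gives access to the Noetherian property of `K[X]`. -/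
lemma IsFGUnder.finite {x : A →ₗ[K] A} (h : IsFGUnder x) :
    Module.Finite K[X] (Module.AEval' x) := by
  classical
  obtain ⟨s, hs⟩ := h
  refine ⟨⟨s.image (Module.AEval'.of x), ?_⟩⟩
  let T := Submodule.span K[X] ((s.image (Module.AEval'.of x) : Finset _) : Set (Module.AEval' x))
  let S : Submodule K A :=
    Submodule.comap (Module.AEval'.of x).toLinearMap (T.restrictScalars K)
  have hS : S = ⊤ := hs S (fun a ha => show Module.AEval'.of x a ∈ T from
      Submodule.subset_span (by rw [Finset.coe_image]; exact ⟨a, ha, rfl⟩)) fun a ha => by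
    change Module.AEval'.of x (x a) ∈ T
    rw [← Module.AEval'.X_smul_of]
    exact T.smul_mem _ (show Module.AEval'.of x a ∈ T from ha)
  rw [eq_top_iff]
  intro a _
  obtain ⟨a, rfl⟩ := (Module.AEval'.of x).surjective a
  have : a ∈ S := hS ▸ Submodule.mem_top
  exact this

/-- `S` is a submodule of a Noetherian `K[x]`-module. Its finitely many generators are killed by a
common power `x ^ N`, so the elements `x ^ m g` with `m < N` span it over `K`. -/
lemma finiteDimensional_of_torsion {x : A →ₗ[K] A} (h : IsFGUnder x) (S : Submodule K A)
    (hx : ∀ a ∈ S, x a ∈ S) (ht : ∀ a ∈ S, ∃ n : ℕ, (x ^ n) a = 0) : FiniteDimensional K S := by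
  classical
  have := h.finite
  let T : Submodule K[X] (Module.AEval' x) :=
    { carrier := {a | (Module.AEval'.of x).symm a ∈ S}
      add_mem' := fun {a b} ha hb => by
        change (Module.AEval'.of x).symm (a + b) ∈ S
        rw [map_add]
        exact S.add_mem ha hb
      zero_mem' := by
        change (Module.AEval'.of x).symm 0 ∈ S
        rw [map_zero]
        exact S.zero_mem
      smul_mem' := by
        intro p a ha
        change (Module.AEval'.of x).symm (p • a) ∈ S
        obtain ⟨a, rfl⟩ := (Module.AEval'.of x).surjective a
        change (Module.AEval'.of x).symm (Module.AEval'.of x a) ∈ S at ha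
        rw [LinearEquiv.symm_apply_apply] at ha
        induction p using Polynomial.induction_on' with
        | add p q hp hq => rw [add_smul, map_add]; exact S.add_mem hp hq
        | monomial n r =>
          rw [← Polynomial.C_mul_X_pow_eq_monomial, mul_smul, Module.AEval'.X_pow_smul_of,
            Module.AEval.C_smul, map_smul]
          refine S.smul_mem _ ?_
          rw [LinearEquiv.symm_apply_apply]
          induction n with
          | zero => exact ha
          | succ n ih => rw [pow_succ']; exact hx _ ih }
  obtain ⟨g, hg⟩ := IsNoetherian.noetherian T
  have hgS : ∀ a ∈ g, (Module.AEval'.of x).symm a ∈ S := fun a ha => by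
    have : a ∈ T := hg ▸ Submodule.subset_span ha
    exact this
  choose! n hn using fun a ha => ht _ (hgS a ha)
  let N := g.sup n
  have hN : ∀ a ∈ g, (x ^ N) ((Module.AEval'.of x).symm a) = 0 := by
    intro a ha
    have : n a ≤ N := Finset.le_sup ha
    rw [← Nat.sub_add_cancel this, pow_add, Module.End.mul_apply, hn a ha, map_zero]
  let B : Finset A := (g ×ˢ Finset.range N).image
    fun z => (x ^ z.2) ((Module.AEval'.of x).symm z.1)
  have hle : S ≤ Submodule.span K (B : Set A) := by
    intro a ha
    have haT : Module.AEval'.of x a ∈ T := by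
      change (Module.AEval'.of x).symm (Module.AEval'.of x a) ∈ S
      rwa [LinearEquiv.symm_apply_apply]
    rw [← hg] at haT
    have key : ∀ b ∈ Submodule.span K[X] (g : Set (Module.AEval' x)),
        (Module.AEval'.of x).symm b ∈ Submodule.span K (B : Set A) := by
      intro b hb
      induction hb using Submodule.closure_induction with
      | zero => rw [map_zero]; exact Submodule.zero_mem _
      | add b c _ _ hb hc => rw [map_add]; exact Submodule.add_mem _ hb hc
      | smul_mem p b hb =>
        obtain ⟨b', rfl⟩ := (Module.AEval'.of x).surjective b
        induction p using Polynomial.induction_on' with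
        | add p q hp hq => rw [add_smul, map_add]; exact Submodule.add_mem _ hp hq
        | monomial m r =>
          rw [← Polynomial.C_mul_X_pow_eq_monomial, mul_smul, Module.AEval'.X_pow_smul_of,
            Module.AEval.C_smul, map_smul]
          refine Submodule.smul_mem _ _ ?_
          rw [LinearEquiv.symm_apply_apply]
          by_cases hm : m < N
          · apply Submodule.subset_span
            rw [Finset.coe_image]
            exact ⟨(_, m), by simpa using ⟨hb, hm⟩, by simp⟩
          · change (x ^ m) b' ∈ _
            have := hN _ hb
            rw [LinearEquiv.symm_apply_apply] at this
            rw [← Nat.sub_add_cancel (not_lt.mp hm), pow_add, Module.End.mul_apply, this, map_zero]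
            exact Submodule.zero_mem _
    have := key _ haT
    rwa [LinearEquiv.symm_apply_apply] at this
  have : FiniteDimensional K (Submodule.span K (B : Set A)) :=
    FiniteDimensional.span_finset K B
  exact Submodule.finiteDimensional_of_le hle

/-- `S` and the finitely many `x ^ k a`, with `a` a generator and `k` below a common exponent `N`,
span an `x`-stable subspace containing the generators, hence everything. -/
lemma finiteDimensional_quotient_of_torsion {x : A →ₗ[K] A} (h : IsFGUnder x)
    (S : Submodule K A) (hx : ∀ a ∈ S, x a ∈ S) (ht : ∀ a, ∃ n : ℕ, (x ^ n) a ∈ S) :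
    FiniteDimensional K (A ⧸ S) := by
  classical
  obtain ⟨s, hs⟩ := h
  choose n hn using ht
  have hpow : ∀ a ∈ S, ∀ k : ℕ, (x ^ k) a ∈ S := by
    intro a ha k
    induction k with
    | zero => exact ha
    | succ k ih => rw [pow_succ']; exact hx _ ih
  let N := s.sup n
  have hN : ∀ a ∈ s, ∀ k, N ≤ k → (x ^ k) a ∈ S := by
    intro a ha k hk
    have : n a ≤ k := (Finset.le_sup ha).trans hk
    rw [← Nat.sub_add_cancel this, pow_add, Module.End.mul_apply]
    exact hpow _ (hn a) _
  let B : Finset A := (s ×ˢ Finset.range N).image fun z => (x ^ z.2) z.1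
  have hpB : ∀ a ∈ s, ∀ k, (x ^ k) a ∈ S ⊔ Submodule.span K (B : Set A) := by
    intro a ha k
    by_cases hk : k < N
    · apply Submodule.mem_sup_right
      apply Submodule.subset_span
      rw [Finset.coe_image]
      exact ⟨(a, k), by simpa using ⟨ha, hk⟩, rfl⟩
    · exact Submodule.mem_sup_left (hN a ha k (not_lt.mp hk))
  have htop : S ⊔ Submodule.span K (B : Set A) = ⊤ := by
    apply hs
    · intro a ha
      exact hpB a ha 0
    · intro a ha
      have : (S ⊔ Submodule.span K (B : Set A)).map x ≤ S ⊔ Submodule.span K (B : Set A) := by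
        rw [Submodule.map_sup, Submodule.map_span]
        refine sup_le ?_ (Submodule.span_le.mpr ?_)
        · rintro _ ⟨b, hb, rfl⟩
          exact Submodule.mem_sup_left (hx b hb)
        · rintro _ ⟨_, hb, rfl⟩
          rw [Finset.coe_image] at hb
          obtain ⟨⟨b, k⟩, hbk, rfl⟩ := hb
          have := hpB b (by simp at hbk; exact hbk.1) (k + 1)
          rwa [pow_succ'] at this
      exact this ⟨a, ha, rfl⟩
  have : FiniteDimensional K (Submodule.span K (B : Set A)) := FiniteDimensional.span_finset K B
  refine Module.Finite.of_surjective (S.mkQ ∘ₗ (Submodule.span K (B : Set A)).subtype) ?_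
  intro q
  obtain ⟨a, rfl⟩ := S.mkQ_surjective q
  obtain ⟨b, hb, c, hc, rfl⟩ := Submodule.mem_sup.mp (htop ▸ Submodule.mem_top : a ∈ _)
  refine ⟨⟨c, hc⟩, ?_⟩
  simp only [LinearMap.comp_apply, Submodule.subtype_apply, map_add]
  rw [show S.mkQ b = 0 from (Submodule.Quotient.mk_eq_zero S).mpr hb, zero_add]

end generation

/-! ### Cohomology of sheaves on two glued affine lines -/

section chart

variable {K : Type*} [Field K] {A B N : Type*} [AddCommGroup A] [Module K A] [AddCommGroup B]
  [Module K B] [AddCommGroup N] [Module K N]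

/-- Algebraic data of a coherent sheaf on a curve with the two charts `Spec K[x]`, `Spec K[y]`,
`xy = 1`: modules `A` and `B` on the charts, the module `N` on the intersection, on which `x` and
`y` act by `t` and `t'`. -/
structure IsChart (x : A →ₗ[K] A) (y : B →ₗ[K] B) (t t' : N →ₗ[K] N) (φ : A →ₗ[K] N)
    (ψ : B →ₗ[K] N) : Prop where
  fgA : IsFGUnder x
  fgB : IsFGUnder y
  tt' : ∀ n, t (t' n) = n
  t't : ∀ n, t' (t n) = n
  hφ : ∀ a, φ (x a) = t (φ a)
  hψ : ∀ b, ψ (y b) = t' (ψ b)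
  kerφ : ∀ a, φ a = 0 → ∃ n : ℕ, (x ^ n) a = 0
  kerψ : ∀ b, ψ b = 0 → ∃ n : ℕ, (y ^ n) b = 0
  surjφ : ∀ n, ∃ (k : ℕ) (a : A), φ a = (t ^ k) n
  surjψ : ∀ n, ∃ (k : ℕ) (b : B), ψ b = (t' ^ k) n

/-- The span of `t ^ n z` for `z ∈ Z` and `n < b`. -/
def growth (t : N →ₗ[K] N) (Z : Submodule K N) : ℕ → Submodule K N
  | 0 => ⊥
  | b + 1 => Z ⊔ (growth t Z b).map t

section growth

variable (t : N →ₗ[K] N) (Z : Submodule K N)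

instance [FiniteDimensional K Z] (b : ℕ) : FiniteDimensional K (growth t Z b) := by
  induction b with
  | zero => exact inferInstanceAs (FiniteDimensional K (⊥ : Submodule K N))
  | succ b ih =>
    exact inferInstanceAs (FiniteDimensional K (Z ⊔ (growth t Z b).map t : Submodule K N))

lemma growth_add (b c : ℕ) :
    growth t Z (b + c) = growth t Z b ⊔ (growth t Z c).map (t ^ b) := by
  induction b with
  | zero => simp [growth, Module.End.one_eq_id]
  | succ b ih =>
    rw [show b + 1 + c = (b + c) + 1 by ring, growth, ih, Submodule.map_sup, ← sup_assoc, growth,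
      ← Submodule.map_comp, pow_succ']
    rfl

lemma growth_mono {b c : ℕ} (h : b ≤ c) : growth t Z b ≤ growth t Z c := by
  obtain ⟨d, rfl⟩ := Nat.exists_eq_add_of_le h
  rw [growth_add]
  exact le_sup_left

lemma map_growth_le (b c : ℕ) : (growth t Z c).map (t ^ b) ≤ growth t Z (b + c) := by
  rw [growth_add]
  exact le_sup_right

variable {t} (ht : Function.Injective t)
include ht

lemma injective_pow (n : ℕ) : Function.Injective (t ^ n) := by
  rw [Module.End.coe_pow]
  exact ht.iterate n

lemma finrank_map_growth (b c : ℕ) : Module.finrank K ((growth t Z c).map (t ^ b)) =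
    Module.finrank K (growth t Z c) :=
  (Submodule.equivMapOfInjective _ (injective_pow ht b) _).finrank_eq.symm

variable [FiniteDimensional K Z]

/-- `growth (b + 2)` lies in the sum of `growth (b + 1)` and its translate by `t`, while the
intersection of these two contains the translate of `growth b`. As `t` is injective, translates keep
their dimension. -/
lemma finrank_growth_concave (b : ℕ) : Module.finrank K (growth t Z (b + 2)) +
    Module.finrank K (growth t Z b) ≤ 2 * Module.finrank K (growth t Z (b + 1)) := by
  have h1 := Submodule.finrank_sup_add_finrank_inf_eq (growth t Z (b + 1))
    ((growth t Z (b + 1)).map (t ^ 1))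
  have h2 : growth t Z (b + 2) ≤ growth t Z (b + 1) ⊔ (growth t Z (b + 1)).map (t ^ 1) := by
    rw [show b + 2 = 1 + (b + 1) by ring, growth_add]
    exact sup_le_sup_right (growth_mono t Z (by omega)) _
  have h3 : (growth t Z b).map (t ^ 1) ≤
      growth t Z (b + 1) ⊓ (growth t Z (b + 1)).map (t ^ 1) :=
    le_inf ((map_growth_le t Z 1 b).trans (by rw [add_comm]))
      (Submodule.map_mono (growth_mono t Z (by omega)))
  have h2' := Submodule.finrank_mono h2
  have h3' := Submodule.finrank_mono h3
  rw [finrank_map_growth Z ht] at h1 h3'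
  omega

/-- The dimension of `growth` is eventually linear. -/
lemma exists_finrank_growth_bounds : ∃ r k : ℕ,
    (∀ n, Module.finrank K (growth t Z n) ≤ k + r * n) ∧
    ∀ n c, Module.finrank K (growth t Z n) + r * c ≤ Module.finrank K (growth t Z (n + c)) := by
  let d : ℕ → ℕ := fun n => Module.finrank K (growth t Z n)
  have hmono : Monotone d := fun _ _ h => Submodule.finrank_mono (growth_mono t Z h)
  let D : ℕ → ℕ := fun n => d (n + 1) - d n
  have hd : ∀ n, d (n + 1) = d n + D n := fun n => by
    have := hmono (Nat.le_succ n)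
    simp only [D]
    change d n ≤ d (n + 1) at this
    omega
  have hD : Antitone D := antitone_nat_of_succ_le fun n => by
    have h1 : d (n + 2) + d n ≤ 2 * d (n + 1) := finrank_growth_concave Z ht n
    have h2 := hd n
    have h3 := hd (n + 1)
    change d (n + 2) = _ at h3
    omega
  -- By concavity the increments `D` decrease in `ℕ`, so they are constant from an index `n₀` on.
  -- Their final value is the rate `r`, and `d n₀` serves as the additive constant.
  obtain ⟨n₀, hn₀⟩ : ∃ n₀, ∀ n, D n₀ ≤ D n := ⟨_, fun n => Function.argmin_le D n⟩
  refine ⟨D n₀, d n₀, ?_, ?_⟩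
  · have key : ∀ c, d (n₀ + c) = d n₀ + D n₀ * c := by
      intro c
      induction c with
      | zero => simp
      | succ c ih =>
        rw [← add_assoc, hd, ih, le_antisymm (hD (Nat.le_add_right n₀ c)) (hn₀ _)]
        ring
    intro n
    rcases le_total n₀ n with h | h
    · obtain ⟨c, rfl⟩ := Nat.exists_eq_add_of_le h
      have := key c
      change d (n₀ + c) ≤ _
      rw [this]
      nlinarith
    · exact (hmono h).trans (Nat.le_add_right _ _)
  · intro n c
    change d n + _ ≤ d (n + c)
    induction c with
    | zero => simp
    | succ c ih =>
      rw [← add_assoc, hd]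
      have := hn₀ (n + c)
      rw [mul_add]
      omega

/-- The sum of the two subspaces contains `growth (b + c)`, whose dimension is at least that of
`growth b` plus `r c`, and `growth (a + c)` has dimension at most `k + r (a + c)`. The dimension
formula leaves at most `k + r a` for the intersection, independently of `b` and `c`. -/
lemma exists_finrank_inf_le (a : ℕ) : ∃ k : ℕ, ∀ b c,
    Module.finrank K ((growth t Z b).map (t ^ c) ⊓ growth t Z (a + c) : Submodule K N) ≤ k := by
  obtain ⟨r, k, h1, h2⟩ := exists_finrank_growth_bounds Z ht
  refine ⟨k + r * a, fun b c => ?_⟩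
  have e := Submodule.finrank_sup_add_finrank_inf_eq ((growth t Z b).map (t ^ c))
    (growth t Z (a + c))
  have h3 : growth t Z (c + b) ≤ (growth t Z b).map (t ^ c) ⊔ growth t Z (a + c) := by
    rw [growth_add, sup_comm]
    exact sup_le_sup_left (growth_mono t Z (by omega)) _
  have h3' := Submodule.finrank_mono h3
  rw [finrank_map_growth Z ht] at e
  have h4 := h1 (a + c)
  have h5 := h2 b c
  rw [add_comm b c] at h5
  rw [mul_add] at h4
  omega

end growth

lemma finiteDimensional_of_card_le (S : Submodule K N) (k : ℕ)
    (H : ∀ W : Submodule K N, W ≤ S → FiniteDimensional K W → Module.finrank K W ≤ k) :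
    FiniteDimensional K S := by
  have hr : Module.rank K S ≤ k := by
    apply rank_le
    intro s hs
    have h1 := finrank_span_finset_eq_card hs
    let W := (Submodule.span K (s : Set S)).map S.subtype
    have h2 : Module.finrank K W = Module.finrank K (Submodule.span K (s : Set S)) :=
      (Submodule.equivMapOfInjective _ S.injective_subtype _).finrank_eq.symm
    rw [← h1, ← h2]
    have : FiniteDimensional K (Submodule.span K (s : Set S)) := FiniteDimensional.span_finset K s
    exact H W (Submodule.map_subtype_le _ _) inferInstance
  exact Module.rank_lt_aleph0_iff.mp (hr.trans_lt (Cardinal.natCast_lt_aleph0))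

variable {x : A →ₗ[K] A} {y : B →ₗ[K] B} {t t' : N →ₗ[K] N} {φ : A →ₗ[K] N}
    {ψ : B →ₗ[K] N}

namespace IsChart

variable (H : IsChart x y t t' φ ψ)
include H

lemma injective_t : Function.Injective t := fun a b h => by rw [← H.t't a, h, H.t't]

lemma t'_pow_t_pow (k : ℕ) (n : N) : (t' ^ k) ((t ^ k) n) = n := by
  induction k generalizing n with
  | zero => rfl
  | succ k ih => rw [pow_succ, pow_succ', Module.End.mul_apply, Module.End.mul_apply, H.t't, ih]

lemma ψ_pow (k : ℕ) (b : B) : ψ ((y ^ k) b) = (t' ^ k) (ψ b) := by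
  induction k with
  | zero => rfl
  | succ k ih => rw [pow_succ', pow_succ', Module.End.mul_apply, H.hψ, ih, Module.End.mul_apply]

lemma finiteDimensional_ker_φ : FiniteDimensional K (LinearMap.ker φ) :=
  finiteDimensional_of_torsion H.fgA _ (fun a ha => by
    have ha : φ a = 0 := ha
    change φ (x a) = 0
    rw [H.hφ, ha, map_zero]) fun a ha => H.kerφ a ha

lemma finiteDimensional_ker_ψ : FiniteDimensional K (LinearMap.ker ψ) :=
  finiteDimensional_of_torsion H.fgB _ (fun a ha => by
    have ha : ψ a = 0 := ha
    change ψ (y a) = 0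
    rw [H.hψ, ha, map_zero]) fun a ha => H.kerψ a ha

/-- This is the finiteness of the space of global sections, up to the kernels of `φ` and `ψ`. An
element of `range φ` involves only powers `t ^ n` with `n ≥ 0` of generators, and one of `range ψ`
has a pole of bounded order `a` at the other end. After translation by a high power of `t`, a
finite-dimensional subspace satisfying both conditions lands in the intersection bounded by
`exists_finrank_inf_le`. -/
lemma finiteDimensional_inf :
    FiniteDimensional K (LinearMap.range φ ⊓ LinearMap.range ψ : Submodule K N) := by
  classical
  obtain ⟨s, hs⟩ := H.fgA
  obtain ⟨s', hs'⟩ := H.fgB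
  let Z : Submodule K N := Submodule.span K ((s.image φ : Finset N) : Set N)
  have : FiniteDimensional K Z := FiniteDimensional.span_finset K _
  -- elements of the range of `φ` lie in some `growth t Z b`
  have h1 : ∀ a, ∃ b, φ a ∈ growth t Z b := by
    let S : Submodule K A :=
      { carrier := {a | ∃ b, φ a ∈ growth t Z b}
        add_mem' := by
          rintro a a' ⟨b, hb⟩ ⟨b', hb'⟩
          refine ⟨max b b', ?_⟩
          rw [map_add]
          exact Submodule.add_mem _ (growth_mono t Z (le_max_left _ _) hb)
            (growth_mono t Z (le_max_right _ _) hb')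
        zero_mem' := ⟨0, by rw [map_zero]; exact Submodule.zero_mem _⟩
        smul_mem' := by
          rintro r a ⟨b, hb⟩
          exact ⟨b, by rw [map_smul]; exact Submodule.smul_mem _ _ hb⟩ }
    have hS : S = ⊤ := hs S (fun a ha => ⟨1, Submodule.mem_sup_left (Submodule.subset_span (by
      rw [Finset.coe_image]; exact ⟨a, ha, rfl⟩))⟩) (by
      rintro a ⟨b, hb⟩
      refine ⟨b + 1, Submodule.mem_sup_right ?_⟩
      rw [H.hφ]
      exact ⟨_, hb, rfl⟩)
    intro a
    have : a ∈ S := hS ▸ Submodule.mem_top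
    exact this
  -- elements of the range of `ψ` are bounded above
  have h2 : ∃ a, ∀ b, ∃ c₀, ∀ c, c₀ ≤ c → (t ^ c) (ψ b) ∈ growth t Z (a + c) := by
    have h3 : ∀ b, ∃ k l, (t ^ k) (ψ b) ∈ growth t Z l := by
      intro b
      obtain ⟨k, a, ha⟩ := H.surjφ (ψ b)
      obtain ⟨l, hl⟩ := h1 a
      exact ⟨k, l, ha ▸ hl⟩
    choose k l hl using h3
    let S : Submodule K B :=
      { carrier := {b | ∃ c₀, ∀ c, c₀ ≤ c → (t ^ c) (ψ b) ∈ growth t Z (s'.sup l + c)}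
        add_mem' := by
          rintro a a' ⟨b, hb⟩ ⟨b', hb'⟩
          refine ⟨max b b', fun c hc => ?_⟩
          rw [map_add, map_add]
          exact Submodule.add_mem _ (hb c ((le_max_left _ _).trans hc))
            (hb' c ((le_max_right _ _).trans hc))
        zero_mem' := ⟨0, fun c _ => by rw [map_zero, map_zero]; exact Submodule.zero_mem _⟩
        smul_mem' := by
          rintro r a ⟨b, hb⟩
          exact ⟨b, fun c hc => by
            rw [map_smul, map_smul]; exact Submodule.smul_mem _ _ (hb c hc)⟩ }
    have hS : S = ⊤ := hs' S (fun b hb => ⟨k b, fun c hc => by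
        rw [← Nat.sub_add_cancel hc, pow_add, Module.End.mul_apply]
        refine growth_mono t Z ?_ (map_growth_le t Z (c - k b) (l b) ⟨_, hl b, rfl⟩)
        have : l b ≤ s'.sup l := Finset.le_sup hb
        omega⟩) (by
      rintro b ⟨c₀, hc₀⟩
      refine ⟨c₀ + 1, fun c hc => ?_⟩
      obtain ⟨c, rfl⟩ : ∃ c', c = c' + 1 := ⟨c - 1, by omega⟩
      rw [H.hψ, pow_succ, Module.End.mul_apply, H.tt']
      exact growth_mono t Z (by omega) (hc₀ c (by omega)))
    refine ⟨s'.sup l, fun b => ?_⟩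
    have : b ∈ S := hS ▸ Submodule.mem_top
    exact this
  obtain ⟨a, ha⟩ := h2
  obtain ⟨k, hk⟩ := exists_finrank_inf_le Z H.injective_t a
  apply finiteDimensional_of_card_le _ k
  intro W hW hWf
  obtain ⟨g, hg⟩ : W.FG := Module.Finite.iff_fg.mp hWf
  have hgW : ∀ z ∈ g, z ∈ W := fun z hz => hg ▸ Submodule.subset_span hz
  have h4 : ∀ z ∈ g, ∃ b, z ∈ growth t Z b := fun z hz => by
    obtain ⟨w, rfl⟩ := (hW (hgW z hz)).1
    exact h1 w
  have h5 : ∀ z ∈ g, ∃ c₀, ∀ c, c₀ ≤ c → (t ^ c) z ∈ growth t Z (a + c) := fun z hz => by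
    obtain ⟨w, rfl⟩ := (hW (hgW z hz)).2
    exact ha w
  choose! b hb using h4
  choose! c hc using h5
  have hWb : W.map (t ^ (g.sup c)) ≤ (growth t Z (g.sup b)).map (t ^ (g.sup c)) ⊓
      growth t Z (a + g.sup c) := by
    rw [← hg, Submodule.map_span, Submodule.span_le]
    rintro _ ⟨z, hz, rfl⟩
    exact ⟨⟨z, growth_mono t Z (Finset.le_sup hz) (hb z hz), rfl⟩,
      hc z hz _ (Finset.le_sup hz)⟩
  rw [(Submodule.equivMapOfInjective _ (injective_pow H.injective_t (g.sup c)) W).finrank_eq]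
  exact (Submodule.finrank_mono hWb).trans (hk _ _)

/-- Finite-dimensionality of the cohomology. -/
theorem isFredholm : IsFredholm (φ.coprod (-ψ)) := by
  classical
  constructor
  · have := H.finiteDimensional_ker_φ
    have := H.finiteDimensional_ker_ψ
    have := H.finiteDimensional_inf
    -- The map `(a, b) ↦ φ a = ψ b` sends the kernel to `range φ ⊓ range ψ`, and its own kernel
    -- embeds in `ker φ × ker ψ`.
    let g : LinearMap.ker (φ.coprod (-ψ)) →ₗ[K] (LinearMap.range φ ⊓ LinearMap.range ψ :
        Submodule K N) := (φ ∘ₗ LinearMap.fst K A B ∘ₗ Submodule.subtype _).codRestrict _ (by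
      rintro ⟨⟨a, b⟩, h⟩
      rw [LinearMap.mem_ker, LinearMap.coprod_apply, LinearMap.neg_apply, ← sub_eq_add_neg,
        sub_eq_zero] at h
      exact ⟨⟨a, rfl⟩, ⟨b, h.symm⟩⟩)
    let k : LinearMap.ker g →ₗ[K] (LinearMap.ker φ × LinearMap.ker ψ) :=
      { toFun := fun z => (⟨z.1.1.1, congrArg Subtype.val z.2⟩, ⟨z.1.1.2, by
          have h := z.1.2
          have h' : φ z.1.1.1 = 0 := congrArg Subtype.val z.2
          rw [LinearMap.mem_ker, LinearMap.coprod_apply, h', zero_add, LinearMap.neg_apply,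
            neg_eq_zero] at h
          exact h⟩)
        map_add' := fun _ _ => rfl
        map_smul' := fun _ _ => rfl }
    have hk : Function.Injective k := by
      intro z w h
      have h1 := congrArg (fun u => u.1.1) h
      have h2 := congrArg (fun u => u.2.1) h
      exact Subtype.ext (Subtype.ext (Prod.ext h1 h2))
    have : FiniteDimensional K (LinearMap.ker g) := FiniteDimensional.of_injective k hk
    have : FiniteDimensional K (LinearMap.ker (φ.coprod (-ψ)) ⧸ LinearMap.ker g) :=
      FiniteDimensional.of_injective ((LinearMap.ker g).liftQ g le_rfl)
        (LinearMap.ker_eq_bot.mp (Submodule.ker_liftQ_eq_bot _ _ _ le_rfl))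
    exact Module.Finite.of_submodule_quotient (LinearMap.ker g)
  · obtain ⟨s, hs⟩ := H.fgA
    have h1 : ∀ a, ∃ k, (t' ^ k) (φ a) ∈ LinearMap.range ψ := fun a => by
      obtain ⟨k, b, hb⟩ := H.surjψ (φ a)
      exact ⟨k, b, hb⟩
    choose k hk using h1
    have hk' : ∀ a j, k a ≤ j → (t' ^ j) (φ a) ∈ LinearMap.range ψ := by
      intro a j hj
      obtain ⟨b, hb⟩ := hk a
      rw [← Nat.sub_add_cancel hj, pow_add, Module.End.mul_apply, ← hb, ← H.ψ_pow]
      exact ⟨_, rfl⟩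
    -- High powers of `t'` carry `φ a` into `range ψ`. Modulo `T`, only the elements `t' ^ j (φ a)`
    -- with `a` a generator and `j` below the common exponent can survive, and `N` consists of
    -- elements `t' ^ j (φ a)`.
    let G : Finset N := (s ×ˢ Finset.range (s.sup k)).image fun z => (t' ^ z.2) (φ z.1)
    let T := LinearMap.range (φ.coprod (-ψ))
    have hφT : ∀ a, φ a ∈ T := fun a => ⟨(a, 0), by simp⟩
    have hψT : ∀ b, ψ b ∈ T := fun b => ⟨(0, -b), by simp⟩
    let W := T ⊔ Submodule.span K (G : Set N)
    let S : Submodule K A :=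
      { carrier := {a | ∀ j : ℕ, (t' ^ j) (φ a) ∈ W}
        add_mem' := fun ha hb j => by rw [map_add, map_add]; exact W.add_mem (ha j) (hb j)
        zero_mem' := fun j => by rw [map_zero, map_zero]; exact W.zero_mem
        smul_mem' := fun r a ha j => by rw [map_smul, map_smul]; exact W.smul_mem _ (ha j) }
    have hS : S = ⊤ := by
      apply hs
      · intro a ha j
        by_cases hj : j < s.sup k
        · apply Submodule.mem_sup_right
          apply Submodule.subset_span
          rw [Finset.coe_image]
          exact ⟨(a, j), Finset.mem_coe.mpr (Finset.mem_product.mpr ⟨ha, Finset.mem_range.mpr hj⟩), rfl⟩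
        · obtain ⟨b, hb⟩ := hk' a j ((Finset.le_sup ha).trans (not_lt.mp hj))
          rw [← hb]
          exact Submodule.mem_sup_left (hψT b)
      · intro a ha j
        cases j with
        | zero => exact Submodule.mem_sup_left (hφT _)
        | succ j =>
          rw [H.hφ, pow_succ, Module.End.mul_apply, H.t't]
          exact ha j
    have hW : W = ⊤ := by
      rw [eq_top_iff]
      intro n _
      obtain ⟨k, a, ha⟩ := H.surjφ n
      have h2 : a ∈ S := hS ▸ Submodule.mem_top
      rw [← H.t'_pow_t_pow k n, ← ha]
      exact h2 k
    have : FiniteDimensional K (Submodule.span K (G : Set N)) := FiniteDimensional.span_finset K G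
    refine Module.Finite.of_surjective (T.mkQ ∘ₗ (Submodule.span K (G : Set N)).subtype) ?_
    intro q
    obtain ⟨a, rfl⟩ := T.mkQ_surjective q
    obtain ⟨b, hb, c, hc, rfl⟩ := Submodule.mem_sup.mp (hW ▸ Submodule.mem_top : a ∈ W)
    refine ⟨⟨c, hc⟩, ?_⟩
    simp only [LinearMap.comp_apply, Submodule.subtype_apply, map_add]
    rw [show T.mkQ b = 0 from (Submodule.Quotient.mk_eq_zero T).mpr hb, zero_add]

end IsChart

end chart

/-! ### Twisting the gluing by powers of an automorphism -/

section linearity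

variable {K : Type*} [Field K] {A B N : Type*} [AddCommGroup A] [Module K A] [AddCommGroup B]
  [Module K B] [AddCommGroup N] [Module K N] {x : A →ₗ[K] A} {y : B →ₗ[K] B}
  {t t' : N →ₗ[K] N} {φ : A →ₗ[K] N} {ψ : B →ₗ[K] N}

lemma pow_comm_apply {v w : N →ₗ[K] N} (h : ∀ n, v (w n) = w (v n)) (k : ℕ) (n : N) :
    v ((w ^ k) n) = (w ^ k) (v n) := by
  induction k generalizing n with
  | zero => rfl
  | succ k ih => rw [pow_succ, Module.End.mul_apply, ih, h, Module.End.mul_apply]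

lemma pow_inverse_apply {v v' : N →ₗ[K] N} (h : ∀ n, v (v' n) = n) (k : ℕ) (n : N) :
    (v ^ k) ((v' ^ k) n) = n := by
  induction k generalizing n with
  | zero => rfl
  | succ k ih => rw [pow_succ, pow_succ', Module.End.mul_apply, Module.End.mul_apply, h, ih]

namespace IsChart

variable (H : IsChart x y t t' φ ψ)
include H

/-- Changing the gluing by an automorphism. -/
lemma comp_aut {u u' : N →ₗ[K] N} (huu' : ∀ n, u (u' n) = n) (hu'u : ∀ n, u' (u n) = n)
    (hut' : ∀ n, u (t' n) = t' (u n)) : IsChart x y t t' φ (u ∘ₗ ψ) where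
  fgA := H.fgA
  fgB := H.fgB
  tt' := H.tt'
  t't := H.t't
  hφ := H.hφ
  hψ b := by rw [LinearMap.comp_apply, H.hψ, hut']; rfl
  kerφ := H.kerφ
  kerψ b hb := H.kerψ b (by
    rw [← hu'u (ψ b)]
    exact (congrArg u' hb).trans (map_zero _))
  surjφ := H.surjφ
  surjψ n := by
    obtain ⟨k, b, hb⟩ := H.surjψ (u' n)
    refine ⟨k, b, ?_⟩
    rw [LinearMap.comp_apply, hb, pow_comm_apply hut', huu']

/-- An endomorphism of `B` that becomes invertible over the intersection of the charts. -/
lemma isFredholm_of_aut (a : B →ₗ[K] B) {v v' : N →ₗ[K] N} (hvv' : ∀ n, v (v' n) = n)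
    (hv'v : ∀ n, v' (v n) = n)
    (hvt' : ∀ n, v (t' n) = t' (v n)) (hay : ∀ b, a (y b) = y (a b)) (ha : ∀ b, ψ (a b) = v (ψ b)) :
    IsFredholm a := by
  constructor
  · refine finiteDimensional_of_torsion H.fgB _ (fun b hb => ?_) fun b hb => ?_
    · have hb : a b = 0 := hb
      change a (y b) = 0
      rw [hay, hb, map_zero]
    · have hb : a b = 0 := hb
      apply H.kerψ
      rw [← hv'v (ψ b), ← ha, hb, map_zero, map_zero]
  · refine finiteDimensional_quotient_of_torsion H.fgB _ ?_ fun b => ?_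
    · rintro _ ⟨b, rfl⟩
      exact ⟨y b, hay b⟩
    -- The equation `v n = ψ b` is solvable in `N`; its solution lifts to `b'` after applying `t' ^
    -- k`. The error `y ^ k b - a b'` dies in `N`, so a further power of `y` kills it: the cokernel
    -- of `a` is `y`-torsion.
    · obtain ⟨k, b', hb'⟩ := H.surjψ (v' (ψ b))
      have hcomm : ∀ (k : ℕ) b, a ((y ^ k) b) = (y ^ k) (a b) := pow_comm_apply hay
      have hz : ψ ((y ^ k) b - a b') = 0 := by
        rw [map_sub, H.ψ_pow, ha, hb', pow_comm_apply hvt', hvv', sub_self]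
      obtain ⟨l, hl⟩ := H.kerψ _ hz
      refine ⟨l + k, (y ^ l) b', ?_⟩
      rw [map_sub, sub_eq_zero] at hl
      rw [hcomm, ← hl, pow_add, Module.End.mul_apply]

end IsChart

/-- The index of the gluing by `u ^ k` is an affine function of `k`. -/
theorem IsChart.index_pow (H : IsChart x y t t' φ ψ) {u u' : N →ₗ[K] N}
    (huu' : ∀ n, u (u' n) = n) (hu'u : ∀ n, u' (u n) = n) (hut' : ∀ n, u (t' n) = t' (u n))
    (a : B →ₗ[K] B) (m : ℕ) (hay : ∀ b, a (y b) = y (a b))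
    (ha : ∀ b, ψ (a b) = u ((t' ^ m) (ψ b))) (k : ℕ) :
    (φ.coprod (-((u ^ k) ∘ₗ ψ))).index =
      (a.index - (y ^ m).index) * k + (φ.coprod (-ψ)).index := by
  have comm : ∀ k n, (u ^ k) (t' n) = t' ((u ^ k) n) := fun k n =>
    (pow_comm_apply (fun n => (hut' n).symm) k n).symm
  have hk : ∀ k, IsFredholm (φ.coprod (-((u ^ k) ∘ₗ ψ))) := fun k =>
    (H.comp_aut (u' := u' ^ k) (pow_inverse_apply huu' k) (pow_inverse_apply hu'u k)
      (comm k)).isFredholm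
  have hA : IsFredholm a := H.isFredholm_of_aut a (v := u ∘ₗ (t' ^ m)) (v' := (t ^ m) ∘ₗ u')
    (fun n => by simp only [LinearMap.comp_apply, pow_inverse_apply H.t't, huu'])
    (fun n => by simp only [LinearMap.comp_apply, pow_inverse_apply H.tt', hu'u])
    (fun n => by
      rw [LinearMap.comp_apply, LinearMap.comp_apply, ← hut']
      congr 1
      exact (pow_comm_apply (fun _ => rfl) m n).symm) hay ha
  have hY : IsFredholm (y ^ m) := H.isFredholm_of_aut _ (v := t' ^ m) (v' := t ^ m)
    (pow_inverse_apply H.t't m) (pow_inverse_apply H.tt' m)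
    (fun n => (pow_comm_apply (fun _ => rfl) m n).symm)
    (fun n => (pow_comm_apply (fun _ => rfl) m n).symm) (H.ψ_pow m)
  induction k with
  | zero => simp [Module.End.one_eq_id]
  | succ k ih =>
    -- Here `a` plays the role of `u y ^ m`, with `m` clearing the pole of `u`. Both composites send
    -- `(b, c)` to `φ b - u ^ (k + 1) t' ^ m ψ c`, so comparison of indices shows that one step in
    -- `k` adds `a.index - (y ^ m).index`.
    have e : (φ.coprod (-((u ^ k) ∘ₗ ψ))) ∘ₗ (LinearMap.id : A →ₗ[K] A).prodMap a =
        (φ.coprod (-((u ^ (k + 1)) ∘ₗ ψ))) ∘ₗ (LinearMap.id : A →ₗ[K] A).prodMap (y ^ m) := by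
      apply LinearMap.ext
      rintro ⟨b, c⟩
      simp only [LinearMap.comp_apply, LinearMap.prodMap_apply, LinearMap.coprod_apply,
        LinearMap.id_apply, LinearMap.neg_apply, ha, H.ψ_pow, pow_succ, Module.End.mul_apply]
    have e1 := (hk k).index_comp (isFredholm_id_prodMap hA A).1
    have e2 := (hk (k + 1)).index_comp (isFredholm_id_prodMap hY A).1
    rw [e, e2, (isFredholm_id_prodMap hA A).2, (isFredholm_id_prodMap hY A).2, ih] at e1
    push_cast
    linarith

end linearity

/-! ### The slope of the index as a rank -/

section rank

variable {K : Type*} [Field K] {A B N : Type*} [AddCommGroup A] [Module K A] [AddCommGroup B]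
  [Module K B] [AddCommGroup N] [Module K N]

lemma finiteDimensional_of_ker_range (f : A →ₗ[K] N) [FiniteDimensional K (LinearMap.ker f)]
    [FiniteDimensional K (LinearMap.range f)] : FiniteDimensional K A := by
  have : Module.Finite K (A ⧸ LinearMap.ker f) := Module.Finite.equiv f.quotKerEquivRange.symm
  exact Module.Finite.of_submodule_quotient (LinearMap.ker f)

lemma IsFGUnder.map {y : A →ₗ[K] A} (h : IsFGUnder y) {y' : B →ₗ[K] B} (p : A →ₗ[K] B)
    (hp : Function.Surjective p) (hy : ∀ a, p (y a) = y' (p a)) : IsFGUnder y' := by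
  classical
  obtain ⟨s, hs⟩ := h
  refine ⟨s.image p, fun S hS hyS => ?_⟩
  have h1 := hs (S.comap p) (fun a ha => hS (Finset.mem_coe.mpr (Finset.mem_image_of_mem p ha)))
    fun a ha => by
      change p (y a) ∈ S
      rw [hy]
      exact hyS _ ha
  rw [eq_top_iff]
  intro b _
  obtain ⟨a, rfl⟩ := hp b
  have : a ∈ S.comap p := h1 ▸ Submodule.mem_top
  exact this

/-- A finitely generated `K[y]`-module on which `y` is bijective is finite dimensional. -/
lemma IsFGUnder.finiteDimensional_of_bijective {y : A →ₗ[K] A} (h : IsFGUnder y)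
    (hy : Function.Bijective y) : FiniteDimensional K A := by
  classical
  obtain ⟨s, hs⟩ := h
  let Z : Submodule K A := Submodule.span K (s : Set A)
  have hZ : FiniteDimensional K Z := FiniteDimensional.span_finset K s
  have hsup : ⨆ n, growth y Z n = ⊤ := by
    have hdir : Directed (· ≤ ·) (growth y Z) := (monotone_nat_of_le_succ fun n =>
      growth_mono y Z (Nat.le_succ n)).directed_le
    apply hs
    · exact fun a ha => Submodule.mem_iSup_of_mem 1 (Submodule.mem_sup_left
        (Submodule.subset_span ha))
    · intro a ha
      obtain ⟨n, hn⟩ := (Submodule.mem_iSup_of_directed _ hdir).mp ha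
      exact Submodule.mem_iSup_of_mem (n + 1) (Submodule.mem_sup_right ⟨a, hn, rfl⟩)
  have hex : ∀ a : A, ∃ n, ∃ b ∈ growth y Z n, y b = a := by
    intro a
    obtain ⟨b, hb⟩ := hy.2 a
    have hdir : Directed (· ≤ ·) (growth y Z) := (monotone_nat_of_le_succ fun n =>
      growth_mono y Z (Nat.le_succ n)).directed_le
    have hb' : b ∈ ⨆ n, growth y Z n := hsup ▸ Submodule.mem_top
    obtain ⟨n, hn⟩ := (Submodule.mem_iSup_of_directed _ hdir).mp hb'
    exact ⟨n, b, hn, hb⟩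
  choose n b hb hyb using hex
  -- Each generator has a preimage under `y` in some `growth`, and `m` bounds all these levels. Then
  -- `growth (m + 1)` is the image of `growth m` under the injective map `y`, so the two have equal
  -- dimension and the growth stops.
  let m := ∑ a ∈ s, n a
  have hle : Z ≤ (growth y Z m).map y := by
    rw [Submodule.span_le]
    intro a ha
    exact ⟨b a, growth_mono y Z (Finset.single_le_sum (f := n) (fun _ _ => Nat.zero_le _) ha) (hb a),
      hyb a⟩
  have h1 : growth y Z (m + 1) = (growth y Z m).map y := sup_eq_right.mpr hle
  have h2 : growth y Z m = growth y Z (m + 1) := by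
    apply Submodule.eq_of_le_of_finrank_eq (growth_mono y Z (Nat.le_succ m))
    rw [h1]
    exact (Submodule.equivMapOfInjective _ hy.1 _).finrank_eq
  have htop : growth y Z m = ⊤ := by
    apply hs
    · intro a ha
      rw [h2, h1]
      exact hle (Submodule.subset_span ha)
    · intro a ha
      rw [h2, h1]
      exact ⟨a, ha, rfl⟩
  have : FiniteDimensional K (⊤ : Submodule K A) := htop ▸ inferInstance
  exact Module.Finite.equiv (Submodule.topEquiv (R := K) (M := A))

/-- The index of `y` on a finitely generated `K[y]`-module is minus its rank. -/
lemma IsFGUnder.index_nonpos {y : B →ₗ[K] B} (h : IsFGUnder y) :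
    y.index ≤ 0 ∧ (y.index = 0 → FiniteDimensional K B) := by
  -- `T` is the `y`-torsion. It is finite-dimensional and contributes index 0; on the torsion-free
  -- quotient `y` is injective, so its index there is minus the dimension of its cokernel.
  let T : Submodule K B :=
    { carrier := {b | ∃ n : ℕ, (y ^ n) b = 0}
      zero_mem' := ⟨0, map_zero _⟩
      add_mem' := by
        rintro a b ⟨n, hn⟩ ⟨m, hm⟩
        have h1 : (y ^ (n + m)) a = 0 := by
          rw [add_comm, pow_add, Module.End.mul_apply, hn, map_zero]
        have h2 : (y ^ (n + m)) b = 0 := by rw [pow_add, Module.End.mul_apply, hm, map_zero]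
        exact ⟨n + m, by rw [map_add, h1, h2, add_zero]⟩
      smul_mem' := by
        rintro c b ⟨n, hn⟩
        exact ⟨n, by rw [map_smul, hn, smul_zero]⟩ }
  have hyT : ∀ b ∈ T, y b ∈ T := by
    rintro b ⟨n, hn⟩
    refine ⟨n, ?_⟩
    rw [← Module.End.mul_apply, ← pow_succ, pow_succ', Module.End.mul_apply, hn, map_zero]
  have hT : FiniteDimensional K T := finiteDimensional_of_torsion h T hyT fun a ha => ha
  let yT : T →ₗ[K] T := y.restrict hyT
  let yQ : (B ⧸ T) →ₗ[K] (B ⧸ T) := T.mapQ T y hyT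
  have hFG : IsFGUnder yQ := h.map T.mkQ T.mkQ_surjective fun _ => rfl
  have hinj : Function.Injective yQ := by
    rw [← LinearMap.ker_eq_bot, LinearMap.ker_eq_bot']
    intro q hq
    obtain ⟨b, rfl⟩ := T.mkQ_surjective q
    have h1 : T.mkQ (y b) = 0 := hq
    rw [Submodule.mkQ_apply, Submodule.Quotient.mk_eq_zero] at h1
    obtain ⟨n, hn⟩ := h1
    rw [Submodule.mkQ_apply, Submodule.Quotient.mk_eq_zero]
    exact ⟨n + 1, by rwa [pow_succ, Module.End.mul_apply]⟩
  have hcoker : FiniteDimensional K ((B ⧸ T) ⧸ LinearMap.range yQ) :=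
    finiteDimensional_quotient_of_torsion hFG _
      (by rintro _ ⟨b, rfl⟩; exact ⟨yQ b, rfl⟩) fun b => ⟨1, b, by rw [pow_one]⟩
  have hker : FiniteDimensional K (LinearMap.ker yQ) := by
    rw [LinearMap.ker_eq_bot.mpr hinj]
    infer_instance
  have hindex : y.index = yT.index + yQ.index := by
    have hex : ∀ a, T.mkQ a = 0 ↔ ∃ b, T.subtype b = a := fun a => by
      rw [Submodule.mkQ_apply, Submodule.Quotient.mk_eq_zero]
      exact ⟨fun h => ⟨⟨a, h⟩, rfl⟩, by rintro ⟨b, rfl⟩; exact b.2⟩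
    exact index_add_of_exact T.subtype T.mkQ T.subtype T.mkQ T.injective_subtype T.mkQ_surjective hex
      T.injective_subtype T.mkQ_surjective hex yT y yQ (fun _ => rfl) (fun _ => rfl)
      ⟨inferInstance, inferInstance⟩ ⟨hker, hcoker⟩
  rw [yT.index_eq_of_finiteDimensional, sub_self, zero_add,
    LinearMap.index_of_injective hinj] at hindex
  refine ⟨by omega, fun h0 => ?_⟩
  have h1 : Module.finrank K ((B ⧸ T) ⧸ LinearMap.range yQ) = 0 := by omega
  have h2 : LinearMap.range yQ = ⊤ := by
    rw [← Submodule.Quotient.subsingleton_iff]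
    exact Module.finrank_zero_iff.mp h1
  have : FiniteDimensional K (B ⧸ T) :=
    hFG.finiteDimensional_of_bijective ⟨hinj, LinearMap.range_eq_top.mp h2⟩
  exact Module.Finite.of_submodule_quotient T

namespace IsChart

variable {x : A →ₗ[K] A} {y : B →ₗ[K] B} {t t' : N →ₗ[K] N} {φ : A →ₗ[K] N} {ψ : B →ₗ[K] N}

/-- The injective map `t'` preserves the finite-dimensional space `range ψ`, hence permutes it.
Every element of `N` enters `range ψ` after finitely many `t'`, so `range ψ = N` and `N` is
finite-dimensional, as is the kernel of `φ`. -/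
lemma finiteDimensional_left (H : IsChart x y t t' φ ψ) [FiniteDimensional K B] :
    FiniteDimensional K A := by
  have ht'inj : Function.Injective t' := fun a b hab => by
    rw [← H.tt' a, hab, H.tt']
  have hmap : (LinearMap.range ψ).map t' = LinearMap.range ψ := by
    apply Submodule.eq_of_le_of_finrank_eq
    · rintro _ ⟨_, ⟨b, rfl⟩, rfl⟩
      exact ⟨y b, H.hψ b⟩
    · exact (Submodule.equivMapOfInjective _ ht'inj _).symm.finrank_eq
  have htop : LinearMap.range ψ = ⊤ := by
    rw [eq_top_iff]
    rintro n -
    obtain ⟨k, b, hb⟩ := H.surjψ n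
    have key : ∀ (k : ℕ) n, (t' ^ k) n ∈ LinearMap.range ψ → n ∈ LinearMap.range ψ := by
      intro k
      induction k with
      | zero => exact fun n h => h
      | succ k ih =>
        intro n h
        rw [pow_succ', Module.End.mul_apply] at h
        apply ih
        rw [← hmap] at h
        obtain ⟨n', hn', h'⟩ := h
        rw [← ht'inj h']
        exact hn'
    exact key k n ⟨b, hb⟩
  have hN : FiniteDimensional K N :=
    Module.Finite.of_surjective ψ (LinearMap.range_eq_top.mp htop)
  have := H.finiteDimensional_ker_φ
  exact finiteDimensional_of_ker_range φ

/-- The slope of the index, when a power of the gluing factors through `t` and automorphisms of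
the two sides. -/
lemma mul_slope (H : IsChart x y t t' φ ψ) {u u' : N →ₗ[K] N}
    (huu' : ∀ n, u (u' n) = n) (hu'u : ∀ n, u' (u n) = n) (hut' : ∀ n, u (t' n) = t' (u n))
    (a : B →ₗ[K] B) (m : ℕ) (hay : ∀ b, a (y b) = y (a b))
    (ha : ∀ b, ψ (a b) = u ((t' ^ m) (ψ b))) (n : ℕ) (α : A ≃ₗ[K] A) (αN : N ≃ₗ[K] N)
    (β : B ≃ₗ[K] B) (hα : ∀ a, φ (α a) = αN (φ a)) (hu : ∀ b, (u ^ n) (ψ b) = αN (t (ψ (β b)))) :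
    (a.index - (y ^ m).index) * n = -y.index := by
  have h1 := H.index_pow huu' hu'u hut' a m hay ha n
  -- The gluing by `t` satisfies the same hypotheses with `a = id` and `m = 1`, so it changes the
  -- index by `-y.index`. Through `α`, `αN` and `β` the gluing by `u ^ n` is equivalent to it.
  have h2 := H.index_pow (u := t) (u' := t') H.tt' H.t't (fun n => by rw [H.tt', H.t't])
    LinearMap.id 1 (fun _ => rfl) (fun b => by
      rw [pow_one, H.tt']
      rfl) 1
  have h3 : (φ.coprod (-((u ^ n) ∘ₗ ψ))).index = (φ.coprod (-((t ^ 1) ∘ₗ ψ))).index := by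
    symm
    refine index_congr (α.prodCongr β.symm) αN ?_
    rintro ⟨c, b⟩
    obtain ⟨b, rfl⟩ := β.surjective b
    simp only [LinearMap.coprod_apply, map_add, LinearMap.neg_apply, map_neg,
      LinearMap.comp_apply, pow_one, LinearEquiv.prodCongr_apply, LinearEquiv.symm_apply_apply]
    rw [hα, hu]
  rw [h1, h2, LinearMap.index_id, pow_one] at h3
  push_cast at h3
  linarith

end IsChart

end rank

/-! ### Sections of sheaves of modules -/

/-- Restriction of functions. -/
abbrev rres {U V : X.Opens} (h : V ≤ U) (a : Γ(X, U)) : Γ(X, V) :=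
  X.presheaf.map (homOfLE h).op a

lemma res_res (M : X.Modules) {U V W : X.Opens} (h : V ≤ U) (h' : W ≤ V) (t : Γ(M, U)) :
    res M h' (res M h t) = res M (h'.trans h) t := by
  simp only [res, ← ConcreteCategory.comp_apply, ← Functor.map_comp]
  rfl

lemma rres_rres {U V W : X.Opens} (h : V ≤ U) (h' : W ≤ V) (t : Γ(X, U)) :
    rres h' (rres h t) = rres (h'.trans h) t := by
  simp only [rres, ← ConcreteCategory.comp_apply, ← Functor.map_comp]
  rfl

@[simp] lemma res_self (M : X.Modules) {U : X.Opens} (h : U ≤ U) (t : Γ(M, U)) :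
    res M h t = t := by
  simp [res]

@[simp] lemma rres_self {U : X.Opens} (h : U ≤ U) (t : Γ(X, U)) : rres h t = t := by
  simp [rres]

lemma res_add (M : X.Modules) {U V : X.Opens} (h : V ≤ U) (s t : Γ(M, U)) :
    res M h (s + t) = res M h s + res M h t := map_add _ _ _

lemma res_sub (M : X.Modules) {U V : X.Opens} (h : V ≤ U) (s t : Γ(M, U)) :
    res M h (s - t) = res M h s - res M h t := map_sub _ _ _

@[simp] lemma res_zero (M : X.Modules) {U V : X.Opens} (h : V ≤ U) :
    res M h 0 = 0 := map_zero _

lemma res_smul (M : X.Modules) {U V : X.Opens} (h : V ≤ U) (a : Γ(X, U)) (t : Γ(M, U)) :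
    res M h (a • t) = rres h a • res M h t :=
  Scheme.Modules.map_smul M (homOfLE h) a t

lemma app_res {M N : X.Modules} (φ : M ⟶ N) {U V : X.Opens} (h : V ≤ U) (t : Γ(M, U)) :
    φ.app V (res M h t) = res N h (φ.app U t) :=
  ConcreteCategory.congr_hom (φ.mapPresheaf.naturality (homOfLE h).op) t

lemma res_bijective_of_eq (M : X.Modules) {U V : X.Opens} (h : V ≤ U) (h' : U ≤ V) :
    Function.Bijective (res M h) :=
  ⟨fun a b hab => by simpa [res_res] using congrArg (res M h') hab,
    fun b => ⟨res M h' b, by simp [res_res]⟩⟩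

lemma section_ext (M : X.Modules) {U : X.Opens} {a b : Γ(M, U)}
    (H : ∀ x ∈ U, ∃ (V : X.Opens) (h : V ≤ U), x ∈ V ∧ res M h a = res M h b) : a = b := by
  apply TopCat.Presheaf.IsSheaf.section_ext M.isSheaf
  intro x hx
  obtain ⟨V, h, hxV, e⟩ := H x hx
  exact ⟨V, h, hxV, e⟩

lemma section_ext_cover (M : X.Modules) {ι : Type*} {U : X.Opens} (V : ι → X.Opens)
    (hV : ∀ i, V i ≤ U) (hc : U ≤ ⨆ i, V i) {a b : Γ(M, U)}
    (H : ∀ i, res M (hV i) a = res M (hV i) b) : a = b := by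
  apply section_ext
  intro x hx
  obtain ⟨i, hi⟩ := Opens.mem_iSup.mp (hc hx)
  exact ⟨V i, hV i, hi, H i⟩

lemma exists_glue (M : X.Modules) {ι : Type} {U : X.Opens} (V : ι → X.Opens)
    (hV : ∀ i, V i ≤ U) (hc : U ≤ ⨆ i, V i) (s : ∀ i, Γ(M, V i))
    (H : ∀ i j, res M (inf_le_left : V i ⊓ V j ≤ V i) (s i) =
      res M (inf_le_right : V i ⊓ V j ≤ V j) (s j)) :
    ∃ t : Γ(M, U), ∀ i, res M (hV i) t = s i := by
  obtain ⟨t, ht, -⟩ := TopCat.Sheaf.existsUnique_gluing' ⟨_, M.isSheaf⟩ V U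
    (fun i => homOfLE (hV i)) hc s (fun i j => H i j)
  exact ⟨t, fun i => ht i⟩

/-! ### Localising sheaves -/

/-- `Γ(M, D(g))` is the localisation of `Γ(M, V)` at `g`. -/
structure IsLocalizingAt (M : X.Modules) {V : X.Opens} (g : Γ(X, V)) : Prop where
  exists_lift : ∀ x : Γ(M, X.basicOpen g), ∃ (n : ℕ) (y : Γ(M, V)),
    res M (X.basicOpen_le g) y = rres (X.basicOpen_le g) g ^ n • x
  exists_pow : ∀ y : Γ(M, V), res M (X.basicOpen_le g) y = 0 → ∃ n : ℕ, g ^ n • y = 0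

/-- Over every affine open set, the sections of `M` over basic open sets are localisations. -/
def IsLocalizing (M : X.Modules) : Prop :=
  ∀ (V : X.Opens), IsAffineOpen V → ∀ g : Γ(X, V), IsLocalizingAt M g

lemma isUnit_rres_basicOpen {V : X.Opens} (g : Γ(X, V)) :
    IsUnit (rres (X.basicOpen_le g) g) :=
  RingedSpace.isUnit_res_basicOpen X.toRingedSpace g

section restrict

variable {V : X.Opens} (hV : IsAffineOpen V) (M : X.Modules)

lemma fromSpec_image_le (W : (Spec Γ(X, V)).Opens) : hV.fromSpec ''ᵁ W ≤ V := by
  have := Scheme.Hom.image_le_opensRange hV.fromSpec W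
  rwa [hV.opensRange_fromSpec] at this

lemma restrictAppIso_fromSpec_smul (W : (Spec Γ(X, V)).Opens) (r : Γ(X, V))
    (x : Γ(M.restrict hV.fromSpec, W)) :
    (M.restrictAppIso hV.fromSpec W).hom (r • x) =
      rres (fromSpec_image_le hV W) r • (M.restrictAppIso hV.fromSpec W).hom x := by
  rw [Scheme.Modules.smul_Spec_def, Scheme.Modules.smul_restrictAppIso_hom_apply]
  congr 1
  simp only [rres, ← ConcreteCategory.comp_apply]
  congr 2
  rw [← Scheme.Hom.appLE_appIso_inv hV.fromSpec
    (show W ≤ hV.fromSpec ⁻¹ᵁ V by rw [hV.fromSpec_preimage_self]; exact le_top),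
    Scheme.Hom.appLE, hV.fromSpec_app_self]
  simp only [Category.assoc]
  rw [← Functor.map_comp_assoc]
  rfl

end restrict

/-- Sections of the restriction to `Spec Γ(X, V)` are sections of `M` over image open sets, which
agree with `V` and `D(g)` only up to a proof of equality. The maps `j` and `k` make this
identification, and restriction along both inclusions passes between equal open sets. -/
lemma isLocalizedModule_iff_isLocalizingAt (M : X.Modules) {V : X.Opens} (hV : IsAffineOpen V)
    (g : Γ(X, V)) :
    IsLocalizedModule (.powers g) ((modulesSpecToSheaf.obj (M.restrict hV.fromSpec)).obj.map
      (PrimeSpectrum.basicOpen g).leTop.op).hom ↔ IsLocalizingAt M g := by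
  have hD : hV.fromSpec ''ᵁ PrimeSpectrum.basicOpen g = X.basicOpen g :=
    hV.fromSpec_image_basicOpen g
  have hT : hV.fromSpec ''ᵁ ⊤ = V := by
    rw [Scheme.Hom.image_top_eq_opensRange, hV.opensRange_fromSpec]
  let D : (Spec Γ(X, V)).Opens := PrimeSpectrum.basicOpen g
  let j : Γ(M.restrict hV.fromSpec, ⊤) → Γ(M, hV.fromSpec ''ᵁ ⊤) :=
    (M.restrictAppIso hV.fromSpec ⊤).hom
  let k : Γ(M.restrict hV.fromSpec, D) → Γ(M, hV.fromSpec ''ᵁ D) :=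
    (M.restrictAppIso hV.fromSpec D).hom
  have hj : ∀ (r : Γ(X, V)) x, j (r • x) = rres hT.le r • j x :=
    restrictAppIso_fromSpec_smul hV M ⊤
  have hk : ∀ (r : Γ(X, V)) x, k (r • x) = rres (hD.le.trans (X.basicOpen_le g)) r • k x :=
    restrictAppIso_fromSpec_smul hV M D
  let ρ := ((modulesSpecToSheaf.obj (M.restrict hV.fromSpec)).obj.map
      (PrimeSpectrum.basicOpen g).leTop.op).hom
  have hjk : ∀ x : Γ(M.restrict hV.fromSpec, ⊤), k (ρ x) = res M (hV.fromSpec.image_mono le_top) (j x) := fun x => rfl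
  have hkinj : ∀ a b : Γ(M.restrict hV.fromSpec, D), k a = k b → a = b := fun a b h => h
  change IsLocalizedModule (.powers g) ρ ↔ _
  constructor
  · intro hloc
    constructor
    · intro x
      obtain ⟨⟨y, ⟨_, n, rfl⟩⟩, hy⟩ := IsLocalizedModule.surj (.powers g) ρ
        (show Γ(M.restrict hV.fromSpec, D) from res M hD.le x)
      refine ⟨n, res M hT.ge (j y), ?_⟩
      have h1 := congrArg k hy
      replace h1 : k (g ^ n • (show Γ(M.restrict hV.fromSpec, D) from res M hD.le x)) =
        k (ρ y) := h1
      rw [hk] at h1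
      replace h1 : rres (hD.le.trans (X.basicOpen_le g)) (g ^ n) • res M hD.le x =
        res M (hV.fromSpec.image_mono le_top) (j y) := h1.trans (hjk y)
      have h2 := congrArg (res M hD.ge) h1
      rw [res_smul, res_res, res_res, rres_rres, res_self] at h2
      have hp : rres (X.basicOpen_le g) (g ^ n) = rres (X.basicOpen_le g) g ^ n := map_pow _ _ _
      rw [← hp, res_res]
      exact h2.symm
    · intro y hy
      have h0 : ρ (show Γ(M.restrict hV.fromSpec, ⊤) from res M hT.le y) = 0 := by
        change res M (hV.fromSpec.image_mono le_top) (res M hT.le y) = 0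
        rw [res_res]
        have := congrArg (res M hD.le) hy
        rwa [res_res, res_zero] at this
      obtain ⟨⟨_, n, rfl⟩, hc⟩ := (IsLocalizedModule.eq_zero_iff (.powers g) ρ).mp h0
      refine ⟨n, ?_⟩
      have h1 := congrArg j hc
      replace h1 : j (g ^ n • (show Γ(M.restrict hV.fromSpec, ⊤) from res M hT.le y)) = 0 := h1
      rw [hj] at h1
      replace h1 : rres hT.le (g ^ n) • res M hT.le y = 0 := h1
      rw [← res_smul] at h1
      simpa [res_res] using congrArg (res M hT.ge) h1
  · intro hloc
    refine IsLocalizedModule.Away.mk_of_addCommGroup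
      (Scheme.Modules.isUnit_algebraMap_end_of_le_basicOpen g le_rfl) ?_ ?_
    · intro (x : Γ(M.restrict hV.fromSpec, D))
      obtain ⟨n, y, hy⟩ := hloc.exists_lift (res M hD.ge (k x))
      refine ⟨n, (show Γ(M.restrict hV.fromSpec, ⊤) from res M hT.le y), ?_⟩
      have h1 := congrArg (res M hD.le) hy
      rw [res_res, res_smul, res_res, res_self, ← map_pow, rres_rres] at h1
      have h2 := (hk (g ^ n) x).trans h1.symm
      have h3 := res_res M hT.le (hV.fromSpec.image_mono (le_top : D ≤ ⊤)) y
      exact hkinj _ _ ((h2.trans h3.symm).trans (hjk _).symm)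
    · intro x hx
      have h0 : res M (X.basicOpen_le g) (res M hT.ge (j x)) = 0 := by
        have := congrArg (res M hD.ge) (show res M (hV.fromSpec.image_mono le_top) (j x) = 0 from hx)
        rw [res_res, res_zero] at this
        rw [res_res]; exact this
      obtain ⟨n, hn⟩ := hloc.exists_pow _ h0
      refine ⟨n, ?_⟩
      have h1 := congrArg (res M hT.le) hn
      rw [res_smul, res_res, res_self, res_zero] at h1
      exact (hj (g ^ n) x).trans h1

lemma isLocalizing_of_isQuasicoherent (M : X.Modules) (hM : SheafOfModules.IsQuasicoherent M) :
    IsLocalizing M := by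
  intro V hV g
  have : (M.restrict hV.fromSpec).IsQuasicoherent :=
    Scheme.Modules.isQuasicoherent_restrictFunctor _ _
  exact (isLocalizedModule_iff_isLocalizingAt M hV g).mp
    ((isIso_fromTildeΓ_iff_isLocalizing _).mp
    ((isQuasicoherent_iff_isIso_fromTildeΓ _).mp this) g)

/-- Over each `V i` the localisation property identifies `M` with the sheaf of a module on `Spec
Γ(X, V i)`, which has a presentation. The rest transports this presentation along `isoSpec` to `V
i`, and then to the site of open subsets of `V i`. -/
lemma isQuasicoherent_of_isLocalizingAt (M : X.Modules) {ι : Type} (V : ι → X.Opens)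
    (hV : ∀ i, IsAffineOpen (V i)) (hc : ⨆ i, V i = ⊤)
    (H : ∀ i (g : Γ(X, V i)), IsLocalizingAt M g) : SheafOfModules.IsQuasicoherent M := by
  have pres : ∀ i, Nonempty (SheafOfModules.Presentation (M.over (V i))) := by
    intro i
    have : IsIso (M.restrict (hV i).fromSpec).fromTildeΓ :=
      (isIso_fromTildeΓ_iff_isLocalizing _).mpr fun g =>
        (isLocalizedModule_iff_isLocalizingAt M (hV i) g).mpr (H i g)
    have P0 : (M.restrict (hV i).fromSpec).Presentation :=
      @SheafOfModules.Presentation.ofIsIso _ _ _ _ _ _ _ _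
        (M.restrict (hV i).fromSpec).fromTildeΓ this (presentationTilde _ .univ (by simp) _ (Submodule.span_eq _))
    have P1 := Scheme.Modules.presentationRestrict (hV i).isoSpec.hom P0
    let iso : (M.restrict (hV i).fromSpec).restrict (hV i).isoSpec.hom ≅
      M.restrict (V i).ι := (Scheme.Modules.restrictFunctorComp _ _).symm.app M ≪≫
        (Scheme.Modules.restrictFunctorCongr (by simp)).app M
    have P2 : (M.restrict (V i).ι).Presentation :=
      @SheafOfModules.Presentation.ofIsIso _ _ _ _ _ _ _ _ iso.hom (Iso.isIso_hom iso) P1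
    have : PreservesColimitsOfSize.{0, 0} (Scheme.Modules.overEquiv (V i)).inverse :=
      (Scheme.Modules.overEquiv (V i)).symm.toAdjunction.leftAdjoint_preservesColimits
    have P3 := @SheafOfModules.Presentation.map _ _ _ _ _ _ _ _ _ _ _ _ _ P2
      (Scheme.Modules.overEquiv (V i)).inverse this
      (Opens.sheafOfModulesEquivOverInverseUnit _ _).symm
    let iso' : (Scheme.Modules.overEquiv (V i)).inverse.obj (M.restrict (V i).ι) ≅
      M.over (V i) := (Scheme.Modules.overEquiv (V i)).inverse.mapIso
        ((Scheme.Modules.overFunctorEquiv (V i)).symm.app M) ≪≫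
        ((Scheme.Modules.overEquiv (V i)).unitIso.symm.app _)
    exact ⟨SheafOfModules.Presentation.ofIsIso iso'.hom P3⟩
  exact SheafOfModules.QuasicoherentData.isQuasicoherent
    { I := ι, X := V, coversTop := (Opens.coversTop_iff _ _).mpr hc,
      presentation := fun i => (pres i).some }

/-! ### Exactness on sections -/

/-- Evaluation of a morphism on sections, as a linear map. -/
def appLin {M N : X.Modules} (φ : M ⟶ N) (U : X.Opens) : Γ(M, U) →ₗ[Γ(X, U)] Γ(N, U) where
  toFun := φ.app U
  map_add' := map_add _
  map_smul' := Scheme.Modules.Hom.app_smul φ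

lemma comp_app_apply {M N P : X.Modules} (φ : M ⟶ N) (ψ : N ⟶ P) {U : X.Opens} (t : Γ(M, U)) :
    (φ ≫ ψ).app U t = ψ.app U (φ.app U t) := rfl

/-- Sections over `U`, as a functor to abelian groups. -/
def sectionsFunctor (U : X.Opens) : X.Modules ⥤ Ab :=
  Scheme.Modules.toPresheaf X ⋙ (evaluation _ _).obj (.op U)

instance (U : X.Opens) : PreservesFiniteLimits (sectionsFunctor U) :=
  have : PreservesFiniteLimits ((CategoryTheory.evaluation (Opens X)ᵒᵖ Ab.{0}).obj (.op U)) :=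
    ⟨fun _ _ _ => CategoryTheory.Limits.evaluation_preservesLimitsOfShape _⟩
  comp_preservesFiniteLimits (Scheme.Modules.toPresheaf X)
    ((CategoryTheory.evaluation (Opens X)ᵒᵖ Ab.{0}).obj (.op U))

lemma app_injective_of_mono {G F : X.Modules} (i : G ⟶ F) [Mono i] (U : X.Opens) :
    Function.Injective (i.app U) :=
  (AddCommGrpCat.mono_iff_injective ((sectionsFunctor U).map i)).mp inferInstance

lemma exists_app_eq_of_isLimit {K F Q : X.Modules} (i : K ⟶ F) (π : F ⟶ Q) (w : i ≫ π = 0)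
    (hl : IsLimit (KernelFork.ofι i w)) {U : X.Opens} {t : Γ(F, U)} (ht : π.app U t = 0) :
    ∃ s : Γ(K, U), i.app U s = t := by
  have w' : (sectionsFunctor U).map i ≫ (sectionsFunctor U).map π = 0 := by
    rw [← Functor.map_comp, w]; rfl
  have hl' : IsLimit (KernelFork.ofι _ w') :=
    isLimitForkMapOfIsLimit' (sectionsFunctor U) w hl
  -- A section is a homomorphism from `ℤ`; in this form the universal property of the kernel applies
  -- to it.
  let k : AddCommGrpCat.of ℤ ⟶ (sectionsFunctor U).obj F :=
    AddCommGrpCat.ofHom (zmultiplesHom _ t)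
  have hk : k ≫ (sectionsFunctor U).map π = 0 := by
    ext
    change π.app U ((1 : ℤ) • t) = 0
    rw [one_smul, ht]
  obtain ⟨l, hlk⟩ := KernelFork.IsLimit.lift' hl' k hk
  refine ⟨l (1 : ℤ), ?_⟩
  have := ConcreteCategory.congr_hom hlk (1 : ℤ)
  refine Eq.trans this ?_
  change (1 : ℤ) • t = t
  rw [one_smul]

lemma exists_app_eq_of_cokernel {G F : X.Modules} (i : G ⟶ F) [Mono i] {U : X.Opens}
    {t : Γ(F, U)} (ht : (cokernel.π i).app U t = 0) : ∃ s : Γ(G, U), i.app U s = t :=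
  exists_app_eq_of_isLimit i (cokernel.π i) (cokernel.condition i)
    (Abelian.monoIsKernelOfCokernel _ (colimit.isColimit _)) ht

lemma exists_app_eq_of_kernel {F Q : X.Modules} (φ : F ⟶ Q) {U : X.Opens}
    {t : Γ(F, U)} (ht : φ.app U t = 0) : ∃ s : Γ(kernel φ, U), (kernel.ι φ).app U s = t :=
  exists_app_eq_of_isLimit (kernel.ι φ) φ (kernel.condition φ) (kernelIsKernel φ) ht

/-- The presheaf cokernel `C` of `π` has zero sheafification because sheafification preserves
epimorphisms and cokernels. So the class of `q` in `C` vanishes locally, and evaluation of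
presheaves at an open set is exact. -/
lemma exists_local_lift_of_epi {F Q : X.Modules} (π : F ⟶ Q) [Epi π] {U : X.Opens}
    (q : Γ(Q, U)) (x : X) (hx : x ∈ U) :
    ∃ (V : X.Opens) (h : V ≤ U) (_ : x ∈ V) (t : Γ(F, V)), π.app V t = res Q h q := by
  let p := (Scheme.Modules.toPresheafOfModules X).map π
  let S := PresheafOfModules.sheafification (𝟙 X.ringCatSheaf.obj)
  let adj := PresheafOfModules.sheafificationAdjunction (𝟙 X.ringCatSheaf.obj)
  let C := cokernel p
  have hQ : IsIso (adj.counit.app (show SheafOfModules X.ringCatSheaf from Q)) := inferInstance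
  have hF : IsIso (adj.counit.app (show SheafOfModules X.ringCatSheaf from F)) := inferInstance
  let π' : (show SheafOfModules X.ringCatSheaf from F) ⟶ (show SheafOfModules X.ringCatSheaf from Q) := π
  have : Epi π' := inferInstanceAs (Epi π)
  have hS : Epi (S.map p) := by
    have e : S.map p ≫ adj.counit.app _ = adj.counit.app _ ≫ π' := adj.counit.naturality π'
    have h1 : S.map p = (adj.counit.app _ ≫ π') ≫ @inv _ _ _ _ (adj.counit.app _) hQ :=
      (@IsIso.eq_comp_inv _ _ _ _ _ _ hQ _ _).mpr e
    have h2 : Epi (adj.counit.app _ ≫ π') := @epi_comp _ _ _ _ _ _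
      (@IsIso.epi_of_iso _ _ _ _ _ hF) _ _
    rw [h1]
    exact @epi_comp _ _ _ _ _ _ h2 _ (@IsIso.epi_of_iso _ _ _ _ _ (@IsIso.inv_isIso _ _ _ _ _ hQ))
  have : S.PreservesZeroMorphisms := Functor.preservesZeroMorphisms_of_isLeftAdjoint S
  have h0 : S.map (cokernel.π p) = 0 := by
    rw [← cancel_epi (S.map p), ← S.map_comp, cokernel.condition, comp_zero, S.map_zero]
  have hC : IsZero (S.obj C) := IsZero.of_epi_eq_zero _ h0
  have hinj : Presheaf.IsLocallyInjective (Opens.grothendieckTopology X)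
    (CategoryTheory.toSheafify (Opens.grothendieckTopology X) C.presheaf) := inferInstance
  let q' : C.presheaf.obj (.op U) := (cokernel.π p).app (.op U) q
  have hsub : Subsingleton Γ((show X.Modules from S.obj C), U) := by
    have h := (IsZero.iff_id_eq_zero _).mp hC
    refine ⟨fun a b => ?_⟩
    have h1 : ∀ a : Γ((show X.Modules from S.obj C), U), a = 0 := fun a =>
      congrArg (fun φ : (show X.Modules from S.obj C) ⟶ (show X.Modules from S.obj C) => φ.app U a) h
    rw [h1 a, h1 b]
  have hq : (toSheafify (Opens.grothendieckTopology X) C.presheaf).app (.op U) q' =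
    (toSheafify (Opens.grothendieckTopology X) C.presheaf).app (.op U) 0 := hsub.elim _ _
  obtain ⟨V, h, hV, hxV⟩ := Presheaf.equalizerSieve_mem (Opens.grothendieckTopology X)
    (toSheafify (Opens.grothendieckTopology X) C.presheaf) q' 0 hq x hx
  refine ⟨V, leOfHom h, hxV, ?_⟩
  have h1 : C.presheaf.map h.op q' = 0 := by
    rw [Presheaf.equalizerSieve_apply] at hV
    rw [hV, map_zero]
  have h2 : (cokernel.π p).app (.op V) (res Q (leOfHom h) q) = 0 :=
    (PresheafOfModules.naturality_apply (cokernel.π p) h.op q).trans h1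
  have hex : (ShortComplex.mk p (cokernel.π p) (cokernel.condition p)).Exact :=
    ShortComplex.exact_cokernel p
  have hex' := hex.map (PresheafOfModules.evaluation _ (.op V))
  rw [ShortComplex.moduleCat_exact_iff] at hex'
  obtain ⟨t, ht⟩ := hex' (res Q (leOfHom h) q) h2
  exact ⟨t, ht⟩

/-- `0 ⟶ G ⟶ F ⟶ Q ⟶ 0` is an exact sequence of sheaves, expressed through sections. -/
structure IsSES {G F Q : X.Modules} (i : G ⟶ F) (π : F ⟶ Q) : Prop where
  inj : ∀ U, Function.Injective (i.app U)
  comp : ∀ U t, π.app U (i.app U t) = 0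
  exact : ∀ U t, π.app U t = 0 → ∃ s, i.app U s = t
  lift : ∀ (U : X.Opens) (q : Γ(Q, U)), ∀ x ∈ U, ∃ (V : X.Opens) (h : V ≤ U) (_ : x ∈ V)
    (t : Γ(F, V)), π.app V t = res Q h q

lemma isSES_cokernel {G F : X.Modules} (i : G ⟶ F) [Mono i] : IsSES i (cokernel.π i) where
  inj := app_injective_of_mono i
  comp U t := by
    have := congrArg (fun φ : G ⟶ cokernel i => φ.app U t) (cokernel.condition i)
    exact this
  exact _ _ ht := exists_app_eq_of_cokernel i ht
  lift _ q x hx := exists_local_lift_of_epi _ q x hx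

lemma isSES_kernel {F Q : X.Modules} (π : F ⟶ Q) [Epi π] : IsSES (kernel.ι π) π where
  inj := app_injective_of_mono _
  comp U t := by
    have := congrArg (fun φ : kernel π ⟶ Q => φ.app U t) (kernel.condition π)
    exact this
  exact _ _ ht := exists_app_eq_of_kernel π ht
  lift _ q x hx := exists_local_lift_of_epi _ q x hx

lemma isSES_image {E F : X.Modules} (s : E ⟶ F) :
    IsSES (kernel.ι s) (Abelian.factorThruImage s) where
  inj := app_injective_of_mono _
  comp U t := by
    apply app_injective_of_mono (Abelian.image.ι s) U
    rw [← comp_app_apply, Abelian.image.fac, map_zero]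
    have := congrArg (fun φ : kernel s ⟶ F => φ.app U t) (kernel.condition s)
    exact this
  exact U t ht := by
    apply exists_app_eq_of_kernel
    rw [← Abelian.image.fac s, comp_app_apply, ht, map_zero]
  lift _ q x hx := exists_local_lift_of_epi _ q x hx

lemma rres_pow {U V : X.Opens} (h : V ≤ U) (a : Γ(X, U)) (n : ℕ) :
    rres h (a ^ n) = rres h a ^ n := map_pow _ _ _

lemma rres_mul {U V : X.Opens} (h : V ≤ U) (a b : Γ(X, U)) :
    rres h (a * b) = rres h a * rres h b := map_mul _ _ _

lemma rres_one {U V : X.Opens} (h : V ≤ U) : rres h (1 : Γ(X, U)) = 1 := map_one _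

/-! ### Ideals and quasi-compactness on affine open sets -/

/-- This is the local-to-global principle of all the arguments below on affine open sets: the
functions `g` for which a problem becomes solvable after multiplication by `g` form an ideal, and
solving the problem near each point, up to powers, puts 1 into it. -/
lemma ideal_eq_top {V : X.Opens} (hV : IsAffineOpen V) (I : Ideal Γ(X, V))
    (H : ∀ x ∈ V, ∃ g ∈ I, x ∈ X.basicOpen g) : I = ⊤ := by
  rw [← Ideal.span_eq I, ← hV.iSup_basicOpen_eq_self_iff]
  apply le_antisymm
  · exact iSup_le fun g => X.basicOpen_le _
  · intro x hx
    obtain ⟨g, hg, hx⟩ := H x hx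
    exact Opens.mem_iSup.mpr ⟨⟨g, hg⟩, hx⟩

/-- An affine open set is quasi-compact, so the local exponents have a common bound. -/
lemma exists_pow_smul_eq_zero (M : X.Modules) {V : X.Opens} (hV : IsAffineOpen V)
    (g : Γ(X, V)) (d : Γ(M, V))
    (H : ∀ x ∈ V, ∃ (W : X.Opens) (h : W ≤ V) (n : ℕ), x ∈ W ∧ res M h (g ^ n • d) = 0) :
    ∃ n : ℕ, g ^ n • d = 0 := by
  suffices h : ∃ n : ℕ, ∀ x ∈ (V : Set X), ∃ (W : X.Opens) (h : W ≤ V), x ∈ W ∧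
      res M h (g ^ n • d) = 0 by
    obtain ⟨n, hn⟩ := h
    refine ⟨n, section_ext M fun x hx => ?_⟩
    obtain ⟨W, h, hxW, e⟩ := hn x hx
    exact ⟨W, h, hxW, by rw [e, res_zero]⟩
  have mono : ∀ {n m : ℕ} (_ : n ≤ m) {W : X.Opens} (h : W ≤ V),
      res M h (g ^ n • d) = 0 → res M h (g ^ m • d) = 0 := by
    intro n m hnm W h e
    obtain ⟨k, rfl⟩ := Nat.exists_eq_add_of_le' hnm
    rw [pow_add, mul_smul, res_smul, e, smul_zero]
  refine hV.isCompact.induction_on (p := fun S => ∃ n : ℕ, ∀ x ∈ S,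
    ∃ (W : X.Opens) (h : W ≤ V), x ∈ W ∧ res M h (g ^ n • d) = 0) ⟨0, by simp⟩
    (fun s t hst ⟨n, hn⟩ => ⟨n, fun x hx => hn x (hst hx)⟩) ?_ ?_
  · rintro s t ⟨n, hn⟩ ⟨m, hm⟩
    refine ⟨max n m, ?_⟩
    rintro x (hx | hx)
    · obtain ⟨W, h, hxW, e⟩ := hn x hx
      exact ⟨W, h, hxW, mono (le_max_left _ _) h e⟩
    · obtain ⟨W, h, hxW, e⟩ := hm x hx
      exact ⟨W, h, hxW, mono (le_max_right _ _) h e⟩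
  · intro x hx
    obtain ⟨W, h, n, hxW, e⟩ := H x hx
    exact ⟨W, mem_nhdsWithin_of_mem_nhds (W.isOpen.mem_nhds hxW), n,
      fun y hy => ⟨W, h, hy, e⟩⟩

lemma basicOpen_mono_affine {V : X.Opens} (hV : IsAffineOpen V) {W : X.Opens} {x : X}
    (hxV : x ∈ V) (hxW : x ∈ W) : ∃ g : Γ(X, V), X.basicOpen g ≤ W ∧ x ∈ X.basicOpen g :=
  hV.exists_basicOpen_le ⟨x, hxW⟩ hxV

/-- Localising in the form of a statement about the open set `W ∩ D(g)`. -/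
lemma IsLocalizing.exists_lift_inf {M : X.Modules} (hM : IsLocalizing M) {V W : X.Opens}
    (hWV : W ≤ V) (hW : IsAffineOpen W) (g : Γ(X, V)) {D : X.Opens} (hD : D = W ⊓ X.basicOpen g)
    (x : Γ(M, D)) : ∃ (n : ℕ) (y : Γ(M, W)), res M (hD.le.trans inf_le_left) y =
      rres (hD.le.trans (inf_le_left.trans hWV)) g ^ n • x := by
  have e : X.basicOpen (rres hWV g) = D := by rw [hD]; exact Scheme.basicOpen_res X g _
  subst e
  obtain ⟨n, y, hy⟩ := (hM W hW (rres hWV g)).exists_lift x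
  refine ⟨n, y, hy.trans ?_⟩
  rw [rres_rres]

lemma IsLocalizing.exists_pow_inf {M : X.Modules} (hM : IsLocalizing M) {V W : X.Opens}
    (hWV : W ≤ V) (hW : IsAffineOpen W) (g : Γ(X, V)) {D : X.Opens} (hD : D = W ⊓ X.basicOpen g)
    (y : Γ(M, W)) (hy : res M (hD.le.trans inf_le_left) y = 0) :
    ∃ n : ℕ, rres hWV g ^ n • y = 0 := by
  have e : X.basicOpen (rres hWV g) = D := by rw [hD]; exact Scheme.basicOpen_res X g _
  subst e
  exact (hM W hW (rres hWV g)).exists_pow y hy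

/-! ### Exact sequences over affine open sets, and coherence -/

section exact

variable {G F Q : X.Modules} {i : G ⟶ F} {π : F ⟶ Q}

/-- Near a point `d` lifts to a section `t` of `F`, and over `D(g)` this `t` comes from `G`. A
multiple of the preimage by a power of `g` extends over the whole neighbourhood and agrees there
with the multiple of `t`, up to a further power; hence a power of `g` kills `d` locally. -/
lemma IsSES.exists_pow (h : IsSES i π) (hG : IsLocalizing G) (hF : IsLocalizing F)
    {V : X.Opens} (hV : IsAffineOpen V) (g : Γ(X, V)) (d : Γ(Q, V))
    (hd : res Q (X.basicOpen_le g) d = 0) : ∃ n : ℕ, g ^ n • d = 0 := by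
  apply exists_pow_smul_eq_zero Q hV
  intro x hx
  obtain ⟨W, hWV, hxW, t, ht⟩ := h.lift V d x hx
  obtain ⟨k, hk, hxk⟩ := basicOpen_mono_affine hV hx hxW
  have hkV := X.basicOpen_le k
  have hka : IsAffineOpen (X.basicOpen k) := hV.basicOpen k
  obtain ⟨s, hs⟩ := h.exact (X.basicOpen k ⊓ X.basicOpen g) (res F (inf_le_left.trans hk) t) (by
    rw [app_res, ht, res_res, ← res_res Q (X.basicOpen_le g) inf_le_right, hd, res_zero])
  obtain ⟨n, s', hs'⟩ := hG.exists_lift_inf hkV hka g rfl s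
  obtain ⟨m, hm⟩ := hF.exists_pow_inf hkV hka g rfl
    (i.app _ s' - rres hkV g ^ n • res F hk t) (by
      rw [res_sub, ← app_res, hs', Scheme.Modules.Hom.app_smul, hs, res_smul, res_res, rres_pow,
        rres_rres, sub_self])
  refine ⟨X.basicOpen k, hkV, m + n, hxk, ?_⟩
  have h2 := congrArg (π.app (X.basicOpen k)) hm
  rw [Scheme.Modules.Hom.app_smul, map_sub, h.comp, Scheme.Modules.Hom.app_smul, app_res, ht,
    res_res, zero_sub, smul_neg, map_zero, neg_eq_zero, ← mul_smul, ← pow_add] at h2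
  rw [res_smul, rres_pow]
  exact h2

/-- A local lift of `q` on `D(g)` extends after multiplication by `g ^ n` to a section `y` over `V`;
the difference of `π y` and `g ^ n q` dies on `D(g)`, hence is killed by a power of `g`. So a power
of `g` times `q` is in the image. -/
lemma IsSES.surjective (h : IsSES i π) (hG : IsLocalizing G) (hF : IsLocalizing F)
    {V : X.Opens} (hV : IsAffineOpen V) : Function.Surjective (π.app V) := by
  intro q
  let I : Ideal Γ(X, V) :=
    (LinearMap.range (appLin π V)).comap (LinearMap.toSpanSingleton Γ(X, V) _ q)
  suffices hI : I = ⊤ by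
    obtain ⟨t, ht⟩ : (1 : Γ(X, V)) ∈ I := hI ▸ Submodule.mem_top
    exact ⟨t, ht.trans (one_smul _ _)⟩
  apply ideal_eq_top hV
  intro x hx
  obtain ⟨W, hWV, hxW, t, ht⟩ := h.lift V q x hx
  obtain ⟨g, hg, hxg⟩ := basicOpen_mono_affine hV hx hxW
  obtain ⟨n, y, hy⟩ := (hF V hV g).exists_lift (res F hg t)
  obtain ⟨m, hm⟩ := h.exists_pow hG hF hV g (π.app V y - g ^ n • q) (by
    rw [res_sub, ← app_res, hy, Scheme.Modules.Hom.app_smul, app_res, ht, res_res, res_smul,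
      rres_pow, sub_self])
  refine ⟨g ^ (m + n + 1), ⟨g ^ (m + 1) • y, ?_⟩, ?_⟩
  · change π.app V (g ^ (m + 1) • y) = g ^ (m + n + 1) • q
    rw [smul_sub, sub_eq_zero] at hm
    rw [Scheme.Modules.Hom.app_smul, pow_succ', mul_smul, hm, ← mul_smul, ← mul_smul]
    ring_nf
  · rw [Scheme.basicOpen_pow _ _ (Nat.succ_pos _)]
    exact hxg

lemma IsSES.isLocalizing_right (h : IsSES i π) (hG : IsLocalizing G) (hF : IsLocalizing F) :
    IsLocalizing Q := by
  intro V hV g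
  refine ⟨fun q => ?_, h.exists_pow hG hF hV g⟩
  obtain ⟨t, rfl⟩ := h.surjective hG hF (hV.basicOpen g) q
  obtain ⟨n, y, hy⟩ := (hF V hV g).exists_lift t
  exact ⟨n, π.app V y, by rw [← app_res, hy, Scheme.Modules.Hom.app_smul]⟩

/-- Local surjectivity of `π` is left out, so that the lemma covers the kernel of an arbitrary
morphism. -/
lemma isLocalizing_left (inj : ∀ U, Function.Injective (i.app U))
    (comp : ∀ U t, π.app U (i.app U t) = 0)
    (exact : ∀ U t, π.app U t = 0 → ∃ s, i.app U s = t)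
    (hF : IsLocalizing F) (hQ : IsLocalizing Q) :
    IsLocalizing G := by
  intro V hV g
  constructor
  · intro x
    obtain ⟨n, y, hy⟩ := (hF V hV g).exists_lift (i.app _ x)
    obtain ⟨m, hm⟩ := (hQ V hV g).exists_pow (π.app V y) (by
      rw [← app_res, hy, Scheme.Modules.Hom.app_smul, comp, smul_zero])
    rw [← Scheme.Modules.Hom.app_smul] at hm
    obtain ⟨z, hz⟩ := exact _ _ hm
    refine ⟨m + n, z, inj _ ?_⟩
    rw [app_res, hz, res_smul, hy, Scheme.Modules.Hom.app_smul, ← mul_smul, rres_pow, pow_add]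
  · intro y hy
    obtain ⟨m, hm⟩ := (hF V hV g).exists_pow (i.app V y) (by rw [← app_res, hy, map_zero])
    exact ⟨m, inj _ (by rw [Scheme.Modules.Hom.app_smul, hm, map_zero])⟩

lemma IsCoherent.isLocalizing (hF : IsCoherent F) : IsLocalizing F :=
  isLocalizing_of_isQuasicoherent F hF.quasicoherent

lemma isQuasicoherent_of_isLocalizing {M : X.Modules} (hM : IsLocalizing M) :
    SheafOfModules.IsQuasicoherent M :=
  isQuasicoherent_of_isLocalizingAt M (fun V : X.affineOpens => V.1) (fun V => V.2)
    (by simpa using iSup_affineOpens_eq_top X) fun V => hM V.1 V.2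

lemma IsSES.isCoherent_right (h : IsSES i π) (hG : IsLocalizing G) (hF : IsCoherent F) :
    IsCoherent Q where
  quasicoherent := isQuasicoherent_of_isLocalizing (h.isLocalizing_right hG hF.isLocalizing)
  finite V hV := by
    have := hF.finite V hV
    exact Module.Finite.of_surjective (appLin π V) (h.surjective hG hF.isLocalizing hV)

variable [IsLocallyNoetherian X]

lemma isNoetherianRing_of_isAffineOpen {V : X.Opens} (hV : IsAffineOpen V) :
    IsNoetherianRing Γ(X, V) :=
  IsLocallyNoetherian.component_noetherian ⟨V, hV⟩

lemma isCoherent_kernel {F Q : X.Modules} (φ : F ⟶ Q) (hF : IsCoherent F) (hQ : IsLocalizing Q) :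
    IsCoherent (kernel φ) where
  quasicoherent := isQuasicoherent_of_isLocalizing (isLocalizing_left (i := kernel.ι φ) (π := φ)
    (app_injective_of_mono _) (fun U t =>
      congrArg (fun ψ : kernel φ ⟶ Q => ψ.app U t) (kernel.condition φ))
      (fun _ _ ht => exists_app_eq_of_kernel φ ht) hF.isLocalizing hQ)
  finite V hV := by
    have := hF.finite V hV
    have := isNoetherianRing_of_isAffineOpen hV
    exact Module.Finite.of_injective (appLin (kernel.ι φ) V) (app_injective_of_mono _ _)

lemma isCoherent_structureSheaf (X : Scheme.{0}) : IsCoherent (structureSheaf X) := by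
  refine ⟨isQuasicoherent_of_isLocalizing fun V hV g => ?_, fun V hV => ?_⟩
  · have := hV.isLocalization_basicOpen g
    constructor
    · intro x
      obtain ⟨n, y, hy⟩ := IsLocalization.Away.surj g (show Γ(X, X.basicOpen g) from x)
      refine ⟨n, y, ?_⟩
      rw [mul_comm] at hy
      exact hy.symm
    · intro y hy
      obtain ⟨⟨_, n, rfl⟩, hc⟩ := (IsLocalization.map_eq_zero_iff (.powers g) Γ(X, X.basicOpen g)
        (show Γ(X, V) from y)).mp hy
      exact ⟨n, hc⟩
  · exact inferInstanceAs (Module.Finite Γ(X, V) Γ(X, V))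

end exact

/-! ### The augmented Čech complex, indexed by finite sets -/

lemma resLin_resLin (f : X ⟶ Spec (CommRingCat.of ℂ)) (M : X.Modules) {U V W : X.Opens}
    (h : V ≤ U) (h' : W ≤ V) (t : Sec f M U) :
    resLin f M h' (resLin f M h t) = resLin f M (h'.trans h) t := res_res M h h' t

@[simp] lemma resLin_self (f : X ⟶ Spec (CommRingCat.of ℂ)) (M : X.Modules) {U : X.Opens}
    (h : U ≤ U) (t : Sec f M U) : resLin f M h t = t := res_self M h t

/-- Multiplication by a function, as a `ℂ`-linear map. -/
def mulLin (f : X ⟶ Spec (CommRingCat.of ℂ)) (M : X.Modules) {U : X.Opens} (g : Γ(X, U)) :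
    Sec f M U →ₗ[ℂ] Sec f M U where
  toFun t := (show Γ(M, U) from g • (show Γ(M, U) from t))
  map_add' a b := smul_add g (show Γ(M, U) from a) (show Γ(M, U) from b)
  map_smul' c t := smul_comm g (scalars f U c) (show Γ(M, U) from t)

lemma resLin_mulLin (f : X ⟶ Spec (CommRingCat.of ℂ)) (M : X.Modules) {U V : X.Opens}
    (h : V ≤ U) (g : Γ(X, U)) (t : Sec f M U) :
    resLin f M h (mulLin f M g t) = mulLin f M (rres h g) (resLin f M h t) := res_smul M h g t

lemma mulLin_mul (f : X ⟶ Spec (CommRingCat.of ℂ)) (M : X.Modules) {U : X.Opens}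
    (g g' : Γ(X, U)) (t : Sec f M U) :
    mulLin f M (g * g') t = mulLin f M g (mulLin f M g' t) :=
  mul_smul g g' (show Γ(M, U) from t)

@[simp] lemma mulLin_one (f : X ⟶ Spec (CommRingCat.of ℂ)) (M : X.Modules) {U : X.Opens}
    (t : Sec f M U) : mulLin f M 1 t = t := one_smul Γ(X, U) (show Γ(M, U) from t)

lemma mulLin_add (f : X ⟶ Spec (CommRingCat.of ℂ)) (M : X.Modules) {U : X.Opens}
    (g g' : Γ(X, U)) (t : Sec f M U) :
    mulLin f M (g + g') t = mulLin f M g t + mulLin f M g' t :=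
  add_smul g g' (show Γ(M, U) from t)

@[simp] lemma mulLin_zero (f : X ⟶ Spec (CommRingCat.of ℂ)) (M : X.Modules) {U : X.Opens}
    (t : Sec f M U) : mulLin f M (0 : Γ(X, U)) t = 0 := zero_smul Γ(X, U) (show Γ(M, U) from t)

section signs

variable {m : ℕ}

/-- The sign of the position of `i` in `s`. -/
def sgn (i : Fin m) (s : Finset (Fin m)) : ℂ := (-1) ^ (s.filter (· < i)).card

lemma sgn_mul_self (i : Fin m) (s : Finset (Fin m)) : sgn i s * sgn i s = 1 := by
  rw [sgn, ← mul_pow]; norm_num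

lemma sgn_insert_self (a : Fin m) (s : Finset (Fin m)) : sgn a (insert a s) = sgn a s := by
  rw [sgn, sgn, Finset.filter_insert, if_neg (lt_irrefl a)]

lemma sgn_insert_of_lt {i a : Fin m} {s : Finset (Fin m)} (ha : a ∉ s) (h : a < i) :
    sgn i (insert a s) = - sgn i s := by
  rw [sgn, sgn, Finset.filter_insert, if_pos h, Finset.card_insert_of_notMem (by simp [ha]),
    pow_succ]
  ring

lemma sgn_insert_of_gt {i a : Fin m} {s : Finset (Fin m)} (h : i < a) :
    sgn i (insert a s) = sgn i s := by
  rw [sgn, sgn, Finset.filter_insert, if_neg h.not_gt]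

lemma sgn_erase_self (a : Fin m) (s : Finset (Fin m)) : sgn a (s.erase a) = sgn a s := by
  by_cases ha : a ∈ s
  · conv_rhs => rw [← Finset.insert_erase ha, sgn_insert_self]
  · rw [Finset.erase_eq_of_notMem ha]

lemma sgn_erase_of_lt {i a : Fin m} {s : Finset (Fin m)} (ha : a ∈ s) (h : a < i) :
    sgn i (s.erase a) = - sgn i s := by
  conv_rhs => rw [← Finset.insert_erase ha, sgn_insert_of_lt (Finset.notMem_erase a s) h, neg_neg]

lemma sgn_erase_of_gt {i a : Fin m} {s : Finset (Fin m)} (h : i < a) :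
    sgn i (s.erase a) = sgn i s := by
  by_cases ha : a ∈ s
  · conv_rhs => rw [← Finset.insert_erase ha, sgn_insert_of_gt h]
  · rw [Finset.erase_eq_of_notMem ha]

/-- The sign rule behind `d ∘ d = 0`. -/
lemma sgn_erase_swap {i j : Fin m} {s : Finset (Fin m)} (hi : i ∈ s) (hj : j ∈ s) (h : i ≠ j) :
    sgn i s * sgn j (s.erase i) = - (sgn j s * sgn i (s.erase j)) := by
  rcases lt_or_gt_of_ne h with h | h
  · rw [sgn_erase_of_lt hi h, sgn_erase_of_gt h]; ring
  · rw [sgn_erase_of_gt h, sgn_erase_of_lt hj h]; ring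

/-- The sign rule behind the contraction given by inserting the index `a`. -/
lemma sgn_homotopy {i a : Fin m} {s : Finset (Fin m)} (hi : i ∈ s) (ha : a ∉ s) :
    sgn i s * sgn a (s.erase i) = - (sgn a s * sgn i (insert a s)) := by
  have hia : i ≠ a := fun h => ha (h ▸ hi)
  rcases lt_or_gt_of_ne hia with h | h
  · rw [sgn_erase_of_lt hi h, sgn_insert_of_gt h]; ring
  · rw [sgn_erase_of_gt h, sgn_insert_of_lt ha h]; ring

end signs

section complex

variable (f : X ⟶ Spec (CommRingCat.of ℂ)) {m : ℕ} (U : Fin m → X.Opens) (M : X.Modules)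

/-- `W ∩ ⋂_{i ∈ s} U_i`. -/
def interF (W : X.Opens) (s : Finset (Fin m)) : X.Opens := W ⊓ s.inf U

lemma interF_anti (W : X.Opens) {s t : Finset (Fin m)} (h : s ⊆ t) :
    interF U W t ≤ interF U W s := inf_le_inf_left _ (Finset.inf_mono h)

lemma interF_mono {W W' : X.Opens} (h : W' ≤ W) (s : Finset (Fin m)) :
    interF U W' s ≤ interF U W s := inf_le_inf_right _ h

lemma interF_le (W : X.Opens) (s : Finset (Fin m)) : interF U W s ≤ W := inf_le_left

/-- Cochains of all degrees of the augmented Čech complex of `M` on `W`. -/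
abbrev TotCochain (W : X.Opens) : Type := (s : Finset (Fin m)) → Sec f M (interF U W s)

/-- The differential of the augmented Čech complex. -/
def totD (W : X.Opens) : TotCochain f U M W →ₗ[ℂ] TotCochain f U M W :=
  LinearMap.pi fun s => ∑ i ∈ s, sgn i s •
    (resLin f M (interF_anti U W (Finset.erase_subset i s))).comp (LinearMap.proj (s.erase i))

lemma totD_apply (W : X.Opens) (c : TotCochain f U M W) (s : Finset (Fin m)) :
    totD f U M W c s = ∑ i ∈ s, sgn i s •
      resLin f M (interF_anti U W (Finset.erase_subset i s)) (c (s.erase i)) := by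
  simp [totD]

/-- Restriction of cochains to a smaller open set. -/
def totRes {W W' : X.Opens} (h : W' ≤ W) : TotCochain f U M W →ₗ[ℂ] TotCochain f U M W' :=
  LinearMap.pi fun s => (resLin f M (interF_mono U h s)).comp (LinearMap.proj s)

lemma totRes_apply {W W' : X.Opens} (h : W' ≤ W) (c : TotCochain f U M W) (s : Finset (Fin m)) :
    totRes f U M h c s = resLin f M (interF_mono U h s) (c s) := rfl

lemma totD_totRes {W W' : X.Opens} (h : W' ≤ W) (c : TotCochain f U M W) :
    totD f U M W' (totRes f U M h c) = totRes f U M h (totD f U M W c) := by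
  ext s
  simp only [totD_apply, totRes_apply, map_sum, map_smul, resLin_resLin]

/-- Multiplication of cochains by a function. -/
def totMul {W : X.Opens} (g : Γ(X, W)) : TotCochain f U M W →ₗ[ℂ] TotCochain f U M W :=
  LinearMap.pi fun s => (mulLin f M (rres (interF_le U W s) g)).comp (LinearMap.proj s)

lemma totMul_apply {W : X.Opens} (g : Γ(X, W)) (c : TotCochain f U M W) (s : Finset (Fin m)) :
    totMul f U M g c s = mulLin f M (rres (interF_le U W s) g) (c s) := rfl

lemma totD_totMul {W : X.Opens} (g : Γ(X, W)) (c : TotCochain f U M W) :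
    totD f U M W (totMul f U M g c) = totMul f U M g (totD f U M W c) := by
  ext s
  simp only [totD_apply, totMul_apply, map_sum, map_smul, resLin_mulLin, rres_rres]

lemma resLin_congr {W W' : X.Opens} (c : TotCochain f U M W) {s t : Finset (Fin m)} (e : s = t)
    (hs : W' ≤ interF U W s) (ht : W' ≤ interF U W t) :
    resLin f M hs (c s) = resLin f M ht (c t) := by
  subst e; rfl

lemma totD_totD (W : X.Opens) (c : TotCochain f U M W) :
    totD f U M W (totD f U M W c) = 0 := by
  ext s
  let T : Fin m → Fin m → Sec f M (interF U W s) := fun i j => (sgn i s * sgn j (s.erase i)) •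
    resLin f M (interF_anti U W ((Finset.erase_subset _ _).trans (Finset.erase_subset i s)))
      (c ((s.erase i).erase j))
  have h1 : totD f U M W (totD f U M W c) s = ∑ i ∈ s, ∑ j ∈ s.erase i, T i j := by
    simp only [totD_apply, map_sum, map_smul, resLin_resLin, Finset.smul_sum, smul_smul, T]
  have h2 : ∑ i ∈ s, ∑ j ∈ s.erase i, T i j = ∑ j ∈ s, ∑ i ∈ s.erase j, T i j := by
    apply Finset.sum_comm'
    intro i j
    simp only [Finset.mem_erase]
    tauto
  -- Exchanging `i` and `j` changes the sign of each term, so the double sum equals its own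
  -- negative.
  have h3 : ∑ j ∈ s, ∑ i ∈ s.erase j, T i j = - ∑ j ∈ s, ∑ i ∈ s.erase j, T j i := by
    rw [← Finset.sum_neg_distrib]
    refine Finset.sum_congr rfl fun j hj => ?_
    rw [← Finset.sum_neg_distrib]
    refine Finset.sum_congr rfl fun i hi => ?_
    simp only [T]
    rw [sgn_erase_swap (Finset.mem_of_mem_erase hi) hj (Finset.ne_of_mem_erase hi), neg_smul,
      resLin_congr f U M c (Finset.erase_right_comm (a := i) (b := j))]
  rw [h1]
  have h4 := h2.trans h3
  have : (2 : ℂ) • (∑ i ∈ s, ∑ j ∈ s.erase i, T i j) = 0 := by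
    rw [two_smul]
    nth_rewrite 1 [h4]
    simp
  exact (smul_eq_zero.mp this).resolve_left two_ne_zero

/-- The augmented Čech complex is exact when `W` lies in a member of the cover. -/
lemma exists_totD_eq_of_le {W : X.Opens} {a : Fin m} (ha : W ≤ U a) (c : TotCochain f U M W)
    (hc : totD f U M W c = 0) : ∃ b, totD f U M W b = c := by
  have hle : ∀ t : Finset (Fin m), interF U W t ≤ interF U W (insert a t) := fun t => by
    rw [interF, interF, Finset.inf_insert]
    exact le_inf inf_le_left (inf_le_inf_right _ ha)
  -- The contracting homotopy: intersecting with `U a` does not change open subsets of `W`, so the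
  -- component at `insert a t` can be used at `t`.
  refine ⟨fun t => if a ∈ t then 0 else sgn a t • resLin f M (hle t) (c (insert a t)), ?_⟩
  ext s
  rw [totD_apply]
  by_cases has : a ∈ s
  · rw [Finset.sum_eq_single_of_mem a has]
    · rw [if_neg (Finset.notMem_erase a s), map_smul, smul_smul, sgn_erase_self, sgn_mul_self,
        one_smul, resLin_resLin, resLin_congr f U M c (Finset.insert_erase has) _ le_rfl,
        resLin_self]
    · intro i _ hia
      rw [if_pos (Finset.mem_erase.mpr ⟨hia.symm, has⟩), map_zero, smul_zero]
  · have h0 := congrArg (resLin f M (hle s)) (congrFun hc (insert a s))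
    rw [totD_apply, Finset.sum_insert has, Pi.zero_apply, map_zero, map_add, map_smul,
      sgn_insert_self, resLin_resLin, resLin_congr f U M c (Finset.erase_insert has) _ le_rfl,
      resLin_self] at h0
    have h1 := congrArg (sgn a s • ·) h0
    simp only [smul_add, smul_zero, smul_smul, sgn_mul_self, one_smul, map_sum, map_smul,
      Finset.smul_sum] at h1
    rw [eq_neg_of_add_eq_zero_left h1, ← Finset.sum_neg_distrib]
    refine Finset.sum_congr rfl fun i hi => ?_
    have hia : i ≠ a := fun h => has (h ▸ hi)
    rw [if_neg (fun h => has (Finset.mem_of_mem_erase h)), map_smul, smul_smul,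
      sgn_homotopy hi has, neg_smul, resLin_resLin, resLin_resLin,
      resLin_congr f U M c (Finset.erase_insert_of_ne hia.symm).symm]

end complex

section exactness

variable (f : X ⟶ Spec (CommRingCat.of ℂ)) {m : ℕ} (U : Fin m → X.Opens) (M : X.Modules)

lemma isAffineOpen_inf [X.IsSeparated] {V W : X.Opens} (hV : IsAffineOpen V)
    (hW : IsAffineOpen W) : IsAffineOpen (V ⊓ W) := hV.inf hW

variable {U M}

lemma isAffineOpen_interF [X.IsSeparated] (hU : ∀ i, IsAffineOpen (U i)) {W : X.Opens}
    (hW : IsAffineOpen W) (s : Finset (Fin m)) : IsAffineOpen (interF U W s) := by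
  induction s using Finset.induction_on generalizing W with
  | empty => simpa [interF] using hW
  | insert a s ha ih =>
    rw [interF, Finset.inf_insert, ← inf_assoc]
    exact ih (isAffineOpen_inf hW (hU a))

lemma isAffineOpen_interF_top [X.IsSeparated] (hU : ∀ i, IsAffineOpen (U i))
    {s : Finset (Fin m)} (hs : s.Nonempty) : IsAffineOpen (interF U ⊤ s) := by
  obtain ⟨a, ha⟩ := hs
  rw [← Finset.insert_erase ha, interF, Finset.inf_insert, top_inf_eq]
  exact isAffineOpen_interF hU (hU a) _

lemma interF_basicOpen {W : X.Opens} (g : Γ(X, W)) (s : Finset (Fin m)) :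
    interF U (X.basicOpen g) s = interF U W s ⊓ X.basicOpen g := by
  rw [interF, interF, inf_right_comm, inf_eq_right.mpr (X.basicOpen_le g)]

lemma totMul_mul {W : X.Opens} (g g' : Γ(X, W)) (c : TotCochain f U M W) :
    totMul f U M (g * g') c = totMul f U M g (totMul f U M g' c) := by
  ext s
  simp only [totMul_apply, rres_mul, mulLin_mul]

lemma exists_totRes_eq [X.IsSeparated] (hU : ∀ i, IsAffineOpen (U i)) (hM : IsLocalizing M)
    {W : X.Opens} (hW : IsAffineOpen W) (g : Γ(X, W)) (b : TotCochain f U M (X.basicOpen g)) :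
    ∃ (n : ℕ) (y : TotCochain f U M W), totRes f U M (X.basicOpen_le g) y =
      totMul f U M (rres (X.basicOpen_le g) g ^ n) b := by
  have H := fun s : Finset (Fin m) => hM.exists_lift_inf (interF_le U W s)
    (isAffineOpen_interF hU hW s) g (interF_basicOpen g s) (b s)
  choose n y hy using H
  let y : TotCochain f U M W := y
  let N := Finset.univ.sup n
  refine ⟨N, fun s => mulLin f M (rres (interF_le U W s) g ^ (N - n s)) (y s), ?_⟩
  ext s
  have hle : n s ≤ N := Finset.le_sup (Finset.mem_univ s)
  rw [totRes_apply, resLin_mulLin, rres_pow, rres_rres, totMul_apply, rres_pow, rres_rres]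
  conv_rhs => rw [← Nat.sub_add_cancel hle, pow_add, mulLin_mul]
  exact congrArg _ (hy s)

lemma exists_totMul_eq_zero [X.IsSeparated] (hU : ∀ i, IsAffineOpen (U i)) (hM : IsLocalizing M)
    {W : X.Opens} (hW : IsAffineOpen W) (g : Γ(X, W)) (c : TotCochain f U M W)
    (hc : totRes f U M (X.basicOpen_le g) c = 0) : ∃ n : ℕ, totMul f U M (g ^ n) c = 0 := by
  have H := fun s : Finset (Fin m) => hM.exists_pow_inf (interF_le U W s)
    (isAffineOpen_interF hU hW s) g (interF_basicOpen g s) (c s) (congrFun hc s)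
  choose n hn using H
  let N := Finset.univ.sup n
  refine ⟨N, ?_⟩
  ext s
  have hle : n s ≤ N := Finset.le_sup (Finset.mem_univ s)
  have h1 : mulLin f M (rres (interF_le U W s) g ^ n s) (c s) = 0 := hn s
  rw [totMul_apply, rres_pow, ← Nat.sub_add_cancel hle, pow_add, mulLin_mul, h1, map_zero]
  rfl

/-- The augmented Čech complex of an affine cover is exact on affine open sets. -/
lemma exists_totD_eq [X.IsSeparated] (hU : IsAffineCover U) (hM : IsLocalizing M)
    {W : X.Opens} (hW : IsAffineOpen W) (c : TotCochain f U M W)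
    (hc : totD f U M W c = 0) : ∃ b, totD f U M W b = c := by
  -- `I` consists of the functions `g` for which `g c` is a coboundary. Near each point `W` shrinks
  -- into some `U a`, where the complex is contractible; the cochain found there extends after
  -- multiplication by a power of `g`.
  let I : Ideal Γ(X, W) :=
    { carrier := {g | ∃ b, totD f U M W b = totMul f U M g c}
      add_mem' := by
        rintro g g' ⟨b, hb⟩ ⟨b', hb'⟩
        refine ⟨b + b', ?_⟩
        rw [map_add, hb, hb']
        ext s
        simp only [Pi.add_apply, totMul_apply, rres, map_add, mulLin_add]
      zero_mem' := ⟨0, by ext s; simp [totMul_apply, rres]⟩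
      smul_mem' := by
        rintro g g' ⟨b, hb⟩
        refine ⟨totMul f U M g b, ?_⟩
        rw [totD_totMul, hb]
        ext s
        simp only [totMul_apply, smul_eq_mul, rres_mul, mulLin_mul] }
  suffices hI : I = ⊤ by
    obtain ⟨b, hb⟩ : (1 : Γ(X, W)) ∈ I := hI ▸ Submodule.mem_top
    refine ⟨b, hb.trans ?_⟩
    ext s
    simp only [totMul_apply, rres_one, mulLin_one]
  apply ideal_eq_top hW
  intro x hx
  obtain ⟨a, ha⟩ : ∃ a, x ∈ U a := by
    have : x ∈ ⨆ i, U i := by rw [hU.cover]; trivial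
    exact Opens.mem_iSup.mp this
  obtain ⟨g, hg, hxg⟩ := basicOpen_mono_affine hW hx ha
  obtain ⟨b', hb'⟩ := exists_totD_eq_of_le f U M hg (totRes f U M (X.basicOpen_le g) c) (by
    rw [totD_totRes, hc, map_zero])
  obtain ⟨n, y, hy⟩ := exists_totRes_eq f hU.affine hM hW g b'
  obtain ⟨k, hk⟩ := exists_totMul_eq_zero f hU.affine hM hW g
    (totD f U M W y - totMul f U M (g ^ n) c) (by
      rw [map_sub, ← totD_totRes, hy, totD_totMul, hb', sub_eq_zero]
      ext s
      simp only [totMul_apply, totRes_apply, resLin_mulLin, rres_rres, rres_pow])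
  refine ⟨g ^ (k + n + 1), ⟨totMul f U M (g ^ (k + 1)) y, ?_⟩, ?_⟩
  · rw [map_sub, sub_eq_zero] at hk
    rw [totD_totMul, pow_succ', totMul_mul, hk, ← totMul_mul, ← totMul_mul]
    congr 1
    congr 1
    ring
  · rw [Scheme.basicOpen_pow _ _ (Nat.succ_pos _)]
    exact hxg

end exactness

section grading

variable (f : X ⟶ Spec (CommRingCat.of ℂ)) {m : ℕ} (U : Fin m → X.Opens) (M : X.Modules)

/-- Cochains of degree `p - 1`, i.e. those supported on sets of cardinality `p`. -/
def homog (W : X.Opens) (p : ℕ) : Submodule ℂ (TotCochain f U M W) where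
  carrier := {c | ∀ s, s.card ≠ p → c s = 0}
  add_mem' := by intro a b ha hb s hs; rw [Pi.add_apply, ha s hs, hb s hs, add_zero]
  zero_mem' := fun _ _ => rfl
  smul_mem' := by intro r a ha s hs; rw [Pi.smul_apply, ha s hs, smul_zero]

variable {f U M}

lemma totD_mem_homog {W : X.Opens} {p : ℕ} {c : TotCochain f U M W} (hc : c ∈ homog f U M W p) :
    totD f U M W c ∈ homog f U M W (p + 1) := by
  intro s hs
  rw [totD_apply]
  refine Finset.sum_eq_zero fun i hi => ?_
  rw [hc, map_zero, smul_zero]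
  rw [Finset.card_erase_of_mem hi]
  have := Finset.card_pos.mpr ⟨i, hi⟩
  omega

lemma totRes_mem_homog {W W' : X.Opens} (h : W' ≤ W) {p : ℕ} {c : TotCochain f U M W}
    (hc : c ∈ homog f U M W p) : totRes f U M h c ∈ homog f U M W' p := by
  intro s hs
  rw [totRes_apply, hc s hs, map_zero]

lemma exists_homog_totD_eq [X.IsSeparated] (hU : IsAffineCover U) (hM : IsLocalizing M)
    {W : X.Opens} (hW : IsAffineOpen W) {p : ℕ} {c : TotCochain f U M W}
    (hp : c ∈ homog f U M W (p + 1)) (hc : totD f U M W c = 0) :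
    ∃ b ∈ homog f U M W p, totD f U M W b = c := by
  obtain ⟨b, hb⟩ := exists_totD_eq f hU hM hW c hc
  -- The differential raises the cardinality by one, so only the part of `b` on sets of size `p`
  -- contributes to the part of size `p + 1`.
  refine ⟨fun s => if s.card = p then b s else 0, fun s hs => if_neg hs, ?_⟩
  ext s
  by_cases hs : s.card = p + 1
  · rw [← hb, totD_apply, totD_apply]
    refine Finset.sum_congr rfl fun i hi => ?_
    rw [if_pos]
    rw [Finset.card_erase_of_mem hi]; omega
  · rw [hp s hs, totD_apply]
    refine Finset.sum_eq_zero fun i hi => ?_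
    rw [if_neg, map_zero, smul_zero]
    rw [Finset.card_erase_of_mem hi]
    have := Finset.card_pos.mpr ⟨i, hi⟩
    omega

/-- A cochain of degree 0 lives on the empty set, and every coboundary has zero component there. -/
lemma eq_zero_of_homog_zero [X.IsSeparated] (hU : IsAffineCover U) (hM : IsLocalizing M)
    {W : X.Opens} (hW : IsAffineOpen W) {c : TotCochain f U M W}
    (hp : c ∈ homog f U M W 0) (hc : totD f U M W c = 0) : c = 0 := by
  obtain ⟨b, rfl⟩ := exists_totD_eq f hU hM hW c hc
  ext s
  by_cases hs : s.card = 0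
  · rw [Finset.card_eq_zero.mp hs, totD_apply]
    rfl
  · exact hp s hs

end grading

/-- `M` is zero on `W`. -/
def VanishesOn (M : X.Modules) (W : X.Opens) : Prop := ∀ V ≤ W, ∀ t : Γ(M, V), t = 0

/-- Every point outside `V` has a neighbourhood on which `M` is zero. -/
def SupportedIn (M : X.Modules) (V : X.Opens) : Prop := ∀ x ∉ V, ∃ W, x ∈ W ∧ VanishesOn M W

/-! ### Two affine open sets that cover the support -/

section two

variable {M : X.Modules} {V₀ V₁ : X.Opens}

/-- Away from `V₀` and `V₁` the sheaf vanishes locally, so these two open sets behave like a cover;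
the same holds for glueing. -/
lemma SupportedIn.eq_zero (hs : SupportedIn M (V₀ ⊔ V₁)) {W W₀ W₁ : X.Opens}
    (h₀ : W₀ = W ⊓ V₀) (h₁ : W₁ = W ⊓ V₁) (t : Γ(M, W))
    (e₀ : res M (h₀.le.trans inf_le_left) t = 0) (e₁ : res M (h₁.le.trans inf_le_left) t = 0) :
    t = 0 := by
  subst h₀ h₁
  apply section_ext
  intro x hx
  by_cases hx0 : x ∈ V₀
  · exact ⟨_, inf_le_left, ⟨hx, hx0⟩, by rw [e₀, res_zero]⟩
  by_cases hx1 : x ∈ V₁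
  · exact ⟨_, inf_le_left, ⟨hx, hx1⟩, by rw [e₁, res_zero]⟩
  obtain ⟨Z, hxZ, hZ⟩ := hs x (by rintro (h | h) <;> contradiction)
  exact ⟨W ⊓ Z, inf_le_left, ⟨hx, hxZ⟩, (hZ _ inf_le_right _).trans (hZ _ inf_le_right _).symm⟩

lemma SupportedIn.exists_glue (hs : SupportedIn M (V₀ ⊔ V₁)) {W W₀ W₁ W₀₁ : X.Opens}
    (h₀ : W₀ = W ⊓ V₀) (h₁ : W₁ = W ⊓ V₁) (hle₀ : W₀₁ ≤ W₀) (hle₁ : W₀₁ ≤ W₁)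
    (h₀₁ : W₀ ⊓ W₁ ≤ W₀₁) (t₀ : Γ(M, W₀)) (t₁ : Γ(M, W₁))
    (e : res M hle₀ t₀ = res M hle₁ t₁) :
    ∃ t : Γ(M, W), res M (h₀.le.trans inf_le_left) t = t₀ ∧
      res M (h₁.le.trans inf_le_left) t = t₁ := by
  -- The largest open set on which `M` vanishes. With it as a third member, carrying the section 0,
  -- the two given open sets become a genuine cover of `W`.
  let Z : X.Opens := sSup {Z | VanishesOn M Z}
  have hZ : ∀ V ≤ Z, ∀ t : Γ(M, V), t = 0 := by
    intro V hV t
    apply section_ext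
    intro x hx
    obtain ⟨Y, hY, hxY⟩ := Opens.mem_sSup.mp (hV hx)
    exact ⟨V ⊓ Y, inf_le_left, ⟨hx, hxY⟩, (hY _ inf_le_right _).trans (hY _ inf_le_right _).symm⟩
  let c : Option Bool → X.Opens := fun o => o.elim (W ⊓ Z) (fun b => if b then W₁ else W₀)
  let s : ∀ o, Γ(M, c o) := fun o => match o with
    | none => 0
    | some false => t₀
    | some true => t₁
  have hc : ∀ o, c o ≤ W := fun o => match o with
    | none => inf_le_left
    | some false => h₀.le.trans inf_le_left
    | some true => h₁.le.trans inf_le_left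
  have key : res M (inf_le_left : W₀ ⊓ W₁ ≤ W₀) t₀ = res M (inf_le_right : W₀ ⊓ W₁ ≤ W₁) t₁ := by
    have := congrArg (res M h₀₁) e
    rwa [res_res, res_res] at this
  have key' : res M (inf_le_left : W₁ ⊓ W₀ ≤ W₁) t₁ = res M (inf_le_right : W₁ ⊓ W₀ ≤ W₀) t₀ := by
    have := congrArg (res M (inf_comm W₁ W₀).le) key
    rw [res_res, res_res] at this
    exact this.symm
  obtain ⟨t, ht⟩ := LimitPairs.exists_glue M c hc (by
    intro x hx
    rw [Opens.mem_iSup]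
    by_cases hx0 : x ∈ V₀
    · exact ⟨some false, h₀.ge ⟨hx, hx0⟩⟩
    by_cases hx1 : x ∈ V₁
    · exact ⟨some true, h₁.ge ⟨hx, hx1⟩⟩
    obtain ⟨Y, hxY, hY⟩ := hs x (by rintro (h | h) <;> contradiction)
    exact ⟨none, hx, Opens.mem_sSup.mpr ⟨Y, hY, hxY⟩⟩) s (by
    intro i j
    rcases i with _ | b
    · have h1 : c none ⊓ c j ≤ Z := inf_le_left.trans inf_le_right
      rw [hZ _ h1 (res M _ _)]
      exact (hZ _ h1 _).symm
    rcases j with _ | b'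
    · have h1 : c (some b) ⊓ c none ≤ Z := inf_le_right.trans inf_le_right
      rw [hZ _ h1 (res M _ _)]
      exact (hZ _ h1 _).symm
    rcases b <;> rcases b'
    · rfl
    · exact key
    · exact key'
    · rfl)
  exact ⟨t, ht (some false), ht (some true)⟩

/-- On an affine open set the cover by `V₀` and `V₁` has no first cohomology. -/
lemma SupportedIn.exists_sub_eq [X.IsSeparated] (hM : IsLocalizing M)
    (hs : SupportedIn M (V₀ ⊔ V₁)) (hV₀ : IsAffineOpen V₀) (hV₁ : IsAffineOpen V₁)
    {W W₀ W₁ W₀₁ : X.Opens} (hW : IsAffineOpen W)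
    (h₀ : W₀ = W ⊓ V₀) (h₁ : W₁ = W ⊓ V₁) (h₀₁ : W₀₁ = W₀ ⊓ W₁) (n : Γ(M, W₀₁)) :
    ∃ (t₀ : Γ(M, W₀)) (t₁ : Γ(M, W₁)),
      res M (h₀₁.le.trans inf_le_left) t₀ - res M (h₀₁.le.trans inf_le_right) t₁ = n := by
  have hW₀ : IsAffineOpen W₀ := h₀ ▸ isAffineOpen_inf hW hV₀
  have hW₁ : IsAffineOpen W₁ := h₁ ▸ isAffineOpen_inf hW hV₁
  have hW₀₁ : IsAffineOpen W₀₁ := h₀₁ ▸ isAffineOpen_inf hW₀ hW₁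
  have l₀ : W₀ ≤ W := h₀.le.trans inf_le_left
  have l₁ : W₁ ≤ W := h₁.le.trans inf_le_left
  have l₀₁ : W₀₁ ≤ W := (h₀₁.le.trans inf_le_left).trans l₀
  let I : Ideal Γ(X, W) :=
    { carrier := {g | ∃ (t₀ : Γ(M, W₀)) (t₁ : Γ(M, W₁)),
        res M (h₀₁.le.trans inf_le_left) t₀ - res M (h₀₁.le.trans inf_le_right) t₁ =
          rres l₀₁ g • n}
      add_mem' := by
        rintro g g' ⟨a, b, h⟩ ⟨a', b', h'⟩
        refine ⟨a + a', b + b', ?_⟩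
        rw [res_add, res_add, add_sub_add_comm, h, h', ← add_smul]
        congr 1
        exact (map_add _ _ _).symm
      zero_mem' := ⟨0, 0, by simp [rres]⟩
      smul_mem' := by
        rintro g g' ⟨a, b, h⟩
        refine ⟨rres l₀ g • a, rres l₁ g • b, ?_⟩
        rw [res_smul, res_smul, rres_rres, rres_rres, ← smul_sub, h, ← mul_smul, smul_eq_mul,
          rres_mul] }
  suffices hI : I = ⊤ by
    obtain ⟨a, b, h⟩ : (1 : Γ(X, W)) ∈ I := hI ▸ Submodule.mem_top
    exact ⟨a, b, by rw [h, rres_one, one_smul]⟩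
  -- A decomposition of `g ^ k n` that holds over `D(g)` holds over the whole of `W₀₁` after
  -- multiplication by a further power of `g`. So it is enough to solve the problem on `D(g)`.
  have red : ∀ (g : Γ(X, W)) (t₀ : Γ(M, W₀)) (t₁ : Γ(M, W₁)) (k : ℕ),
      (∀ (h : W₀₁ ⊓ X.basicOpen g ≤ W₀₁), res M h
      (res M (h₀₁.le.trans inf_le_left) t₀ - res M (h₀₁.le.trans inf_le_right) t₁ -
        rres l₀₁ g ^ k • n) = 0) → ∃ l : ℕ, g ^ (l + 1) ∈ I := by
    intro g t₀ t₁ k h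
    obtain ⟨l, hl⟩ := hM.exists_pow_inf l₀₁ hW₀₁ g rfl _ (h inf_le_left)
    refine ⟨l + k, rres l₀ g ^ (l + 1) • t₀, rres l₁ g ^ (l + 1) • t₁, ?_⟩
    rw [smul_sub, sub_eq_zero] at hl
    rw [res_smul, res_smul, rres_pow, rres_pow, rres_rres, rres_rres, ← smul_sub, pow_succ',
      mul_smul, hl, rres_pow, ← mul_smul, ← mul_smul]
    congr 1
    ring
  apply ideal_eq_top hW
  intro x hx
  suffices h : ∃ g : Γ(X, W), x ∈ X.basicOpen g ∧ ∃ l : ℕ, g ^ (l + 1) ∈ I by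
    obtain ⟨g, hg, l, hl⟩ := h
    refine ⟨_, hl, ?_⟩
    rw [Scheme.basicOpen_pow _ _ (Nat.succ_pos _)]
    exact hg
  by_cases hx0 : x ∈ V₀
  · obtain ⟨g, hg, hxg⟩ := basicOpen_mono_affine hW hx hx0
    refine ⟨g, hxg, ?_⟩
    -- If `D(g)` lies in `V₀`, then over `D(g)` the intersection is all of `W₁`, and a multiple of
    -- `n` extends to `W₁`: take 0 on `W₀` and minus the extension on `W₁`.
    have hD : W₀₁ ⊓ X.basicOpen g = W₁ ⊓ X.basicOpen g := by
      subst h₀ h₁ h₀₁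
      apply le_antisymm
      · exact inf_le_inf_right _ inf_le_right
      · exact le_inf (le_inf (le_inf (inf_le_left.trans inf_le_left) (inf_le_right.trans hg))
          inf_le_left) inf_le_right
    obtain ⟨k, y, hy⟩ := hM.exists_lift_inf l₁ hW₁ g hD (res M inf_le_left n)
    refine red g 0 (-y) k fun h => ?_
    have hn : res M (h₀₁.le.trans inf_le_right) (-y) = - res M (h₀₁.le.trans inf_le_right) y :=
      map_neg _ _
    rw [hn, res_zero, zero_sub, neg_neg, res_sub, res_res, hy, res_smul, rres_pow, rres_rres,
      sub_self]
  by_cases hx1 : x ∈ V₁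
  · obtain ⟨g, hg, hxg⟩ := basicOpen_mono_affine hW hx hx1
    refine ⟨g, hxg, ?_⟩
    have hD : W₀₁ ⊓ X.basicOpen g = W₀ ⊓ X.basicOpen g := by
      subst h₀ h₁ h₀₁
      apply le_antisymm
      · exact inf_le_inf_right _ inf_le_left
      · exact le_inf (le_inf inf_le_left (le_inf (inf_le_left.trans inf_le_left)
          (inf_le_right.trans hg))) inf_le_right
    obtain ⟨k, y, hy⟩ := hM.exists_lift_inf l₀ hW₀ g hD (res M inf_le_left n)
    refine red g y 0 k fun h => ?_
    rw [res_zero, sub_zero, res_sub, res_res, hy, res_smul, rres_pow, rres_rres, sub_self]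
  obtain ⟨Y, hxY, hY⟩ := hs x (by rintro (h | h) <;> contradiction)
  obtain ⟨g, hg, hxg⟩ := basicOpen_mono_affine hW hx hxY
  exact ⟨g, hxg, red g 0 0 0 fun h => hY _ (inf_le_right.trans hg) _⟩

end two

/-! ### Ordered Čech cochains as cochains indexed by finite sets -/

section compare

variable (f : X ⟶ Spec (CommRingCat.of ℂ)) {m : ℕ} (U : Fin m → X.Opens) (M : X.Modules)

lemma interF_le_inter {p : ℕ} {s : Finset (Fin m)} (σ : Fin (p + 1) ↪o Fin m)
    (h : ∀ j, σ j ∈ s) : interF U ⊤ s ≤ inter U σ :=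
  le_iInf fun j => inf_le_right.trans (Finset.inf_le (h j))

lemma inter_le_interF {p : ℕ} (σ : Fin (p + 1) ↪o Fin m) :
    inter U σ ≤ interF U ⊤ (Finset.univ.map σ.toEmbedding) := by
  refine le_inf le_top (Finset.le_inf fun i hi => ?_)
  obtain ⟨j, -, rfl⟩ := Finset.mem_map.mp hi
  exact iInf_le (fun j => U (σ j)) j

lemma resLin_cochain_congr {p : ℕ} (z : Cochain f U M p) {σ τ : Fin (p + 1) ↪o Fin m}
    (e : σ = τ) {W : X.Opens} (hσ : W ≤ inter U σ) (hτ : W ≤ inter U τ) :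
    resLin f M hσ (z σ) = resLin f M hτ (z τ) := by
  subst e; rfl

/-- A Čech cochain as a cochain indexed by finite sets. -/
def extC (p : ℕ) : Cochain f U M p →ₗ[ℂ] TotCochain f U M ⊤ :=
  LinearMap.pi fun s => if h : s.card = p + 1 then
    (resLin f M (interF_le_inter U (s.orderEmbOfFin h) (s.orderEmbOfFin_mem h))).comp
      (LinearMap.proj (s.orderEmbOfFin h)) else 0

lemma extC_apply {p : ℕ} (z : Cochain f U M p) {s : Finset (Fin m)} (σ : Fin (p + 1) ↪o Fin m)
    (h : s = Finset.univ.map σ.toEmbedding) : extC f U M p z s =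
      resLin f M (interF_le_inter U σ (by simp [h])) (z σ) := by
  have hc : s.card = p + 1 := by simp [h]
  simp only [extC, LinearMap.pi_apply, dif_pos hc]
  exact resLin_cochain_congr f U M z
    (Finset.orderEmbOfFin_unique' hc (by simp [h])).symm _ _

lemma extC_mem_homog {p : ℕ} (z : Cochain f U M p) : extC f U M p z ∈ homog f U M ⊤ (p + 1) := by
  intro s hs
  simp only [extC, LinearMap.pi_apply, dif_neg hs, LinearMap.zero_apply]

lemma exists_extC_eq {p : ℕ} {c : TotCochain f U M ⊤} (hc : c ∈ homog f U M ⊤ (p + 1)) :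
    ∃ z, extC f U M p z = c := by
  refine ⟨fun σ => resLin f M (inter_le_interF U σ) (c _), ?_⟩
  ext s
  by_cases hs : s.card = p + 1
  · have e : s = Finset.univ.map (s.orderEmbOfFin hs).toEmbedding := by simp
    rw [extC_apply f U M _ (s.orderEmbOfFin hs) e, resLin_resLin,
      resLin_congr f U M c e.symm _ le_rfl, resLin_self]
  · rw [hc s hs, extC_mem_homog f U M _ s hs]

lemma extC_injective (p : ℕ) : Function.Injective (extC f U M p) := by
  rw [injective_iff_map_eq_zero]
  intro z hz
  ext σ
  have h := congrFun hz (Finset.univ.map σ.toEmbedding)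
  rw [extC_apply f U M z σ rfl] at h
  have h' := congrArg (resLin f M (inter_le_interF U σ)) h
  rw [resLin_resLin, resLin_self] at h'
  rw [h']
  exact map_zero _

lemma sgn_map {p : ℕ} (σ : Fin (p + 2) ↪o Fin m) (j : Fin (p + 2)) :
    sgn (σ j) (Finset.univ.map σ.toEmbedding) = (-1) ^ (j : ℕ) := by
  rw [sgn]
  congr 1
  have : (Finset.univ.map σ.toEmbedding).filter (· < σ j) =
      (Finset.Iio j).map σ.toEmbedding := by
    ext i
    simp only [Finset.mem_filter, Finset.mem_map, Finset.mem_univ, true_and, Finset.mem_Iio]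
    constructor
    · rintro ⟨⟨k, rfl⟩, hk⟩
      exact ⟨k, σ.lt_iff_lt.mp hk, rfl⟩
    · rintro ⟨k, hk, rfl⟩
      exact ⟨⟨k, rfl⟩, σ.lt_iff_lt.mpr hk⟩
  rw [this, Finset.card_map, Fin.card_Iio]

lemma map_face {p : ℕ} (σ : Fin (p + 2) ↪o Fin m) (j : Fin (p + 2)) :
    (Finset.univ.map σ.toEmbedding).erase (σ j) =
      Finset.univ.map (face σ j).toEmbedding := by
  ext i
  simp only [Finset.mem_erase, Finset.mem_map, Finset.mem_univ, true_and]
  constructor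
  · rintro ⟨hne, k, rfl⟩
    obtain ⟨l, rfl⟩ := Fin.exists_succAbove_eq (x := k) (y := j) (fun h => hne (by rw [h]; rfl))
    exact ⟨l, rfl⟩
  · rintro ⟨l, rfl⟩
    refine ⟨fun h => Fin.succAbove_ne j l (σ.injective h), _, rfl⟩

lemma totD_extC (p : ℕ) (z : Cochain f U M p) :
    totD f U M ⊤ (extC f U M p z) = extC f U M (p + 1) (cechD f U M p z) := by
  ext s
  by_cases hs : s.card = p + 2
  · obtain ⟨σ, rfl⟩ : ∃ σ : Fin (p + 2) ↪o Fin m, s = Finset.univ.map σ.toEmbedding :=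
      ⟨s.orderEmbOfFin hs, by simp⟩
    rw [extC_apply f U M _ σ rfl, totD_apply, Finset.sum_map]
    simp only [cechD, LinearMap.pi_apply, LinearMap.sum_apply, LinearMap.smul_apply,
      LinearMap.comp_apply, LinearMap.proj_apply, map_sum, map_smul, resLin_resLin]
    refine Finset.sum_congr rfl fun j _ => ?_
    have e : sgn (σ.toEmbedding j) (Finset.univ.map σ.toEmbedding) = (-1) ^ (j : ℕ) :=
      sgn_map σ j
    rw [e]
    congr 1
    refine (congrArg _ (extC_apply f U M z (face σ j) (map_face σ j))).trans ?_
    rw [resLin_resLin]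
  · rw [extC_mem_homog f U M _ s hs]
    exact totD_mem_homog (extC_mem_homog f U M z) s hs

end compare

/-! ### Diagram chase in the double complex of two covers -/

section chase

variable {C E N : Type*} [AddCommGroup C] [Module ℂ C] [AddCommGroup E] [Module ℂ E]
  [AddCommGroup N] [Module ℂ N]

/-- Differential graded modules `C ⟶ E ⟶ N` such that `E` and `N` are exact and the sequence is
exact except for the surjectivity in degree zero. -/
structure IsTwoStepResolution (dC : C →ₗ[ℂ] C) (dE : E →ₗ[ℂ] E) (dN : N →ₗ[ℂ] N)
    (gC : ℕ → Submodule ℂ C) (gE : ℕ → Submodule ℂ E) (gN : ℕ → Submodule ℂ N)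
    (α : C →ₗ[ℂ] E) (β : E →ₗ[ℂ] N) : Prop where
  dgE : ∀ {p c}, c ∈ gE p → dE c ∈ gE (p + 1)
  dgN : ∀ {p c}, c ∈ gN p → dN c ∈ gN (p + 1)
  dα : ∀ c, dE (α c) = α (dC c)
  dβ : ∀ c, dN (β c) = β (dE c)
  ddE : ∀ c, dE (dE c) = 0
  ddN : ∀ c, dN (dN c) = 0
  exE : ∀ {p c}, c ∈ gE (p + 1) → dE c = 0 → ∃ b ∈ gE p, dE b = c
  exN : ∀ {p c}, c ∈ gN (p + 1) → dN c = 0 → ∃ b ∈ gN p, dN b = c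
  zeroE : ∀ {c}, c ∈ gE 0 → dE c = 0 → c = 0
  zeroN : ∀ {c}, c ∈ gN 0 → dN c = 0 → c = 0
  inj : ∀ {c}, α c = 0 → c = 0
  αg : ∀ {p c}, c ∈ gC p → α c ∈ gE p
  βg : ∀ {p c}, c ∈ gE p → β c ∈ gN p
  βα : ∀ c, β (α c) = 0
  ker : ∀ {p c}, c ∈ gE p → β c = 0 → ∃ b ∈ gC p, α b = c
  surj : ∀ {p c}, c ∈ gN (p + 1) → ∃ b ∈ gE (p + 1), β b = c

namespace IsTwoStepResolution

variable {dC : C →ₗ[ℂ] C} {dE : E →ₗ[ℂ] E} {dN : N →ₗ[ℂ] N}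
    {gC : ℕ → Submodule ℂ C} {gE : ℕ → Submodule ℂ E} {gN : ℕ → Submodule ℂ N}
    {α : C →ₗ[ℂ] E} {β : E →ₗ[ℂ] N} (H : IsTwoStepResolution dC dE dN gC gE gN α β)
include H

lemma closed_of {c : C} {e : E} (h : dE e = α c) : dC c = 0 :=
  H.inj (by rw [← H.dα, ← h, H.ddE])

/-- In this grading degree `p` means index sets of size `p`: a Čech cocycle of degree 0 lies in `gC
1`, and degree 0 of `E` consists of pairs of sections over `V₀` and `V₁`. The kernel of `β` on such
pairs corresponds to the cocycles of degree 0. -/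
lemma exists_zero {c : C} (hc : c ∈ gC 1) (h : dC c = 0) :
    ∃ e ∈ gE 0, β e = 0 ∧ dE e = α c := by
  obtain ⟨e, he, hec⟩ := H.exE (H.αg hc) (by rw [H.dα, h, map_zero])
  exact ⟨e, he, H.zeroN (H.βg he) (by rw [H.dβ, hec, H.βα]), hec⟩

lemma exists_zero' {e : E} (he : e ∈ gE 0) (h : β e = 0) : ∃ c ∈ gC 1, dE e = α c := by
  obtain ⟨c, hc, h⟩ := H.ker (H.dgE he) (by rw [← H.dβ, h, map_zero])
  exact ⟨c, hc, h.symm⟩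

/-- The zigzag from Čech 1-cocycles to sections over `V₀ ∩ V₁`: solve in `E`, apply `β`, and solve
again in `N`. The lemma `exists_one'` runs it backwards. -/
lemma exists_one {c : C} (hc : c ∈ gC 2) (h : dC c = 0) :
    ∃ n ∈ gN 0, ∃ e ∈ gE 1, β e = dN n ∧ dE e = α c := by
  obtain ⟨e, he, hec⟩ := H.exE (H.αg hc) (by rw [H.dα, h, map_zero])
  obtain ⟨n, hn, hne⟩ := H.exN (H.βg he) (by rw [H.dβ, hec, H.βα])
  exact ⟨n, hn, e, he, hne.symm, hec⟩

lemma exists_one' {n : N} (hn : n ∈ gN 0) :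
    ∃ c ∈ gC 2, ∃ e ∈ gE 1, β e = dN n ∧ dE e = α c := by
  obtain ⟨e, he, hen⟩ := H.surj (H.dgN hn)
  obtain ⟨c, hc, h⟩ := H.ker (H.dgE he) (by rw [← H.dβ, hen, H.ddN])
  exact ⟨c, hc, e, he, hen, h.symm⟩

/-- For two ends `n` and `c` of a zigzag through `e`, being a coboundary on one side is equivalent
to being one on the other: subtract from `e` the differential of a lift of `n`, respectively the
image of a primitive of `c`. -/
lemma one_iff {n : N} (hn : n ∈ gN 0) {c : C} {e : E} (he : e ∈ gE 1)
    (h₁ : β e = dN n) (h₂ : dE e = α c) : (∃ e₀ ∈ gE 0, β e₀ = n) ↔ ∃ b ∈ gC 1, dC b = c := by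
  constructor
  · rintro ⟨e₀, he₀, rfl⟩
    obtain ⟨b, hb, h⟩ := H.ker (sub_mem he (H.dgE he₀)) (by rw [map_sub, h₁, H.dβ, sub_self])
    refine ⟨b, hb, ?_⟩
    rw [← sub_eq_zero]
    apply H.inj
    rw [map_sub, ← H.dα, h, map_sub, H.ddE, h₂, sub_zero, sub_self]
  · rintro ⟨b, hb, rfl⟩
    obtain ⟨e₀, he₀, h⟩ := H.exE (sub_mem he (H.αg hb)) (by rw [map_sub, h₂, H.dα, sub_self])
    refine ⟨e₀, he₀, ?_⟩
    rw [← sub_eq_zero]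
    apply H.zeroN (sub_mem (H.βg he₀) hn)
    rw [map_sub, H.dβ, h, map_sub, H.βα, h₁, sub_zero, sub_self]

/-- In these degrees the element `n` at the end of the zigzag has positive degree, where `β` is
surjective, so the obstruction of `one_iff` vanishes. -/
lemma exists_of_three_le {p : ℕ} {c : C} (hc : c ∈ gC (p + 3)) (h : dC c = 0) :
    ∃ b ∈ gC (p + 2), dC b = c := by
  obtain ⟨e, he, hec⟩ := H.exE (H.αg hc) (by rw [H.dα, h, map_zero])
  obtain ⟨n, hn, hne⟩ := H.exN (H.βg he) (by rw [H.dβ, hec, H.βα])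
  obtain ⟨e₀, he₀, rfl⟩ := H.surj hn
  obtain ⟨b, hb, h'⟩ := H.ker (sub_mem he (H.dgE he₀)) (by rw [map_sub, ← hne, H.dβ, sub_self])
  refine ⟨b, hb, ?_⟩
  rw [← sub_eq_zero]
  apply H.inj
  rw [map_sub, ← H.dα, h', map_sub, H.ddE, hec, sub_zero, sub_self]

end IsTwoStepResolution

/-- The comparison of cohomologies is a zigzag rather than a map. A linear relation, total on both
sides and matching the two subspaces, induces an isomorphism of the quotients all the same. -/
lemma finrank_quotient_eq_of_rel {P Q : Type*} [AddCommGroup P] [Module ℂ P] [AddCommGroup Q]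
    [Module ℂ Q] (Y : Submodule ℂ (P × Q)) (P₀ : Submodule ℂ P) (Q₀ : Submodule ℂ Q)
    (h₁ : ∀ p, ∃ q, (p, q) ∈ Y) (h₂ : ∀ q, ∃ p, (p, q) ∈ Y)
    (h₃ : ∀ p q, (p, q) ∈ Y → (p ∈ P₀ ↔ q ∈ Q₀)) :
    Module.finrank ℂ (P ⧸ P₀) = Module.finrank ℂ (Q ⧸ Q₀) := by
  let f : Y →ₗ[ℂ] P ⧸ P₀ := P₀.mkQ ∘ₗ LinearMap.fst ℂ P Q ∘ₗ Y.subtype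
  let g : Y →ₗ[ℂ] Q ⧸ Q₀ := Q₀.mkQ ∘ₗ LinearMap.snd ℂ P Q ∘ₗ Y.subtype
  have hf : Function.Surjective f := by
    intro p
    obtain ⟨p, rfl⟩ := P₀.mkQ_surjective p
    obtain ⟨q, hq⟩ := h₁ p
    exact ⟨⟨_, hq⟩, rfl⟩
  have hg : Function.Surjective g := by
    intro q
    obtain ⟨q, rfl⟩ := Q₀.mkQ_surjective q
    obtain ⟨p, hp⟩ := h₂ q
    exact ⟨⟨_, hp⟩, rfl⟩
  have hk : LinearMap.ker f = LinearMap.ker g := by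
    ext ⟨⟨p, q⟩, h⟩
    simpa [f, g] using h₃ p q h
  exact ((f.quotKerEquivOfSurjective hf).symm ≪≫ₗ Submodule.quotEquivOfEq _ _ hk ≪≫ₗ
    g.quotKerEquivOfSurjective hg).finrank_eq

end chase

/-! ### The Euler characteristic as the index of a two-term complex -/

section euler

variable (f : X ⟶ Spec (CommRingCat.of ℂ)) {m : ℕ} (U : Fin m → X.Opens) (M : X.Modules)

/-- A section, as a cochain of degree `-1`. -/
def placeC (W : X.Opens) : Sec f M W →ₗ[ℂ] TotCochain f U M W :=
  LinearMap.pi fun s => if s.card = 0 then resLin f M (interF_le U W s) else 0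

lemma placeC_apply_empty (W : X.Opens) (t : Sec f M W) :
    placeC f U M W t ∅ = resLin f M (interF_le U W ∅) t := by
  simp [placeC]

lemma placeC_mem_homog (W : X.Opens) (t : Sec f M W) : placeC f U M W t ∈ homog f U M W 0 := by
  intro s hs
  simp only [placeC, LinearMap.pi_apply, if_neg hs, LinearMap.zero_apply]

lemma ext_homog_zero {W : X.Opens} {c c' : TotCochain f U M W} (hc : c ∈ homog f U M W 0)
    (hc' : c' ∈ homog f U M W 0) (h : c ∅ = c' ∅) : c = c' := by
  ext s
  by_cases hs : s.card = 0
  · rw [Finset.card_eq_zero] at hs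
    subst hs
    exact h
  · rw [hc s hs, hc' s hs]

lemma le_interF_empty (W : X.Opens) : W ≤ interF U W ∅ := by simp [interF]

lemma placeC_injective (W : X.Opens) : Function.Injective (placeC f U M W) := by
  intro a b h
  have h1 := congrFun h ∅
  rw [placeC_apply_empty, placeC_apply_empty] at h1
  simpa [resLin_resLin] using congrArg (resLin f M (le_interF_empty U W)) h1

lemma exists_placeC_eq {W : X.Opens} {c : TotCochain f U M W} (hc : c ∈ homog f U M W 0) :
    ∃ t, placeC f U M W t = c :=
  ⟨resLin f M (le_interF_empty U W) (c ∅), ext_homog_zero f U M (placeC_mem_homog _ _ _ _ _) hc (by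
    rw [placeC_apply_empty, resLin_resLin, resLin_self])⟩

lemma totRes_placeC {W W' : X.Opens} (h : W' ≤ W) (t : Sec f M W) :
    totRes f U M h (placeC f U M W t) = placeC f U M W' (resLin f M h t) :=
  ext_homog_zero f U M (totRes_mem_homog h (placeC_mem_homog _ _ _ _ _))
    (placeC_mem_homog _ _ _ _ _) (by
      rw [totRes_apply, placeC_apply_empty, placeC_apply_empty, resLin_resLin, resLin_resLin])

variable (V₀ V₁ : X.Opens)

/-- The Čech differential of the two-set cover `V₀, V₁`. -/
def twoD : Sec f M V₀ × Sec f M V₁ →ₗ[ℂ] Sec f M (V₀ ⊓ V₁) :=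
  (resLin f M inf_le_left).coprod (-(resLin f M inf_le_right))

lemma interF_eq_top_inf (V : X.Opens) (s : Finset (Fin m)) :
    interF U V s = interF U ⊤ s ⊓ V := by
  rw [interF, interF, top_inf_eq, inf_comm]

variable {U M V₀ V₁}

/-- `V₀`, `V₁` and `V₀ ∩ V₁` are affine, so their augmented Čech complexes are exact. Surjectivity
of the last map needs an affine `interF U ⊤ s`, which is available for nonempty `s` only, hence in
positive degrees; its failure for `s = ∅` is the first cohomology of the two-set cover. -/
lemma isTwoStepResolution [X.IsSeparated] (hU : IsAffineCover U) (hM : IsLocalizing M)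
    (hV₀ : IsAffineOpen V₀) (hV₁ : IsAffineOpen V₁) (hs : SupportedIn M (V₀ ⊔ V₁)) :
    IsTwoStepResolution (totD f U M ⊤) ((totD f U M V₀).prodMap (totD f U M V₁))
      (totD f U M (V₀ ⊓ V₁)) (homog f U M ⊤)
      (fun p => (homog f U M V₀ p).prod (homog f U M V₁ p)) (homog f U M (V₀ ⊓ V₁))
      ((totRes f U M le_top).prod (totRes f U M le_top))
      ((totRes f U M inf_le_left).coprod (-(totRes f U M inf_le_right))) := by
  have inj : ∀ {c : TotCochain f U M ⊤} (s : Finset (Fin m)),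
      totRes f U M (le_top : V₀ ≤ ⊤) c s = 0 → totRes f U M (le_top : V₁ ≤ ⊤) c s = 0 →
        c s = 0 := fun {c} s h0 h1 =>
    hs.eq_zero (interF_eq_top_inf U V₀ s) (interF_eq_top_inf U V₁ s) (c s) h0 h1
  have hsub : ∀ (a : TotCochain f U M V₀) (b : TotCochain f U M V₁),
    ((totRes f U M (inf_le_left : V₀ ⊓ V₁ ≤ V₀)).coprod (-(totRes f U M inf_le_right))) (a, b) =
      totRes f U M inf_le_left a - totRes f U M inf_le_right b := fun a b => by
    rw [LinearMap.coprod_apply, LinearMap.neg_apply, sub_eq_add_neg]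
  refine ⟨fun h => ⟨totD_mem_homog h.1, totD_mem_homog h.2⟩, totD_mem_homog,
    fun c => ?_, fun c => ?_, fun c => ?_, totD_totD f U M _, ?_,
    exists_homog_totD_eq hU hM (isAffineOpen_inf hV₀ hV₁), ?_,
    eq_zero_of_homog_zero hU hM (isAffineOpen_inf hV₀ hV₁), ?_, ?_, ?_, ?_, ?_, ?_⟩
  · exact Prod.ext (totD_totRes _ _ _ _ _) (totD_totRes _ _ _ _ _)
  · obtain ⟨a, b⟩ := c
    rw [hsub, map_sub, totD_totRes, totD_totRes]
    exact (hsub _ _).symm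
  · exact Prod.ext (totD_totD _ _ _ _ _) (totD_totD _ _ _ _ _)
  · rintro p ⟨a, b⟩ ⟨ha, hb⟩ h
    obtain ⟨a', ha', h1⟩ := exists_homog_totD_eq hU hM hV₀ ha (congrArg Prod.fst h)
    obtain ⟨b', hb', h2⟩ := exists_homog_totD_eq hU hM hV₁ hb (congrArg Prod.snd h)
    exact ⟨(a', b'), ⟨ha', hb'⟩, Prod.ext h1 h2⟩
  · rintro ⟨a, b⟩ ⟨ha, hb⟩ h
    exact Prod.ext (eq_zero_of_homog_zero hU hM hV₀ ha (congrArg Prod.fst h))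
      (eq_zero_of_homog_zero hU hM hV₁ hb (congrArg Prod.snd h))
  · intro c h
    ext s
    exact inj s (congrFun (congrArg Prod.fst h) s) (congrFun (congrArg Prod.snd h) s)
  · exact fun h => ⟨totRes_mem_homog _ h, totRes_mem_homog _ h⟩
  · rintro p ⟨a, b⟩ ⟨ha, hb⟩
    rw [hsub]
    exact sub_mem (totRes_mem_homog _ ha) (totRes_mem_homog _ hb)
  · intro c
    refine (hsub _ _).trans ?_
    ext s
    simp only [Pi.sub_apply, totRes_apply, resLin_resLin, sub_self, Pi.zero_apply]
  · rintro p ⟨a, b⟩ ⟨ha, hb⟩ h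
    rw [hsub, sub_eq_zero] at h
    have H := fun s => hs.exists_glue (interF_eq_top_inf U V₀ s) (interF_eq_top_inf U V₁ s)
      (interF_mono U (inf_le_left : V₀ ⊓ V₁ ≤ V₀) s) (interF_mono U inf_le_right s)
      (by
        simp only [interF]
        exact le_inf (inf_le_inf inf_le_left inf_le_left) (inf_le_left.trans inf_le_right))
      (a s) (b s) (congrFun h s)
    choose c hc using H
    have e : ((totRes f U M le_top).prod (totRes f U M le_top)) c = (a, b) :=
      Prod.ext (funext fun s => (hc s).1) (funext fun s => (hc s).2)
    refine ⟨c, fun s hsp => inj s ?_ ?_, e⟩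
    · exact (hc s).1.trans (ha s hsp)
    · exact (hc s).2.trans (hb s hsp)
  · intro p n hn
    have H : ∀ s, ∃ (a : Sec f M (interF U V₀ s)) (b : Sec f M (interF U V₁ s)),
        (s.card ≠ p + 1 → a = 0) ∧ (s.card ≠ p + 1 → b = 0) ∧
        resLin f M (interF_mono U inf_le_left s) a - resLin f M (interF_mono U inf_le_right s) b =
          n s := by
      intro s
      by_cases hsp : s.card = p + 1
      · obtain ⟨a, b, h⟩ := hs.exists_sub_eq hM hV₀ hV₁
          (isAffineOpen_interF_top hU.affine (Finset.card_pos.mp (by omega) : s.Nonempty))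
          (interF_eq_top_inf U V₀ s) (interF_eq_top_inf U V₁ s)
          (show interF U (V₀ ⊓ V₁) s = _ by simp only [interF]; exact inf_inf_distrib_right _ _ _)
          (n s)
        exact ⟨a, b, fun h => absurd hsp h, fun h => absurd hsp h, h⟩
      · exact ⟨0, 0, fun _ => rfl, fun _ => rfl, by rw [map_zero, map_zero, sub_zero, hn s hsp]⟩
    choose a b ha hb hab using H
    exact ⟨(a, b), ⟨ha, hb⟩, (hsub _ _).trans (funext hab)⟩

end euler

section euler

variable (f : X ⟶ Spec (CommRingCat.of ℂ)) {m : ℕ} {U : Fin m → X.Opens} {M : X.Modules}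
  {V₀ V₁ : X.Opens}

lemma cechD_eq_zero_iff {p : ℕ} (z : Cochain f U M p) :
    cechD f U M p z = 0 ↔ totD f U M ⊤ (extC f U M p z) = 0 := by
  rw [totD_extC, map_eq_zero_iff _ (extC_injective f U M (p + 1))]

section
variable [X.IsSeparated] (hU : IsAffineCover U) (hM : IsLocalizing M)
    (hV₀ : IsAffineOpen V₀) (hV₁ : IsAffineOpen V₁) (hs : SupportedIn M (V₀ ⊔ V₁))
include hU hM hV₀ hV₁ hs

lemma finrank_cechH_zero :
    Module.finrank ℂ (CechH f U M 0) = Module.finrank ℂ (LinearMap.ker (twoD f M V₀ V₁)) := by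
  have H := isTwoStepResolution f hU hM hV₀ hV₁ hs
  let A : Sec f M V₀ × Sec f M V₁ →ₗ[ℂ] TotCochain f U M V₀ × TotCochain f U M V₁ :=
    (placeC f U M V₀).prodMap (placeC f U M V₁)
  have hA : ∀ e, A e ∈ (homog f U M V₀ 0).prod (homog f U M V₁ 0) := fun e =>
    ⟨placeC_mem_homog _ _ _ _ _, placeC_mem_homog _ _ _ _ _⟩
  have hAi : Function.Injective A := fun a b h => Prod.ext
    (placeC_injective _ _ _ _ (congrArg Prod.fst h)) (placeC_injective _ _ _ _ (congrArg Prod.snd h))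
  have hAs : ∀ e ∈ (homog f U M V₀ 0).prod (homog f U M V₁ 0), ∃ a, A a = e := by
    rintro ⟨a, b⟩ ⟨ha, hb⟩
    obtain ⟨a', ha'⟩ := exists_placeC_eq f U M ha
    obtain ⟨b', hb'⟩ := exists_placeC_eq f U M hb
    exact ⟨(a', b'), Prod.ext ha' hb'⟩
  have hAβ : ∀ e, ((totRes f U M (inf_le_left : V₀ ⊓ V₁ ≤ V₀)).coprod
      (-(totRes f U M inf_le_right))) (A e) = placeC f U M _ (twoD f M V₀ V₁ e) := by
    rintro ⟨a, b⟩
    simp only [A, twoD, LinearMap.prodMap_apply, LinearMap.coprod_apply, LinearMap.neg_apply,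
      map_add, map_neg, totRes_placeC]
  let dE := (totD f U M V₀).prodMap (totD f U M V₁)
  let α := (totRes f U M (le_top : V₀ ≤ ⊤)).prod (totRes f U M (le_top : V₁ ≤ ⊤))
  let Y : Submodule ℂ (LinearMap.ker (twoD f M V₀ V₁) × LinearMap.ker (cechD f U M 0)) :=
    LinearMap.ker ((dE ∘ₗ A ∘ₗ Submodule.subtype _ ∘ₗ LinearMap.fst _ _ _) -
      (α ∘ₗ extC f U M 0 ∘ₗ Submodule.subtype _ ∘ₗ LinearMap.snd _ _ _))
  have hY : ∀ e z, (e, z) ∈ Y ↔ dE (A e.1) = α (extC f U M 0 z.1) := fun e z => by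
    simp only [Y, LinearMap.mem_ker, LinearMap.sub_apply, sub_eq_zero]
    rfl
  have := finrank_quotient_eq_of_rel Y ⊥ ((coboundaries f U M 0).comap
    (LinearMap.ker (cechD f U M 0)).subtype) ?_ ?_ ?_
  · rw [← this]
    exact (Submodule.quotEquivOfEqBot ⊥ rfl).finrank_eq
  · rintro ⟨e, he⟩
    obtain ⟨c, hc, h⟩ := H.exists_zero' (hA e) (by
      rw [hAβ, LinearMap.mem_ker.mp he, map_zero])
    obtain ⟨z, rfl⟩ := exists_extC_eq f U M hc
    exact ⟨⟨z, (cechD_eq_zero_iff f z).mpr (H.closed_of h)⟩, (hY _ _).mpr h⟩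
  · rintro ⟨z, hz⟩
    obtain ⟨e, he, h0, h⟩ := H.exists_zero (extC_mem_homog f U M z)
      ((cechD_eq_zero_iff f z).mp hz)
    obtain ⟨e, rfl⟩ := hAs e he
    refine ⟨⟨e, ?_⟩, (hY _ _).mpr h⟩
    rw [hAβ] at h0
    exact placeC_injective f U M _ (h0.trans (map_zero _).symm)
  · rintro ⟨e, he⟩ ⟨z, hz⟩ h
    rw [hY] at h
    simp only [Submodule.mem_bot, Submodule.mem_comap, coboundaries, Submodule.mk_eq_zero]
    change e = 0 ↔ z = 0
    constructor
    · rintro rfl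
      apply extC_injective f U M 0
      rw [map_zero]
      exact H.inj (by rw [← h, map_zero, map_zero])
    · rintro rfl
      apply hAi
      rw [map_zero]
      exact H.zeroE (hA e) (by rw [h, map_zero, map_zero])

/-- The relation `Y` consists of the pairs of ends of the zigzags of `exists_one`, and `one_iff`
says that it matches the coboundaries. -/
lemma finrank_cechH_one :
    Module.finrank ℂ (CechH f U M 1) =
      Module.finrank ℂ (Sec f M (V₀ ⊓ V₁) ⧸ LinearMap.range (twoD f M V₀ V₁)) := by
  have H := isTwoStepResolution f hU hM hV₀ hV₁ hs
  let dE := (totD f U M V₀).prodMap (totD f U M V₁)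
  let α := (totRes f U M (le_top : V₀ ≤ ⊤)).prod (totRes f U M (le_top : V₁ ≤ ⊤))
  let β := (totRes f U M (inf_le_left : V₀ ⊓ V₁ ≤ V₀)).coprod (-(totRes f U M inf_le_right))
  have hAβ : ∀ a b, β (placeC f U M V₀ a, placeC f U M V₁ b) =
      placeC f U M _ (twoD f M V₀ V₁ (a, b)) := by
    intro a b
    simp only [β, twoD, LinearMap.coprod_apply, LinearMap.neg_apply,
      map_add, map_neg, totRes_placeC]
  let Y : Submodule ℂ (Sec f M (V₀ ⊓ V₁) × LinearMap.ker (cechD f U M 1)) :=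
    { carrier := {y | ∃ e ∈ (homog f U M V₀ 1).prod (homog f U M V₁ 1),
        β e = totD f U M _ (placeC f U M _ y.1) ∧ dE e = α (extC f U M 1 y.2.1)}
      add_mem' := by
        rintro y y' ⟨e, he, h1, h2⟩ ⟨e', he', h1', h2'⟩
        refine ⟨e + e', add_mem he he', ?_, ?_⟩
        · rw [map_add, h1, h1', Prod.fst_add, map_add, map_add]
        · rw [map_add, h2, h2', Prod.snd_add, Submodule.coe_add, map_add, map_add]
      zero_mem' := ⟨0, zero_mem _, by simp, by simp⟩
      smul_mem' := by
        rintro r y ⟨e, he, h1, h2⟩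
        refine ⟨r • e, Submodule.smul_mem _ _ he, ?_, ?_⟩
        · rw [map_smul, h1, Prod.smul_fst, map_smul, map_smul]
        · rw [map_smul, h2, Prod.smul_snd, Submodule.coe_smul, map_smul, map_smul] }
  symm
  apply finrank_quotient_eq_of_rel Y
  · intro n
    obtain ⟨c, hc, e, he, h1, h2⟩ := H.exists_one' (placeC_mem_homog f U M _ n)
    obtain ⟨z, rfl⟩ := exists_extC_eq f U M hc
    exact ⟨⟨z, (cechD_eq_zero_iff f z).mpr (H.closed_of h2)⟩, e, he, h1, h2⟩
  · rintro ⟨z, hz⟩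
    obtain ⟨n, hn, e, he, h1, h2⟩ := H.exists_one (extC_mem_homog f U M z)
      ((cechD_eq_zero_iff f z).mp hz)
    obtain ⟨n, rfl⟩ := exists_placeC_eq f U M hn
    exact ⟨n, e, he, h1, h2⟩
  · rintro n ⟨z, hz⟩ ⟨e, he, h1, h2⟩
    have key := H.one_iff (placeC_mem_homog f U M _ n) he h1 h2
    constructor
    · rintro ⟨⟨a, b⟩, rfl⟩
      obtain ⟨b, hb, h⟩ := key.mp ⟨_, ⟨placeC_mem_homog f U M _ a, placeC_mem_homog f U M _ b⟩,
        hAβ a b⟩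
      obtain ⟨w, rfl⟩ := exists_extC_eq f U M hb
      rw [totD_extC] at h
      exact ⟨w, extC_injective f U M _ h⟩
    · rintro ⟨w, hw⟩
      obtain ⟨⟨a, b⟩, ⟨ha, hb⟩, h⟩ := key.mpr ⟨_, extC_mem_homog f U M w, by
        rw [totD_extC]; exact congrArg _ hw⟩
      obtain ⟨a, rfl⟩ := exists_placeC_eq f U M ha
      obtain ⟨b, rfl⟩ := exists_placeC_eq f U M hb
      exact ⟨(a, b), placeC_injective f U M _ ((hAβ a b).symm.trans h)⟩

lemma finrank_cechH_add_two (p : ℕ) : Module.finrank ℂ (CechH f U M (p + 2)) = 0 := by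
  have H := isTwoStepResolution f hU hM hV₀ hV₁ hs
  have : Subsingleton (CechH f U M (p + 2)) := by
    rw [Submodule.Quotient.subsingleton_iff, eq_top_iff]
    rintro ⟨z, hz⟩ -
    obtain ⟨b, hb, h⟩ := H.exists_of_three_le (extC_mem_homog f U M z)
      ((cechD_eq_zero_iff f z).mp hz)
    obtain ⟨w, rfl⟩ := exists_extC_eq f U M hb
    rw [totD_extC] at h
    exact ⟨w, extC_injective f U M _ h⟩
  exact Module.finrank_zero_of_subsingleton

/-- The Euler characteristic of a sheaf supported in the union of two affine open sets. -/
theorem eulerChar_eq_index : eulerChar f U M = (twoD f M V₀ V₁).index := by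
  have hz : ∀ p, m ≤ p → Module.finrank ℂ (CechH f U M p) = 0 := by
    intro p hp
    have : IsEmpty (Fin (p + 1) ↪o Fin m) := ⟨fun σ => by
      have := Fintype.card_le_of_injective σ σ.injective
      simp at this
      omega⟩
    have : Subsingleton (Cochain f U M p) := inferInstance
    have : Subsingleton (CechH f U M p) := inferInstance
    exact Module.finrank_zero_of_subsingleton
  -- The sum is padded by two zero terms, so that degrees 0 and 1 can be split off even when `m <
  -- 2`.
  have h1 : eulerChar f U M = ∑ p ∈ Finset.range (m + 2),
      (-1) ^ p * (Module.finrank ℂ (CechH f U M p) : ℤ) := by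
    rw [eulerChar]
    refine Finset.sum_subset (Finset.range_mono (Nat.le_add_right m 2)) fun p _ hp => ?_
    rw [hz p (by simpa using hp)]; simp
  rw [h1, Finset.sum_range_succ', Finset.sum_range_succ', Finset.sum_eq_zero]
  · rw [finrank_cechH_zero f hU hM hV₀ hV₁ hs, zero_add, finrank_cechH_one f hU hM hV₀ hV₁ hs,
      LinearMap.index]
    simp
    ring
  · intro p _
    rw [finrank_cechH_add_two f hU hM hV₀ hV₁ hs]; simp
end

end euler

/-! ### Tensor products with invertible sheaves -/

section tensor

variable (M N : X.Modules)

/-- The presheaf tensor product. -/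
abbrev preTensor : PresheafOfModules X.ringCatSheaf.obj :=
  PresheafOfModules.Monoidal.tensorObj (R := X.sheaf.obj) M.val N.val

/-- The canonical map from the presheaf tensor product to the tensor product. -/
def toTensor (W : X.Opens) : TensorProduct Γ(X, W) Γ(M, W) Γ(N, W) →+ Γ(tensor M N, W) :=
  ((toSheafify (Opens.grothendieckTopology X) (preTensor M N).presheaf).app (.op W)).hom

/-- Restriction in the presheaf tensor product. -/
def resTensor {V W : X.Opens} (h : W ≤ V) :
    TensorProduct Γ(X, V) Γ(M, V) Γ(N, V) →+ TensorProduct Γ(X, W) Γ(M, W) Γ(N, W) :=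
  ((preTensor M N).presheaf.map (homOfLE h).op).hom

lemma resTensor_tmul {V W : X.Opens} (h : W ≤ V) (a : Γ(M, V)) (b : Γ(N, V)) :
    resTensor M N h (a ⊗ₜ b) = (res M h a) ⊗ₜ (res N h b) := rfl

lemma toTensor_resTensor {V W : X.Opens} (h : W ≤ V) (p) :
    toTensor M N W (resTensor M N h p) = res (tensor M N) h (toTensor M N V p) :=
  ConcreteCategory.congr_hom
    ((toSheafify (Opens.grothendieckTopology X) (preTensor M N).presheaf).naturality
      (homOfLE h).op) p

lemma toTensor_smul (W : X.Opens) (a : Γ(X, W)) (p : TensorProduct Γ(X, W) Γ(M, W) Γ(N, W)) :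
    toTensor M N W (a • p) = a • toTensor M N W p :=
  (((PresheafOfModules.sheafificationAdjunction (𝟙 X.ringCatSheaf.obj)).unit.app
    (preTensor M N)).app (.op W)).hom.map_smul a p

lemma exists_resTensor_eq_zero {W : X.Opens} {p : TensorProduct Γ(X, W) Γ(M, W) Γ(N, W)}
    (hp : toTensor M N W p = 0) {x : X} (hx : x ∈ W) :
    ∃ (V : X.Opens) (h : V ≤ W), x ∈ V ∧ resTensor M N h p = 0 := by
  have hq : (toSheafify (Opens.grothendieckTopology X) (preTensor M N).presheaf).app (.op W) p =
    (toSheafify (Opens.grothendieckTopology X) (preTensor M N).presheaf).app (.op W) 0 :=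
    hp.trans (map_zero (toTensor M N W)).symm
  obtain ⟨V, h, hV, hxV⟩ := Presheaf.equalizerSieve_mem (Opens.grothendieckTopology X)
    (toSheafify (Opens.grothendieckTopology X) (preTensor M N).presheaf) p 0 hq x hx
  exact ⟨V, leOfHom h, hxV, hV.trans (map_zero (resTensor M N (leOfHom h)))⟩

lemma exists_toTensor_eq {W : X.Opens} (t : Γ(tensor M N, W)) {x : X} (hx : x ∈ W) :
    ∃ (V : X.Opens) (h : V ≤ W) (p : _), x ∈ V ∧ toTensor M N V p = res (tensor M N) h t := by
  obtain ⟨V, h, ⟨p, hp⟩, hxV⟩ := Presheaf.imageSieve_mem (Opens.grothendieckTopology X)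
    (toSheafify (Opens.grothendieckTopology X) (preTensor M N).presheaf) t x hx
  exact ⟨V, leOfHom h, p, hxV, hp⟩

variable {M N}

/-- The section `m ⊗ n`. -/
def tmul {W : X.Opens} (m : Γ(M, W)) (n : Γ(N, W)) : Γ(tensor M N, W) :=
  toTensor M N W (m ⊗ₜ n)

lemma res_tmul {V W : X.Opens} (h : W ≤ V) (m : Γ(M, V)) (n : Γ(N, V)) :
    res (tensor M N) h (tmul m n) = tmul (res M h m) (res N h n) := by
  rw [tmul, ← toTensor_resTensor, resTensor_tmul]; rfl

lemma add_tmul {W : X.Opens} (m m' : Γ(M, W)) (n : Γ(N, W)) :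
    tmul (m + m') n = tmul m n + tmul m' n := by
  rw [tmul, TensorProduct.add_tmul, map_add]; rfl

lemma sub_tmul {W : X.Opens} (m m' : Γ(M, W)) (n : Γ(N, W)) :
    tmul (m - m') n = tmul m n - tmul m' n := by
  rw [tmul, TensorProduct.sub_tmul, map_sub]; rfl

@[simp] lemma zero_tmul {W : X.Opens} (n : Γ(N, W)) : tmul (0 : Γ(M, W)) n = 0 := by
  rw [tmul, TensorProduct.zero_tmul, map_zero]

lemma smul_tmul {W : X.Opens} (a : Γ(X, W)) (m : Γ(M, W)) (n : Γ(N, W)) :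
    tmul (a • m) n = a • tmul m n := by
  rw [tmul, ← TensorProduct.smul_tmul', toTensor_smul]; rfl

lemma tmul_smul {W : X.Opens} (a : Γ(X, W)) (m : Γ(M, W)) (n : Γ(N, W)) :
    tmul m (a • n) = a • tmul m n := by
  rw [tmul, TensorProduct.tmul_smul, toTensor_smul]; rfl

lemma IsGenerator.res {V W : X.Opens} {e : Γ(N, V)} (he : IsGenerator N e) (h : W ≤ V) :
    IsGenerator N (res N h e) := by
  intro Y hY
  have := he Y (hY.trans h)
  simpa only [res_res] using this

lemma IsGenerator.bijective_tmul_pre {V : X.Opens} {e : Γ(N, V)} (he : IsGenerator N e) :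
    Function.Bijective (fun m : Γ(M, V) => (m ⊗ₜ[Γ(X, V)] e : TensorProduct _ _ Γ(N, V))) := by
  have h1 := he V le_rfl
  simp only [res_self] at h1
  let E : Γ(X, V) ≃ₗ[Γ(X, V)] Γ(N, V) :=
    LinearEquiv.ofBijective (LinearMap.toSpanSingleton Γ(X, V) Γ(N, V) e) h1
  let T : Γ(M, V) ≃ₗ[Γ(X, V)] TensorProduct Γ(X, V) Γ(M, V) Γ(N, V) :=
    (TensorProduct.rid _ _).symm ≪≫ₗ TensorProduct.congr (LinearEquiv.refl _ _) E
  have hT : ∀ m, T m = m ⊗ₜ e := by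
    intro m
    simp only [T, LinearEquiv.trans_apply, TensorProduct.rid_symm_apply,
      TensorProduct.congr_tmul, LinearEquiv.refl_apply]
    congr 1
    exact one_smul _ _
  rw [show (fun m : Γ(M, V) => (m ⊗ₜ[Γ(X, V)] e : TensorProduct _ _ Γ(N, V))) = T from
    funext fun m => (hT m).symm]
  exact T.bijective

/-- A section of the presheaf tensor product that dies in the sheaf dies already in the presheaf
locally. There `e` is still a basis, so the coefficient is zero. -/
lemma IsGenerator.injective_tmul {V : X.Opens} {e : Γ(N, V)} (he : IsGenerator N e) :
    Function.Injective (fun m : Γ(M, V) => tmul m e) := by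
  intro a b hab
  have h0 : toTensor M N V ((a - b) ⊗ₜ e) = 0 := by
    change tmul (a - b) e = 0
    rw [sub_tmul, sub_eq_zero]
    exact hab
  rw [← sub_eq_zero]
  apply section_ext M
  intro x hx
  obtain ⟨W, h, hxW, h1⟩ := exists_resTensor_eq_zero M N h0 hx
  refine ⟨W, h, hxW, ?_⟩
  rw [resTensor_tmul] at h1
  rw [res_zero]
  exact (he.res h).bijective_tmul_pre.1 (h1.trans (TensorProduct.zero_tmul _ _).symm)

/-- Tensoring with a generator of an invertible sheaf is bijective on sections. -/
lemma IsGenerator.bijective_tmul {V : X.Opens} {e : Γ(N, V)} (he : IsGenerator N e) :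
    Function.Bijective (fun m : Γ(M, V) => tmul m e) := by
  refine ⟨he.injective_tmul, fun t => ?_⟩
  -- Local preimages come from sheafification; being unique by `injective_tmul`, they glue.
  have H : ∀ x : V, ∃ (W : X.Opens) (h : W ≤ V) (m : Γ(M, W)), x.1 ∈ W ∧
      tmul m (LimitPairs.res N h e) = LimitPairs.res _ h t := by
    rintro ⟨x, hx⟩
    obtain ⟨W, h, p, hxW, hp⟩ := exists_toTensor_eq M N t hx
    obtain ⟨m, rfl⟩ := (he.res h).bijective_tmul_pre.2 p
    exact ⟨W, h, m, hxW, hp⟩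
  choose W h m hx hm using H
  obtain ⟨y, hy⟩ := exists_glue M W h (fun x hx' => Opens.mem_iSup.mpr ⟨⟨x, hx'⟩, hx _⟩) m (by
    intro i j
    apply (he.res (inf_le_left.trans (h i))).injective_tmul
    change tmul _ _ = tmul _ _
    have h1 := congrArg (LimitPairs.res _ (inf_le_left : W i ⊓ W j ≤ W i)) (hm i)
    have h2 := congrArg (LimitPairs.res _ (inf_le_right : W i ⊓ W j ≤ W j)) (hm j)
    rw [res_tmul, res_res, res_res] at h1 h2
    exact h1.trans h2.symm)
  refine ⟨y, section_ext_cover _ W h (fun x hx' => Opens.mem_iSup.mpr ⟨⟨x, hx'⟩, hx _⟩) fun i => ?_⟩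
  change LimitPairs.res _ _ (tmul y e) = _
  rw [res_tmul, hy, hm]

lemma tensor_vanishesOn {W : X.Opens} (h : ∀ V ≤ W, ∀ t : Γ(M, V), t = 0) :
    ∀ V ≤ W, ∀ t : Γ(tensor M N, V), t = 0 := by
  intro V hV t
  apply section_ext
  intro x hx
  obtain ⟨Y, hY, p, hxY, hp⟩ := exists_toTensor_eq M N t hx
  refine ⟨Y, hY, hxY, ?_⟩
  have : ∀ p : TensorProduct Γ(X, Y) Γ(M, Y) Γ(N, Y), p = 0 := fun p => by
    induction p with
    | zero => rfl
    | tmul a b => rw [h Y (hY.trans hV) a, TensorProduct.zero_tmul]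
    | add a b ha hb => rw [ha, hb, add_zero]
  rw [← hp, this p, map_zero, res_zero]

end tensor

section power

/-- Powers of a section of an invertible sheaf. -/
def genPow {L : X.Modules} {V : X.Opens} (e : Γ(L, V)) : (k : ℕ) → Γ(tensorPow L k, V)
  | 0 => (1 : Γ(X, V))
  | k + 1 => tmul (genPow e k) e

variable {L : X.Modules}

lemma res_genPow {V W : X.Opens} (h : W ≤ V) (e : Γ(L, V)) (k : ℕ) :
    res (tensorPow L k) h (genPow e k) = genPow (res L h e) k := by
  induction k with
  | zero => exact rres_one h
  | succ k ih =>
    refine (res_tmul h (genPow e k) e).trans ?_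
    rw [ih]; rfl

lemma genPow_smul {V : X.Opens} (a : Γ(X, V)) (e : Γ(L, V)) (k : ℕ) :
    genPow (a • e) k = a ^ k • genPow e k := by
  induction k with
  | zero => rw [pow_zero, one_smul]; rfl
  | succ k ih =>
    change tmul (genPow (a • e) k) (a • e) = a ^ (k + 1) • tmul (genPow e k) e
    rw [ih, smul_tmul, tmul_smul, ← mul_smul, pow_succ]

lemma IsGenerator.genPow {V : X.Opens} {e : Γ(L, V)} (he : IsGenerator L e) (k : ℕ) :
    IsGenerator (tensorPow L k) (genPow e k) := by
  induction k with
  | zero =>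
    intro W h
    have : ∀ a : Γ(X, W), a • LimitPairs.res (tensorPow L 0) h (LimitPairs.genPow e 0) = a :=
      fun a => by
        rw [res_genPow]
        exact mul_one a
    simp only [this]
    exact Function.bijective_id
  | succ k ih =>
    intro W h
    have : (fun a : Γ(X, W) => a • LimitPairs.res (tensorPow L (k + 1)) h (LimitPairs.genPow e (k + 1))) =
        (fun m => tmul m (LimitPairs.res L h e)) ∘
          (fun a : Γ(X, W) => a • LimitPairs.res (tensorPow L k) h (LimitPairs.genPow e k)) := by
      funext a
      simp only [Function.comp]
      rw [smul_tmul, res_genPow, res_genPow]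
      rfl
    rw [this]
    exact (he.res h).bijective_tmul.comp (ih W h)

end power

/-! ### Twists in terms of local trivialisations -/

section twist

variable {F N L : X.Modules}

lemma isLocalizingAt_tensor {V : X.Opens} (g : Γ(X, V)) (hF : IsLocalizingAt F g) {e : Γ(N, V)}
    (he : IsGenerator N e) : IsLocalizingAt (tensor F N) g := by
  constructor
  · intro x
    obtain ⟨y, rfl⟩ := (he.res (X.basicOpen_le g)).bijective_tmul.2 x
    obtain ⟨n, z, hz⟩ := hF.exists_lift y
    refine ⟨n, tmul z e, ?_⟩
    change _ = _ • tmul _ _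
    rw [res_tmul, hz, smul_tmul]
  · intro y hy
    obtain ⟨z, rfl⟩ := he.bijective_tmul.2 y
    change res _ _ (tmul z e) = 0 at hy
    rw [res_tmul] at hy
    obtain ⟨n, hn⟩ := hF.exists_pow z
      ((he.res (X.basicOpen_le g)).injective_tmul (hy.trans (zero_tmul _).symm))
    refine ⟨n, ?_⟩
    change _ • tmul _ _ = _
    rw [← smul_tmul, hn, zero_tmul]

lemma IsInvertible.exists_affine (hN : IsInvertible N) (x : X) : ∃ V : X.Opens, IsAffineOpen V ∧
    x ∈ V ∧ ∃ e : Γ(N, V), IsGenerator N e := by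
  obtain ⟨W, hx, e, he⟩ := hN x
  obtain ⟨_, ⟨V, hV, rfl⟩, hxV, hVW⟩ :=
    X.isBasis_affineOpens.exists_subset_of_mem_open (show x ∈ (W : Set X) from hx) W.isOpen
  exact ⟨V, hV, hxV, _, he.res hVW⟩

lemma isLocalizing_tensor (hF : IsLocalizing F) (hN : IsInvertible N) :
    IsLocalizing (tensor F N) := by
  choose V hV hx e he using hN.exists_affine
  exact isLocalizing_of_isQuasicoherent _ (isQuasicoherent_of_isLocalizingAt _ V hV
    (by rw [eq_top_iff]; exact fun x _ => Opens.mem_iSup.mpr ⟨x, hx x⟩)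
    fun x g => isLocalizingAt_tensor g (hF _ (hV x) g) (he x))

lemma IsInvertible.tensorPow (hL : IsInvertible L) (k : ℕ) : IsInvertible (tensorPow L k) := by
  intro x
  obtain ⟨V, hx, e, he⟩ := hL x
  exact ⟨V, hx, _, he.genPow k⟩

lemma supportedIn_tensor {V : X.Opens} (hF : SupportedIn F V) : SupportedIn (tensor F N) V := by
  intro x hx
  obtain ⟨W, hxW, hW⟩ := hF x hx
  exact ⟨W, hxW, tensor_vanishesOn hW⟩

variable (f : X ⟶ Spec (CommRingCat.of ℂ))

/-- Tensoring with a generator, as a linear equivalence. -/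
def tmulEquiv (F : X.Modules) {V : X.Opens} {e : Γ(N, V)} (he : IsGenerator N e) :
    Sec f F V ≃ₗ[ℂ] Sec f (tensor F N) V :=
  LinearEquiv.ofBijective
    (show Sec f F V →ₗ[ℂ] Sec f (tensor F N) V from
      { toFun := fun m => (tmul (show Γ(F, V) from m) e : Γ(tensor F N, V))
        map_add' := fun a b => add_tmul (show Γ(F, V) from a) (show Γ(F, V) from b) e
        map_smul' := fun r a => smul_tmul (scalars f V r) (show Γ(F, V) from a) e }) he.bijective_tmul

/-- The differential of a two-set cover, with the gluing twisted by a function. -/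
def chartD (F : X.Modules) {V₀ V₁ : X.Opens} (u : Γ(X, V₀ ⊓ V₁)) :
    Sec f F V₀ × Sec f F V₁ →ₗ[ℂ] Sec f F (V₀ ⊓ V₁) :=
  (resLin f F inf_le_left).coprod (-(mulLin f F u ∘ₗ resLin f F inf_le_right))

/-- The Euler characteristic of `F(k)` in terms of trivialisations of `L`. -/
theorem eulerChar_twist [X.IsSeparated] {m : ℕ} {U : Fin m → X.Opens} (hU : IsAffineCover U)
    (hF : IsLocalizing F) (hL : IsInvertible L) {V₀ V₁ : X.Opens}
    (hV₀ : IsAffineOpen V₀) (hV₁ : IsAffineOpen V₁) (hs : SupportedIn F (V₀ ⊔ V₁))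
    {e₀ : Γ(L, V₀)} (he₀ : IsGenerator L e₀) {e₁ : Γ(L, V₁)} (he₁ : IsGenerator L e₁)
    (u : Γ(X, V₀ ⊓ V₁)) (hu : res L inf_le_right e₁ = u • res L inf_le_left e₀) (k : ℕ) :
    eulerChar f U (twist L F k) = (chartD f F (u ^ k)).index := by
  change eulerChar f U (tensor F (tensorPow L k)) = _
  rw [eulerChar_eq_index f hU (isLocalizing_tensor hF (hL.tensorPow k)) hV₀ hV₁
    (supportedIn_tensor hs)]
  symm
  -- Trivialise by `e₀ᵏ` on `V₀` and on the intersection, and by `e₁ᵏ` on `V₁`. Since `e₁ᵏ = uᵏ e₀ᵏ`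
  -- on the intersection, the restriction from `V₁` acquires the factor `uᵏ`.
  refine index_congr ((tmulEquiv f F (he₀.genPow k)).prodCongr (tmulEquiv f F (he₁.genPow k)))
    (tmulEquiv f F ((he₀.res inf_le_left).genPow k)) ?_
  rintro ⟨a, b⟩
  have h1 : tmulEquiv f F ((he₀.res (inf_le_left : V₀ ⊓ V₁ ≤ V₀)).genPow k)
      (resLin f F inf_le_left a) =
      resLin f (twist L F k) inf_le_left (tmulEquiv f F (he₀.genPow k) a) := by
    change tmul (res F inf_le_left a) (genPow (res L inf_le_left e₀) k) =
      res (tensor F (tensorPow L k)) inf_le_left (tmul _ (genPow e₀ k))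
    rw [res_tmul, res_genPow]
  have h2 : tmulEquiv f F ((he₀.res (inf_le_left : V₀ ⊓ V₁ ≤ V₀)).genPow k)
      (mulLin f F (u ^ k) (resLin f F inf_le_right b)) =
      resLin f (twist L F k) inf_le_right (tmulEquiv f F (he₁.genPow k) b) := by
    change tmul (u ^ k • res F inf_le_right b) (genPow (res L inf_le_left e₀) k) =
      res (tensor F (tensorPow L k)) inf_le_right (tmul _ (genPow e₁ k))
    rw [res_tmul, res_genPow, hu, genPow_smul, smul_tmul, tmul_smul]
  change (tmulEquiv f F _) (chartD f F (u ^ k) (a, b)) = twoD f (twist L F k) V₀ V₁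
    (tmulEquiv f F (he₀.genPow k) a, tmulEquiv f F (he₁.genPow k) b)
  rw [chartD, twoD, LinearMap.coprod_apply, LinearMap.coprod_apply, map_add, LinearMap.neg_apply,
    LinearMap.neg_apply, map_neg, LinearMap.comp_apply, h1, h2]
  rfl

end twist

/-! ### Loci where sections generate -/

section generator

variable {M : X.Modules}

lemma IsGenerator.smul_unit {V : X.Opens} {e : Γ(M, V)} (he : IsGenerator M e) {a : Γ(X, V)}
    (ha : IsUnit a) : IsGenerator M (a • e) := by
  intro W h
  have hu : IsUnit (rres h a) := ha.map _
  have : (fun b : Γ(X, W) => b • LimitPairs.res M h (a • e)) =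
      (fun b : Γ(X, W) => b • LimitPairs.res M h e) ∘ (fun b => b * rres h a) := by
    funext b
    simp only [Function.comp, res_smul, mul_smul]
  rw [this]
  exact (he W h).comp (Units.mulRight_bijective hu.unit)

lemma IsGenerator.exists_eq_smul {V W : X.Opens} (h : W ≤ V) {e : Γ(M, V)}
    (he : IsGenerator M e) (s : Γ(M, W)) : ∃ a : Γ(X, W), s = a • LimitPairs.res M h e := by
  obtain ⟨a, ha⟩ := (he W h).2 s
  exact ⟨a, ha.symm⟩

lemma IsGenerator.smul_inj {V W : X.Opens} (h : W ≤ V) {e : Γ(M, V)}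
    (he : IsGenerator M e) {a b : Γ(X, W)} (hab : a • LimitPairs.res M h e =
      b • LimitPairs.res M h e) : a = b := (he W h).1 hab

lemma IsGenerator.of_cover {V : X.Opens} {e : Γ(M, V)}
    (H : ∀ x ∈ V, ∃ (W : X.Opens) (h : W ≤ V), x ∈ W ∧ IsGenerator M (LimitPairs.res M h e)) :
    IsGenerator M e := by
  intro Y hY
  constructor
  · intro a b hab
    apply section_ext (structureSheaf X) (a := a) (b := b)
    intro x hx
    obtain ⟨W, h, hxW, hW⟩ := H x (hY hx)
    refine ⟨Y ⊓ W, inf_le_left, ⟨hx, hxW⟩, ?_⟩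
    have h1 := congrArg (LimitPairs.res M (inf_le_left : Y ⊓ W ≤ Y)) hab
    simp only [res_smul, res_res] at h1
    rw [← res_res M h inf_le_right] at h1
    exact hW.smul_inj _ h1
  · intro t
    choose! W hW hxW hgen using H
    have hW' : ∀ x : Y, Y ⊓ W x.1 ≤ Y := fun x => inf_le_left
    have hex : ∀ x : Y, ∃ a : Γ(X, Y ⊓ W x.1), LimitPairs.res M (hW' x) t =
        a • LimitPairs.res M ((hW' x).trans hY) e := fun x => by
      obtain ⟨a, ha⟩ := (hgen x.1 (hY x.2)).exists_eq_smul
        (inf_le_right : Y ⊓ W x.1 ≤ W x.1) (LimitPairs.res M (hW' x) t)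
      rw [res_res] at ha
      exact ⟨a, ha⟩
    choose a ha using hex
    have hc : Y ≤ ⨆ x : Y, Y ⊓ W x.1 := fun x hx =>
      Opens.mem_iSup.mpr ⟨⟨x, hx⟩, hx, hxW x (hY hx)⟩
    obtain ⟨b, hb⟩ := exists_glue (structureSheaf X) (fun x : Y => Y ⊓ W x.1) hW' hc a (by
      intro i j
      have h1 := congrArg (LimitPairs.res M (inf_le_left : (Y ⊓ W i.1) ⊓ (Y ⊓ W j.1) ≤ _)) (ha i)
      have h2 := congrArg (LimitPairs.res M (inf_le_right : (Y ⊓ W i.1) ⊓ (Y ⊓ W j.1) ≤ _)) (ha j)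
      rw [res_smul, res_res, res_res] at h1 h2
      have h3 := h1.symm.trans h2
      rw [← res_res M (hW i.1 (hY i.2)) (inf_le_left.trans inf_le_right)] at h3
      exact (hgen i.1 (hY i.2)).smul_inj _ h3)
    refine ⟨b, section_ext_cover M (fun x : Y => Y ⊓ W x.1) hW' hc fun x => ?_⟩
    change LimitPairs.res M (hW' x) ((show Γ(X, Y) from b) • LimitPairs.res M hY e) = _
    rw [res_smul, res_res, ha]
    congr 1
    exact hb x

/-- The open set on which a section generates. -/
def genLocus {V : X.Opens} (s : Γ(M, V)) : X.Opens :=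
  sSup {U : X.Opens | ∃ h : U ≤ V, IsGenerator M (res M h s)}

lemma genLocus_le {V : X.Opens} (s : Γ(M, V)) : genLocus s ≤ V :=
  sSup_le fun _ ⟨h, _⟩ => h

lemma nonvanishing_eq_genLocus (s : Γ(M, ⊤)) : nonvanishing M s = genLocus s := by
  rw [nonvanishing, genLocus]
  congr 1
  ext U
  exact ⟨fun h => ⟨le_top, h⟩, fun ⟨_, h⟩ => h⟩

lemma mem_genLocus {V : X.Opens} {s : Γ(M, V)} {x : X} : x ∈ genLocus s ↔
    ∃ (W : X.Opens) (h : W ≤ V), x ∈ W ∧ IsGenerator M (res M h s) := by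
  rw [genLocus, Opens.mem_sSup]
  constructor
  · rintro ⟨W, ⟨h, hW⟩, hx⟩
    exact ⟨W, h, hx, hW⟩
  · rintro ⟨W, h, hx, hW⟩
    exact ⟨W, ⟨h, hW⟩, hx⟩

lemma isGenerator_genLocus {V : X.Opens} (s : Γ(M, V)) :
    IsGenerator M (res M (genLocus_le s) s) := by
  apply IsGenerator.of_cover
  intro x hx
  obtain ⟨W, h, hxW, hW⟩ := mem_genLocus.mp hx
  refine ⟨W, fun y hy => mem_genLocus.mpr ⟨W, h, hy, hW⟩, hxW, ?_⟩
  rwa [res_res]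

lemma isGenerator_res_iff {V W : X.Opens} (h : W ≤ V) (s : Γ(M, V)) :
    IsGenerator M (res M h s) ↔ W ≤ genLocus s := by
  constructor
  · exact fun hW x hx => mem_genLocus.mpr ⟨W, h, hx, hW⟩
  · intro hW
    have := (isGenerator_genLocus s).res hW
    rwa [res_res] at this

/-- Where `s = a e` generates, `e` is a multiple `b s`, so `a b = 1` and `a` is invertible;
conversely a unit multiple of a generator is a generator. -/
lemma genLocus_inf {V W : X.Opens} (h : W ≤ V) (s : Γ(M, V)) {e : Γ(M, W)}
    (he : IsGenerator M e) {a : Γ(X, W)} (ha : res M h s = a • e) :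
    genLocus s ⊓ W = X.basicOpen a := by
  apply le_antisymm
  · rintro x ⟨hx, hxW⟩
    obtain ⟨Y, hY, hxY, hgen⟩ := mem_genLocus.mp hx
    obtain ⟨b, hb⟩ := hgen.exists_eq_smul (inf_le_left : Y ⊓ W ≤ Y) (res M inf_le_right e)
    have h1 := congrArg (res M (inf_le_right : Y ⊓ W ≤ W)) ha
    rw [res_res, res_smul, hb, res_res, ← mul_smul] at h1
    have h2 : (1 : Γ(X, Y ⊓ W)) = rres inf_le_right a * b := by
      apply hgen.smul_inj inf_le_left
      rw [res_res, one_smul]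
      exact h1
    have h3 : IsUnit (rres (inf_le_right : Y ⊓ W ≤ W) a) := IsUnit.of_mul_eq_one b h2.symm
    have h4 : X.basicOpen (rres (inf_le_right : Y ⊓ W ≤ W) a) = Y ⊓ W :=
      X.basicOpen_of_isUnit h3
    have h5 : X.basicOpen (rres (inf_le_right : Y ⊓ W ≤ W) a) = (Y ⊓ W) ⊓ X.basicOpen a :=
      Scheme.basicOpen_res X a _
    have h6 : x ∈ (Y ⊓ W) ⊓ X.basicOpen a := by
      rw [← h5, h4]
      exact ⟨hxY, hxW⟩
    exact h6.2
  · refine le_inf ?_ (X.basicOpen_le a)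
    rw [← isGenerator_res_iff ((X.basicOpen_le a).trans h), ← res_res M h (X.basicOpen_le a), ha,
      res_smul]
    exact (he.res _).smul_unit (isUnit_rres_basicOpen a)

end generator

/-! ### Sections of the powers of an invertible sheaf, in coordinates -/

lemma fun_ext {U : X.Opens} {a b : Γ(X, U)}
    (H : ∀ x ∈ U, ∃ (V : X.Opens) (h : V ≤ U), x ∈ V ∧ rres h a = rres h b) : a = b :=
  section_ext (structureSheaf X) (a := a) (b := b) H

lemma exists_glue_fun {ι : Type} {U : X.Opens} (V : ι → X.Opens)
    (hV : ∀ i, V i ≤ U) (hc : U ≤ ⨆ i, V i) (s : ∀ i, Γ(X, V i))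
    (H : ∀ i j, rres (inf_le_left : V i ⊓ V j ≤ V i) (s i) =
      rres (inf_le_right : V i ⊓ V j ≤ V j) (s j)) :
    ∃ t : Γ(X, U), ∀ i, rres (hV i) t = s i :=
  exists_glue (structureSheaf X) V hV hc s H

lemma isUnit_rres_of_le_basicOpen {U V : X.Opens} (h : V ≤ U) {a : Γ(X, U)}
    (ha : V ≤ X.basicOpen a) : IsUnit (rres h a) := by
  rw [← rres_rres (X.basicOpen_le a) ha]
  exact (isUnit_rres_basicOpen a).map _

lemma IsGenerator.exists_eq_smul_self {M : X.Modules} {V : X.Opens} {e : Γ(M, V)}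
    (he : IsGenerator M e) (s : Γ(M, V)) : ∃ a : Γ(X, V), s = a • e := by
  obtain ⟨a, ha⟩ := he.exists_eq_smul le_rfl s
  exact ⟨a, by rwa [res_self] at ha⟩

lemma IsGenerator.smul_inj_self {M : X.Modules} {V : X.Opens} {e : Γ(M, V)}
    (he : IsGenerator M e) {a b : Γ(X, V)} (hab : a • e = b • e) : a = b :=
  he.smul_inj le_rfl (by rwa [res_self])

/-- A section of `Lⁿ` over `V`, given by its coordinates with respect to the powers `eⁿ` of the
local generators `e` of `L`. -/
structure PowSec (L : X.Modules) (n : ℕ) (V : X.Opens) where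
  /-- The coordinate with respect to `eⁿ`. -/
  coord : ∀ {W : X.Opens} (_ : W ≤ V) {e : Γ(L, W)} (_ : IsGenerator L e), Γ(X, W)
  rres_coord : ∀ {W W' : X.Opens} (h : W ≤ V) (h' : W' ≤ W) {e : Γ(L, W)} (he : IsGenerator L e),
    rres h' (coord h he) = coord (h'.trans h) (he.res h')
  coord_smul : ∀ {W : X.Opens} (h : W ≤ V) {e e' : Γ(L, W)} (he : IsGenerator L e)
    (he' : IsGenerator L e') (u : Γ(X, W)), e' = u • e → coord h he = u ^ n * coord h he'

namespace PowSec

variable {L : X.Modules} {n m : ℕ} {V : X.Opens}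

/-- Restriction. -/
def restrict (s : PowSec L n V) {V' : X.Opens} (hV : V' ≤ V) : PowSec L n V' where
  coord h _ he := s.coord (h.trans hV) he
  rres_coord h h' _ he := s.rres_coord (h.trans hV) h' he
  coord_smul h _ _ he he' u hu := s.coord_smul (h.trans hV) he he' u hu

/-- The product of sections of powers. -/
def mul (s : PowSec L n V) (t : PowSec L m V) : PowSec L (n + m) V where
  coord h _ he := s.coord h he * t.coord h he
  rres_coord h h' _ he := by rw [rres_mul, s.rres_coord, t.rres_coord]
  coord_smul h _ _ he he' u hu := by
    rw [s.coord_smul h he he' u hu, t.coord_smul h he he' u hu]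
    ring

/-- The power of a section. -/
def pow (s : PowSec L n V) (k : ℕ) : PowSec L (n * k) V where
  coord h _ he := s.coord h he ^ k
  rres_coord h h' _ he := by rw [rres_pow, s.rres_coord]
  coord_smul h _ _ he he' u hu := by
    rw [s.coord_smul h he he' u hu]
    ring

/-- Linear combinations of sections. -/
def sum {ι : Type*} (S : Finset ι) (c : ι → Γ(X, V)) (s : ι → PowSec L n V) : PowSec L n V where
  coord h _ he := ∑ i ∈ S, rres h (c i) * (s i).coord h he
  rres_coord h h' _ he := by
    refine (map_sum (X.presheaf.map (homOfLE h').op).hom _ _).trans (Finset.sum_congr rfl ?_)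
    intro i _
    refine (rres_mul h' _ _).trans ?_
    rw [rres_rres, (s i).rres_coord]
  coord_smul h _ _ he he' u hu := by
    rw [Finset.mul_sum]
    refine Finset.sum_congr rfl fun i _ => ?_
    rw [(s i).coord_smul h he he' u hu]
    ring

/-- A function as a section of `L⁰`. -/
def ofFun (L : X.Modules) (g : Γ(X, V)) : PowSec L 0 V where
  coord h _ _ := rres h g
  rres_coord h h' _ _ := rres_rres h h' g
  coord_smul _ _ _ _ _ u _ := by rw [pow_zero, one_mul]

/-- The coordinates of a section of the tensor power. -/
def ofSection (s : Γ(tensorPow L n, V)) : PowSec L n V where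
  coord h _ he := ((he.genPow n).exists_eq_smul_self (res (tensorPow L n) h s)).choose
  rres_coord h h' e he := by
    have h1 := ((he.genPow n).exists_eq_smul_self (res (tensorPow L n) h s)).choose_spec
    have h2 := (((he.res h').genPow n).exists_eq_smul_self
      (res (tensorPow L n) (h'.trans h) s)).choose_spec
    apply ((he.res h').genPow n).smul_inj_self
    refine Eq.trans ?_ h2
    rw [← res_genPow, ← res_smul, ← res_res _ h h']
    exact (congrArg (res (tensorPow L n) h') h1).symm
  coord_smul h e e' he he' u hu := by
    have h1 := ((he.genPow n).exists_eq_smul_self (res (tensorPow L n) h s)).choose_spec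
    have h2 := ((he'.genPow n).exists_eq_smul_self (res (tensorPow L n) h s)).choose_spec
    apply (he.genPow n).smul_inj_self
    refine h1.symm.trans (h2.trans ?_)
    conv_lhs => enter [2]; rw [hu]
    rw [genPow_smul, ← mul_smul, mul_comm]

lemma coord_ofSection (s : Γ(tensorPow L n, V)) {W : X.Opens} (h : W ≤ V) {e : Γ(L, W)}
    (he : IsGenerator L e) :
    res (tensorPow L n) h s = (ofSection s).coord h he • genPow e n :=
  ((he.genPow n).exists_eq_smul_self (res (tensorPow L n) h s)).choose_spec

/-- The open set where a section does not vanish. -/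
def locus (s : PowSec L n V) : X.Opens :=
  sSup {D | ∃ (W : X.Opens) (h : W ≤ V) (e : Γ(L, W)) (he : IsGenerator L e),
    D = X.basicOpen (s.coord h he)}

lemma locus_le (s : PowSec L n V) : s.locus ≤ V :=
  sSup_le fun _ ⟨_, h, _, _, hD⟩ => hD.le.trans ((X.basicOpen_le _).trans h)

lemma mem_locus {s : PowSec L n V} {x : X} : x ∈ s.locus ↔
    ∃ (W : X.Opens) (h : W ≤ V) (e : Γ(L, W)) (he : IsGenerator L e),
      x ∈ X.basicOpen (s.coord h he) := by
  rw [locus, Opens.mem_sSup]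
  constructor
  · rintro ⟨_, ⟨W, h, e, he, rfl⟩, hx⟩
    exact ⟨W, h, e, he, hx⟩
  · rintro ⟨W, h, e, he, hx⟩
    exact ⟨_, ⟨W, h, e, he, rfl⟩, hx⟩

/-- If one coordinate is invertible at `x`, the change of generator writes it as a multiple of any
other coordinate, which is then invertible too. So one generator is enough to test membership. -/
lemma mem_locus_iff (s : PowSec L n V) {W : X.Opens} (h : W ≤ V) {e : Γ(L, W)}
    (he : IsGenerator L e) {x : X} (hx : x ∈ W) :
    x ∈ s.locus ↔ x ∈ X.basicOpen (s.coord h he) := by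
  constructor
  · intro hs
    obtain ⟨W', h', e', he', hx'⟩ := mem_locus.mp hs
    have hxW' := X.basicOpen_le _ hx'
    obtain ⟨v, hv⟩ := he'.exists_eq_smul (inf_le_right : W ⊓ W' ≤ W') (res L inf_le_left e)
    have h1 := s.coord_smul (inf_le_left.trans h) (he'.res (inf_le_right : W ⊓ W' ≤ W'))
      (he.res (inf_le_left : W ⊓ W' ≤ W)) v hv
    rw [← s.rres_coord h inf_le_left he, ← s.rres_coord h' inf_le_right he'] at h1
    have h2 : x ∈ X.basicOpen (rres (inf_le_right : W ⊓ W' ≤ W') (s.coord h' he')) := by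
      rw [rres, Scheme.basicOpen_res]
      exact ⟨⟨hx, hxW'⟩, hx'⟩
    rw [h1, Scheme.basicOpen_mul] at h2
    have h3 := h2.2
    rw [rres, Scheme.basicOpen_res] at h3
    exact h3.2
  · exact fun hs => mem_locus.mpr ⟨W, h, e, he, hs⟩

lemma locus_inf (s : PowSec L n V) {W : X.Opens} (h : W ≤ V) {e : Γ(L, W)}
    (he : IsGenerator L e) : s.locus ⊓ W = X.basicOpen (s.coord h he) := by
  ext x
  constructor
  · rintro ⟨h1, h2⟩
    exact (s.mem_locus_iff h he h2).mp h1
  · intro hx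
    have hxW := X.basicOpen_le _ hx
    exact ⟨(s.mem_locus_iff h he hxW).mpr hx, hxW⟩

lemma isUnit_coord (s : PowSec L n V) {W : X.Opens} (h : W ≤ V) (hs : W ≤ s.locus) {e : Γ(L, W)}
    (he : IsGenerator L e) : IsUnit (s.coord h he) := by
  have h1 : X.basicOpen (s.coord h he) = W := by
    rw [← s.locus_inf h he, inf_eq_right]
    exact hs
  rw [← rres_self le_rfl (s.coord h he)]
  exact isUnit_rres_of_le_basicOpen _ h1.ge

lemma exists_generator_le (hL : IsInvertible L) {x : X} (hx : x ∈ V) :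
    ∃ (W : X.Opens) (_ : W ≤ V) (e : Γ(L, W)) (_ : IsGenerator L e), x ∈ W := by
  obtain ⟨W, hxW, e, he⟩ := hL x
  exact ⟨V ⊓ W, inf_le_left, _, he.res inf_le_right, hx, hxW⟩

lemma locus_restrict (hL : IsInvertible L) (s : PowSec L n V) {V' : X.Opens} (hV : V' ≤ V) :
    (s.restrict hV).locus = s.locus ⊓ V' := by
  ext x
  constructor
  · intro hx
    refine ⟨?_, locus_le _ hx⟩
    obtain ⟨W, h, e, he, hx⟩ := mem_locus.mp hx
    exact mem_locus.mpr ⟨W, h.trans hV, e, he, hx⟩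
  · rintro ⟨h1, h2⟩
    obtain ⟨W, h, e, he, hx⟩ := exists_generator_le hL h2
    rw [SetLike.mem_coe, mem_locus_iff _ h he hx]
    exact (s.mem_locus_iff (h.trans hV) he hx).mp h1

lemma locus_mul (hL : IsInvertible L) (s : PowSec L n V) (t : PowSec L m V) :
    (s.mul t).locus = s.locus ⊓ t.locus := by
  ext x
  by_cases hx : x ∈ V
  · obtain ⟨W, h, e, he, hxW⟩ := exists_generator_le hL hx
    change _ ↔ x ∈ s.locus ∧ x ∈ t.locus
    rw [SetLike.mem_coe, mem_locus_iff _ h he hxW, mem_locus_iff _ h he hxW,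
      mem_locus_iff _ h he hxW]
    change x ∈ X.basicOpen (_ * _) ↔ _
    rw [Scheme.basicOpen_mul]
    rfl
  · exact ⟨fun h => absurd (locus_le _ h) hx, fun h => absurd (locus_le _ h.1) hx⟩

lemma locus_pow (hL : IsInvertible L) (s : PowSec L n V) {k : ℕ} (hk : 1 ≤ k) :
    (s.pow k).locus = s.locus := by
  ext x
  by_cases hx : x ∈ V
  · obtain ⟨W, h, e, he, hxW⟩ := exists_generator_le hL hx
    rw [SetLike.mem_coe, SetLike.mem_coe, mem_locus_iff _ h he hxW, mem_locus_iff _ h he hxW]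
    change x ∈ X.basicOpen (_ ^ _) ↔ _
    rw [Scheme.basicOpen_pow X _ hk]
  · exact ⟨fun h => absurd (locus_le _ h) hx, fun h => absurd (locus_le _ h) hx⟩

lemma nonvanishing_eq_locus (hL : IsInvertible L) (s : Γ(tensorPow L n, ⊤)) :
    nonvanishing (tensorPow L n) s = (ofSection s).locus := by
  rw [nonvanishing_eq_genLocus]
  ext x
  obtain ⟨W, hx, e, he⟩ := hL x
  have h1 := genLocus_inf le_top s (he.genPow n) (coord_ofSection s le_top he)
  have h2 := (ofSection s).locus_inf le_top he
  rw [← h2] at h1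
  have h3 : x ∈ genLocus s ⊓ W ↔ x ∈ (ofSection s).locus ⊓ W := by rw [h1]
  exact ⟨fun h => (h3.mp ⟨h, hx⟩).1, fun h => (h3.mpr ⟨h, hx⟩).1⟩

/-- Glueing of sections given in coordinates. -/
lemma exists_of_cover {ι : Type} (U : ι → X.Opens) (hU : ∀ j, U j ≤ V) (hc : V ≤ ⨆ j, U j)
    (e : ∀ j, Γ(L, U j)) (he : ∀ j, IsGenerator L (e j)) (μ : ∀ j, Γ(X, U j))
    (H : ∀ i j (v : Γ(X, U i ⊓ U j)), res L inf_le_right (e j) = v • res L inf_le_left (e i) →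
      rres inf_le_left (μ i) = v ^ n * rres inf_le_right (μ j)) :
    ∃ s : PowSec L n V, ∀ j, s.coord (hU j) (he j) = μ j := by
  obtain ⟨t, ht⟩ := exists_glue (tensorPow L n) U hU hc (fun j => μ j • genPow (e j) n) (by
    intro i j
    obtain ⟨v, hv⟩ := (he i).exists_eq_smul (inf_le_left : U i ⊓ U j ≤ U i)
      (res L inf_le_right (e j))
    rw [res_smul, res_smul, res_genPow, res_genPow, hv, genPow_smul, H i j v hv, ← mul_smul,
      mul_comm])
  refine ⟨ofSection t, fun j => ((he j).genPow n).smul_inj le_rfl ?_⟩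
  rw [res_self, ← coord_ofSection, ht]

/-- The quotient of two sections of the same power. -/
lemma exists_ratio (hL : IsInvertible L) (s t : PowSec L n V) (ht : V ≤ t.locus) :
    ∃ r : Γ(X, V), ∀ {W : X.Opens} (h : W ≤ V) {e : Γ(L, W)} (he : IsGenerator L e),
      s.coord h he = rres h r * t.coord h he := by
  choose W hW e he hxW using fun x : V => exists_generator_le hL x.2
  have hu := fun x => t.isUnit_coord (hW x) ((hW x).trans ht) (he x)
  have key : ∀ x, ∃ a : Γ(X, W x), s.coord (hW x) (he x) = a * t.coord (hW x) (he x) := fun x =>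
    ⟨s.coord (hW x) (he x) * ↑(hu x).unit⁻¹, by rw [mul_assoc, (hu x).val_inv_mul, mul_one]⟩
  -- Changing the generator multiplies both coordinates by the same power of the transition
  -- function, so their quotient does not depend on it and the local quotients glue.
  have key2 : ∀ {Y : X.Opens} (h : Y ≤ V) {ε ε' : Γ(L, Y)} (hε : IsGenerator L ε)
      (hε' : IsGenerator L ε') (a a' : Γ(X, Y)), s.coord h hε = a * t.coord h hε →
      s.coord h hε' = a' * t.coord h hε' → a = a' := by
    intro Y h ε ε' hε hε' a a' h1 h2
    obtain ⟨v, hv⟩ := hε.exists_eq_smul le_rfl ε'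
    rw [res_self] at hv
    rw [s.coord_smul h hε hε' v hv, h2, mul_left_comm, ← t.coord_smul h hε hε' v hv] at h1
    exact ((t.isUnit_coord h (h.trans ht) hε).mul_right_cancel h1).symm
  choose a ha using key
  have hres : ∀ x {Y : X.Opens} (h : Y ≤ W x), s.coord (h.trans (hW x)) ((he x).res h) =
      rres h (a x) * t.coord (h.trans (hW x)) ((he x).res h) := fun x Y h => by
    rw [← s.rres_coord (hW x) h (he x), ha, rres_mul, t.rres_coord]
  have hc : V ≤ ⨆ x : V, W x := fun x hx => Opens.mem_iSup.mpr ⟨⟨x, hx⟩, hxW _⟩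
  obtain ⟨r, hr⟩ := exists_glue_fun W hW hc a
    (fun x y => key2 (inf_le_left.trans (hW x)) _ _ _ _ (hres x inf_le_left)
      (hres y inf_le_right))
  refine ⟨r, fun {Y} h {ε} hε => fun_ext fun x hx => ?_⟩
  refine ⟨Y ⊓ W ⟨x, h hx⟩, inf_le_left, ⟨hx, hxW _⟩, ?_⟩
  rw [rres_mul, s.rres_coord, t.rres_coord, rres_rres]
  obtain ⟨v, hv⟩ := ((he ⟨x, h hx⟩).res (inf_le_right : Y ⊓ W ⟨x, h hx⟩ ≤ _)).exists_eq_smul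
    le_rfl (res L inf_le_left ε)
  obtain ⟨v', hv'⟩ := (hε.res (inf_le_left : Y ⊓ W ⟨x, h hx⟩ ≤ _)).exists_eq_smul
    le_rfl (res L inf_le_right (e ⟨x, h hx⟩))
  rw [res_self] at hv'
  have h3 := hres ⟨x, h hx⟩ (inf_le_right : Y ⊓ W ⟨x, h hx⟩ ≤ _)
  have h4 : rres (inf_le_right : Y ⊓ W ⟨x, h hx⟩ ≤ _) (a ⟨x, h hx⟩) =
      rres (inf_le_left.trans h) r := by
    rw [← hr, rres_rres]
  rw [h4] at h3
  rw [s.coord_smul _ (hε.res inf_le_left) ((he ⟨x, h hx⟩).res inf_le_right) v' hv',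
    t.coord_smul _ (hε.res inf_le_left) ((he ⟨x, h hx⟩).res inf_le_right) v' hv', h3]
  ring

lemma basicOpen_ratio (hL : IsInvertible L) {s t : PowSec L n V} (ht : V ≤ t.locus) {r : Γ(X, V)}
    (hr : ∀ {W : X.Opens} (h : W ≤ V) {e : Γ(L, W)} (he : IsGenerator L e),
      s.coord h he = rres h r * t.coord h he) : X.basicOpen r = s.locus := by
  ext x
  by_cases hx : x ∈ V
  · obtain ⟨W, h, e, he, hxW⟩ := exists_generator_le hL hx
    have h1 := (t.mem_locus_iff h he hxW).mp (ht hx)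
    rw [SetLike.mem_coe, SetLike.mem_coe, mem_locus_iff s h he hxW, hr h he, Scheme.basicOpen_mul,
      rres, Scheme.basicOpen_res]
    exact ⟨fun h' => ⟨⟨hxW, h'⟩, h1⟩, fun h' => h'.1.2⟩
  · exact ⟨fun h => absurd (X.basicOpen_le _ h) hx, fun h => absurd (locus_le _ h) hx⟩

/-- A section of `L` without zeros gives a generator. -/
lemma exists_generator (hL : IsInvertible L) (s : PowSec L 1 V) (hs : V ≤ s.locus) :
    ∃ e : Γ(L, V), IsGenerator L e := by
  choose W hW e he hxW using fun x : V => exists_generator_le hL x.2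
  have hc : V ≤ ⨆ x : V, W x := fun x hx => Opens.mem_iSup.mpr ⟨⟨x, hx⟩, hxW _⟩
  obtain ⟨r, hr⟩ := exists_glue L W hW hc (fun x => s.coord (hW x) (he x) • e x) (by
    intro x y
    obtain ⟨v, hv⟩ := (he x).exists_eq_smul (inf_le_left : W x ⊓ W y ≤ W x)
      (res L inf_le_right (e y))
    have h1 := s.coord_smul (inf_le_left.trans (hW x)) ((he x).res inf_le_left)
      ((he y).res inf_le_right) v hv
    rw [res_smul, res_smul, s.rres_coord, s.rres_coord, h1, pow_one]
    refine Eq.trans ?_ (congrArg (_ • ·) hv.symm)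
    rw [← mul_smul, mul_comm])
  refine ⟨r, IsGenerator.of_cover fun x hx => ⟨W ⟨x, hx⟩, hW _, hxW _, ?_⟩⟩
  rw [hr]
  exact (he _).smul_unit (s.isUnit_coord _ ((hW _).trans hs) _)

end PowSec

/-! ### Generic sections and affine loci -/

/-- Finitely many nonzero linear forms, each over an extension field of its own, are
simultaneously nonzero at some point. -/
lemma exists_forall_sum_ne_zero {k ι : Type*} [Field k] [Infinite k] (T : Finset ι)
    (κ : T → Type*) [∀ t, Field (κ t)] (φ : ∀ t, k →+* κ t) (v : ∀ t, ι → κ t)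
    (hv : ∀ t : T, v t t ≠ 0) : ∃ c : ι → k, ∀ t, ∑ i ∈ T, φ t (c i) * v t i ≠ 0 := by
  classical
  -- The bad coefficients for `t` form a `k`-subspace, although the values lie in `κ t`; it is
  -- proper because the basis vector at `t` avoids it. Over an infinite field finitely many proper
  -- subspaces do not cover the space.
  let P : T → Submodule k (ι → k) := fun t =>
    { carrier := {c | ∑ i ∈ T, φ t (c i) * v t i = 0}
      zero_mem' := by simp
      add_mem' := fun {a b} ha hb => by
        simp only [Set.mem_ofPred_eq] at ha hb ⊢
        simp only [Pi.add_apply, map_add, add_mul, Finset.sum_add_distrib, ha, hb, add_zero]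
      smul_mem' := fun a b hb => by
        simp only [Set.mem_ofPred_eq] at hb ⊢
        simp only [Pi.smul_apply, smul_eq_mul, map_mul, mul_assoc, ← Finset.mul_sum, hb,
          mul_zero] }
  have hne : ∀ t, P t ≠ ⊤ := by
    intro t ht
    have h1 : (Pi.single t.1 1 : ι → k) ∈ P t := ht ▸ Submodule.mem_top
    have h2 : ∑ i ∈ T, φ t ((Pi.single t.1 1 : ι → k) i) * v t i = 0 := h1
    rw [Finset.sum_eq_single t.1 (fun i _ hi => by
      rw [Pi.single_eq_of_ne hi, map_zero, zero_mul]) (fun h => absurd t.2 h),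
      Pi.single_eq_same, map_one, one_mul] at h2
    exact hv t h2
  have hU := Subspace.biUnion_ne_univ_of_top_notMem (s := Finset.univ.image P) (by
    rw [Finset.mem_image]
    rintro ⟨t, _, ht⟩
    exact hne t ht)
  obtain ⟨c, hc⟩ := (Set.ne_univ_iff_exists_notMem _).mp hU
  refine ⟨c, fun t ht => hc ?_⟩
  exact Set.mem_biUnion (Finset.mem_coe.mpr (Finset.mem_image_of_mem P (Finset.mem_univ t))) ht

lemma exists_lift_fun [IsLocallyNoetherian X] {V : X.Opens} (hV : IsAffineOpen V) (g : Γ(X, V))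
    (x : Γ(X, X.basicOpen g)) : ∃ (n : ℕ) (y : Γ(X, V)),
      rres (X.basicOpen_le g) y = rres (X.basicOpen_le g) g ^ n * x :=
  ((isCoherent_structureSheaf X).isLocalizing V hV g).exists_lift x

lemma exists_pow_fun [IsLocallyNoetherian X] {V : X.Opens} (hV : IsAffineOpen V) (g y : Γ(X, V))
    (h : rres (X.basicOpen_le g) y = 0) : ∃ n : ℕ, g ^ n * y = 0 :=
  ((isCoherent_structureSheaf X).isLocalizing V hV g).exists_pow y h

namespace PowSec

variable {L : X.Modules} {n k : ℕ} {V : X.Opens}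

/-- On an affine open set, the locus where a section does not vanish is affine. -/
lemma isAffineOpen_locus (hL : IsInvertible L) (hV : IsAffineOpen V) (s : PowSec L n V) :
    IsAffineOpen s.locus := by
  -- Over a basic open subset of `V` where `L` is trivial, the locus is the basic open set of a
  -- coordinate, hence affine. Affineness is then glued along functions generating the unit ideal.
  have H : ∀ x : V, ∃ g : Γ(X, V), x.1 ∈ X.basicOpen g ∧
      IsAffineOpen (X.basicOpen (rres s.locus_le g)) := by
    rintro ⟨x, hx⟩
    obtain ⟨W, hxW, e, he⟩ := hL x
    obtain ⟨g, hg, hxg⟩ := basicOpen_mono_affine hV hx hxW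
    refine ⟨g, hxg, ?_⟩
    have h2 : X.basicOpen (rres s.locus_le g) = s.locus ⊓ X.basicOpen g :=
      Scheme.basicOpen_res X g _
    rw [h2, s.locus_inf (X.basicOpen_le g) (he.res hg)]
    exact (hV.basicOpen g).basicOpen _
  choose g hxg hg using H
  have htop : Ideal.span (Set.range g) = ⊤ := by
    rw [← hV.iSup_basicOpen_eq_self_iff]
    apply le_antisymm (iSup_le fun _ => X.basicOpen_le _)
    intro x hx
    exact Opens.mem_iSup.mpr ⟨⟨g ⟨x, hx⟩, _, rfl⟩, hxg ⟨x, hx⟩⟩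
  apply isAffineOpen_of_isAffineOpen_basicOpen _ (Set.range fun x => rres s.locus_le (g x))
  · have h1 := congrArg (Ideal.map (X.presheaf.map (homOfLE s.locus_le).op).hom) htop
    rw [Ideal.map_span, Ideal.map_top, ← Set.range_comp] at h1
    exact h1
  · rintro _ ⟨x, rfl⟩
    exact hg x

/-- The locus of a linear combination is affine when the loci of the terms are. -/
lemma isAffineOpen_locus_sum (hL : IsInvertible L) {ι : Type*} (S : Finset ι) (c : ι → Γ(X, V))
    (s : ι → PowSec L n V) (hs : ∀ i ∈ S, IsAffineOpen (s i).locus) :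
    IsAffineOpen (sum S c s).locus := by
  set σ := sum S c s with hσ
  have hle := σ.locus_le
  have hself : σ.locus ≤ (σ.restrict hle).locus := by
    rw [locus_restrict hL, inf_idem]
  choose r hr using fun i => exists_ratio hL ((s i).restrict hle) (σ.restrict hle) hself
  have hD : ∀ i, X.basicOpen (r i) = (s i).locus ⊓ σ.locus := fun i => by
    rw [basicOpen_ratio hL hself (hr i), locus_restrict hL]
  -- With `r i` the quotient of `s i` by the combination `σ`, the identity `∑ cᵢ rᵢ = 1` shows that
  -- the `rᵢ` generate the unit ideal on the locus of `σ`. The set `D(rᵢ)` is where both `s i` and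
  -- `σ` are nonzero, which is also the basic open set of the inverse quotient in the affine locus
  -- of `s i`.
  apply isAffineOpen_of_isAffineOpen_basicOpen _ (r '' S)
  · rw [Ideal.eq_top_iff_one]
    have h1 : (1 : Γ(X, σ.locus)) = ∑ i ∈ S, rres hle (c i) * r i := by
      refine fun_ext fun x hx => ?_
      obtain ⟨W, h, e, he, hxW⟩ := exists_generator_le hL hx
      refine ⟨W, h, hxW, ?_⟩
      apply ((σ.restrict hle).isUnit_coord h (h.trans hself) he).mul_right_cancel
      rw [rres_one, one_mul]
      change ∑ i ∈ S, rres _ (c i) * (s i).coord _ he = _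
      have h2 : rres h (∑ i ∈ S, rres hle (c i) * r i) =
          ∑ i ∈ S, rres h (rres hle (c i) * r i) :=
        map_sum (X.presheaf.map (homOfLE h).op).hom _ _
      rw [h2, Finset.sum_mul]
      refine Finset.sum_congr rfl fun i _ => ?_
      rw [rres_mul, mul_assoc, ← hr, rres_rres]
      rfl
    rw [h1]
    exact Ideal.sum_mem _ fun i hi =>
      Ideal.mul_mem_left _ _ (Ideal.subset_span ⟨i, hi, rfl⟩)
  · rintro _ ⟨i, hi, rfl⟩
    have hle' := (s i).locus_le
    have hself' : (s i).locus ≤ ((s i).restrict hle').locus := by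
      rw [locus_restrict hL, inf_idem]
    obtain ⟨r', hr'⟩ := exists_ratio hL (σ.restrict hle') ((s i).restrict hle') hself'
    have hD' := basicOpen_ratio hL hself' hr'
    rw [locus_restrict hL, inf_comm, ← hD i] at hD'
    rw [← hD']
    exact (hs i hi).basicOpen r'

/-- A generic linear combination vanishes at none of finitely many given points. -/
lemma exists_mem_locus_sum (hL : IsInvertible L) (f : X ⟶ Spec (CommRingCat.of ℂ))
    (T : Finset X) (s : X → PowSec L n V) (hs : ∀ t ∈ T, t ∈ (s t).locus) :
    ∃ c : X → ℂ, ∀ t ∈ T, t ∈ (sum T (fun i => scalars f V (c i)) s).locus := by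
  choose W hW e he hxW using fun t : T => exists_generator_le hL ((s t).locus_le (hs t.1 t.2))
  let ev : ∀ t : T, Γ(X, W t) →+* X.residueField t.1 := fun t =>
    (X.evaluation (W t) t.1 (hxW t)).hom
  obtain ⟨c, hc⟩ := exists_forall_sum_ne_zero T (fun t => X.residueField t.1)
    (fun t => (ev t).comp (scalars f (W t))) (fun t i => ev t ((s i).coord (hW t) (he t)))
    (fun t => (Scheme.evaluation_ne_zero_iff_mem_basicOpen X t.1 (hxW t) _).mpr
      (((s t).mem_locus_iff (hW t) (he t) (hxW t)).mp (hs t.1 t.2)))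
  refine ⟨c, fun t ht => ?_⟩
  rw [mem_locus_iff _ (hW ⟨t, ht⟩) (he ⟨t, ht⟩) (hxW ⟨t, ht⟩),
    ← Scheme.evaluation_ne_zero_iff_mem_basicOpen X t (hxW ⟨t, ht⟩)]
  intro h0
  apply hc ⟨t, ht⟩
  refine Eq.trans ?_ h0
  refine Eq.trans ?_ (map_sum (ev ⟨t, ht⟩) _ _).symm
  refine Finset.sum_congr rfl fun i _ => ?_
  refine Eq.trans ?_ (map_mul (ev ⟨t, ht⟩) _ _).symm
  congr 1
  exact congrArg (ev ⟨t, ht⟩) (map_scalars f (hW ⟨t, ht⟩) (c i)).symm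

/-- A section over the locus of `s` extends after multiplication by a power of `s`. -/
lemma exists_extension [X.IsSeparated] [IsLocallyNoetherian X] (hL : IsInvertible L)
    (hV : IsCompact (V : Set X)) (s : PowSec L n V) (e : PowSec L k s.locus) :
    ∃ K, ∃ τ : PowSec L (k + n * K) V, τ.locus ⊓ s.locus = e.locus := by
  have hcov : ∀ x : V, ∃ W : X.Opens, W ≤ V ∧ IsAffineOpen W ∧ x.1 ∈ W ∧
      ∃ ε : Γ(L, W), IsGenerator L ε := by
    rintro ⟨x, hx⟩
    obtain ⟨W, h, ε, hε, hxW⟩ := exists_generator_le hL hx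
    obtain ⟨_, ⟨Y, hY, rfl⟩, hxY, hYW⟩ :=
      X.isBasis_affineOpens.exists_subset_of_mem_open (show x ∈ (W : Set X) from hxW) W.isOpen
    exact ⟨Y, le_trans (show Y ≤ W from hYW) h, hY, hxY, _, hε.res hYW⟩
  choose W hWV hW hxW ε hε using hcov
  obtain ⟨T, hT⟩ := hV.elim_finite_subcover (fun x => (W x : Set X)) (fun x => (W x).isOpen)
    (fun x hx => Set.mem_iUnion.mpr ⟨⟨x, hx⟩, hxW _⟩)
  have hc : V ≤ ⨆ j : T, W j := by
    intro x hx
    obtain ⟨j, hj, hx⟩ := Set.mem_iUnion₂.mp (hT hx)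
    exact Opens.mem_iSup.mpr ⟨⟨j, hj⟩, hx⟩
  let a : ∀ j : T, Γ(X, W j) := fun j => s.coord (hWV j) (hε j)
  have hD : ∀ j, X.basicOpen (a j) ≤ s.locus := fun j => by
    rw [← s.locus_inf]
    exact inf_le_left
  let μ : ∀ j : T, Γ(X, X.basicOpen (a j)) := fun j =>
    e.coord (hD j) ((hε j).res (X.basicOpen_le _))
  -- On each of the finitely many `W j` the coordinate of `e` extends after multiplication by a
  -- power of the coordinate `a j` of `s`; one exponent `K` serves all.
  have hlift : ∃ K, ∀ j : T, ∃ y : Γ(X, W j),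
      rres (X.basicOpen_le _) y = rres (X.basicOpen_le _) (a j) ^ K * μ j := by
    choose K y hy using fun j : T => exists_lift_fun (hW j) (a j) (μ j)
    refine ⟨∑ j, K j, fun j => ⟨a j ^ (∑ j, K j - K j) * y j, ?_⟩⟩
    rw [rres_mul, rres_pow, hy j, ← mul_assoc, ← pow_add,
      Nat.sub_add_cancel (Finset.single_le_sum (fun _ _ => Nat.zero_le _) (Finset.mem_univ j))]
  obtain ⟨K, hK⟩ := hlift
  choose y hy using hK
  have hv : ∀ i j : T, ∃ v : Γ(X, W i.1 ⊓ W j.1), res L inf_le_right (ε j) =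
      v • res L inf_le_left (ε i) := fun i j =>
    (hε i).exists_eq_smul (inf_le_left : W i.1 ⊓ W j.1 ≤ W i) (res L inf_le_right (ε j))
  choose v hv using hv
  have hav : ∀ i j : T, rres inf_le_left (a i) = v i j ^ n * rres inf_le_right (a j) := by
    intro i j
    rw [s.rres_coord, s.rres_coord]
    exact s.coord_smul _ ((hε i).res inf_le_left) ((hε j).res inf_le_right) _ (hv i j)
  -- The extensions are compatible over the locus of `s`, so on the overlaps their differences are
  -- killed by a power of `s`; the exponent `p` serves all pairs.
  have hkill : ∃ p, ∀ i j : T, rres (inf_le_left : W i.1 ⊓ W j.1 ≤ _) (a i) ^ p *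
      (rres inf_le_left (y i) - v i j ^ (k + n * K) * rres inf_le_right (y j)) = 0 := by
    have h0 : ∀ i j : T, ∃ p, rres (inf_le_left : W i.1 ⊓ W j.1 ≤ _) (a i) ^ p *
        (rres inf_le_left (y i) - v i j ^ (k + n * K) * rres inf_le_right (y j)) = 0 := by
      intro i j
      refine exists_pow_fun (isAffineOpen_inf (hW i) (hW j)) (rres inf_le_left (a i)) _ ?_
      set D := X.basicOpen (rres (inf_le_left : W i.1 ⊓ W j.1 ≤ _) (a i)) with hDdef
      have hDi : D ≤ X.basicOpen (a i) := by
        rw [hDdef, rres, Scheme.basicOpen_res]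
        exact inf_le_right
      have hDle : D ≤ W i.1 ⊓ W j.1 := X.basicOpen_le _
      have hDj : D ≤ X.basicOpen (a j) := by
        have h1 : D = s.locus ⊓ (W i.1 ⊓ W j.1) := by
          rw [hDdef, s.rres_coord, ← s.locus_inf]
        rw [h1, ← s.locus_inf]
        exact inf_le_inf_left _ inf_le_right
      have h2 : rres hDle (rres inf_le_left (y i) -
          v i j ^ (k + n * K) * rres inf_le_right (y j)) =
          rres hDle (rres inf_le_left (y i)) -
            rres hDle (v i j ^ (k + n * K) * rres inf_le_right (y j)) :=
        map_sub (X.presheaf.map (homOfLE hDle).op).hom _ _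
      have hyi := congrArg (rres hDi) (hy i)
      have hyj := congrArg (rres hDj) (hy j)
      have hμ := e.coord_smul (hDi.trans (hD i)) ((hε i).res (hDle.trans inf_le_left))
        ((hε j).res (hDle.trans inf_le_right)) (rres hDle (v i j)) (by
          have := congrArg (res L hDle) (hv i j)
          rwa [res_smul, res_res, res_res] at this)
      have hμi : rres hDi (μ i) = e.coord (hDi.trans (hD i))
          ((hε i).res (hDle.trans inf_le_left)) := by
        refine (e.rres_coord _ hDi _).trans ?_
        congr 1
        exact res_res _ _ _ _
      have hμj : rres hDj (μ j) = e.coord (hDi.trans (hD i))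
          ((hε j).res (hDle.trans inf_le_right)) := by
        refine (e.rres_coord _ hDj _).trans ?_
        congr 1
        exact res_res _ _ _ _
      have ha := congrArg (rres hDle) (hav i j)
      rw [rres_mul, rres_pow, rres_rres, hμi] at hyi
      rw [rres_mul, rres_pow, rres_rres, hμj] at hyj
      simp only [rres_rres, rres_mul, rres_pow] at ha hyi hyj h2
      rw [h2, hyi, hyj, hμ, ha]
      ring
    choose p hp using h0
    refine ⟨∑ i, ∑ j, p i j, fun i j => ?_⟩
    have hle : p i j ≤ ∑ i, ∑ j, p i j :=
      (Finset.single_le_sum (f := fun j => p i j) (fun _ _ => Nat.zero_le _)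
        (Finset.mem_univ j)).trans
      (Finset.single_le_sum (f := fun i => ∑ j, p i j) (fun _ _ => Nat.zero_le _)
        (Finset.mem_univ i))
    rw [← Nat.sub_add_cancel hle, pow_add, mul_assoc, hp, mul_zero]
  obtain ⟨p, hp⟩ := hkill
  -- A further factor `s ^ p` makes the local extensions compatible, so the total exponent is `K +
  -- p`.
  obtain ⟨τ, hτ⟩ := exists_of_cover (n := k + n * (K + p)) (fun j : T => W j) (fun j => hWV j) hc
    (fun j => ε j) (fun j => hε j) (fun j => a j ^ p * y j) (by
      intro i j w hw
      have hwv : w = v i j := ((hε i).res inf_le_left).smul_inj_self (hw.symm.trans (hv i j))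
      subst hwv
      have h1 := hp i j
      rw [mul_sub, sub_eq_zero] at h1
      rw [rres_mul, rres_pow, h1, rres_mul, rres_pow, hav i j]
      ring)
  refine ⟨K + p, τ, ?_⟩
  ext x
  change (x ∈ τ.locus ∧ x ∈ s.locus) ↔ x ∈ e.locus
  suffices H : x ∈ s.locus → (x ∈ τ.locus ↔ x ∈ e.locus) from
    ⟨fun h => (H h.2).mp h.1, fun h => ⟨(H (e.locus_le h)).mpr h, e.locus_le h⟩⟩
  intro hx
  obtain ⟨j, hj⟩ := Opens.mem_iSup.mp (hc (s.locus_le hx))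
  have hxa : x ∈ X.basicOpen (a j) := (s.mem_locus_iff _ _ hj).mp hx
  rw [τ.mem_locus_iff (hWV j) (hε j) hj, hτ j,
    e.mem_locus_iff (hD j) ((hε j).res (X.basicOpen_le _)) hxa]
  have h1 : rres (X.basicOpen_le (a j)) (a j ^ p * y j) =
      rres (X.basicOpen_le _) (a j) ^ (p + K) * μ j := by
    rw [rres_mul, hy j, rres_pow, pow_add, mul_assoc]
  have h2 : X.basicOpen (rres (X.basicOpen_le (a j)) (a j ^ p * y j)) =
      X.basicOpen (a j) ⊓ X.basicOpen (a j ^ p * y j) := Scheme.basicOpen_res X _ _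
  rw [h1, Scheme.basicOpen_mul] at h2
  have hu : X.basicOpen (rres (X.basicOpen_le (a j)) (a j) ^ (p + K)) = X.basicOpen (a j) :=
    X.basicOpen_of_isUnit ((isUnit_rres_basicOpen (a j)).pow _)
  rw [hu] at h2
  have h3 : x ∈ X.basicOpen (a j) ⊓ X.basicOpen (μ j) ↔
    x ∈ X.basicOpen (a j) ⊓ X.basicOpen (a j ^ p * y j) := by rw [h2]
  exact ⟨fun h => (h3.mpr ⟨hxa, h⟩).2, fun h => (h3.mp ⟨hxa, h⟩).2⟩

end PowSec

/-- For an ample sheaf, every finite set of points lies in the affine locus of a section of a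
positive power, on which the sheaf is moreover trivial. -/
lemma IsAmple.exists_powSec [X.IsSeparated] [IsLocallyNoetherian X] [CompactSpace X]
    {L : X.Modules} (hL : IsAmple L) (f : X ⟶ Spec (CommRingCat.of ℂ)) (T : Finset X) :
    ∃ (n : ℕ) (_ : 1 ≤ n) (σ : PowSec L n ⊤), IsAffineOpen σ.locus ∧ (∀ t ∈ T, t ∈ σ.locus) ∧
      ∃ e : Γ(L, σ.locus), IsGenerator L e := by
  have hinv := hL.1
  -- The sections given by ampleness lie in different powers `n t`; they are raised to the common
  -- power `∏ n t`, which leaves their loci unchanged.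
  have h1 : ∃ (n : ℕ) (_ : 1 ≤ n) (s : X → PowSec L n ⊤), ∀ t ∈ T, t ∈ (s t).locus ∧
      IsAffineOpen (s t).locus := by
    choose n hn s hs using hL.2
    simp only [PowSec.nonvanishing_eq_locus hinv] at hs
    have hN : 1 ≤ ∏ t ∈ T, n t := Finset.one_le_prod' fun t _ => hn t
    refine ⟨∏ t ∈ T, n t, hN, ?_⟩
    have : ∀ t, ∃ σ : PowSec L (∏ t ∈ T, n t) ⊤, t ∈ T → t ∈ σ.locus ∧ IsAffineOpen σ.locus := by
      intro t
      by_cases ht : t ∈ T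
      · obtain ⟨d, hd⟩ := Finset.dvd_prod_of_mem n ht
        have hd1 : 1 ≤ d := Nat.one_le_iff_ne_zero.mpr fun h => by
          rw [h, mul_zero] at hd
          omega
        rw [hd]
        refine ⟨(PowSec.ofSection (s t)).pow d, fun _ => ?_⟩
        rw [PowSec.locus_pow hinv _ hd1]
        exact hs t
      · obtain ⟨σ⟩ : Nonempty (PowSec L (∏ t ∈ T, n t) ⊤) := ⟨PowSec.sum ∅ 0 fun i : Empty => i.elim⟩
        exact ⟨σ, fun h => absurd h ht⟩
    choose σ hσ using this
    exact ⟨σ, hσ⟩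
  obtain ⟨n, hn, s, hs⟩ := h1
  obtain ⟨c, hc⟩ := PowSec.exists_mem_locus_sum hinv f T s fun t ht => (hs t ht).1
  set σ := PowSec.sum T (fun i => scalars f ⊤ (c i)) s with hσ
  have hσa : IsAffineOpen σ.locus := PowSec.isAffineOpen_locus_sum hinv T _ s fun i hi => (hs i hi).2
  -- The locus of `σ` is affine and contains `T`, but `L` need not be trivial on it. For each `t` a
  -- section of `L` over this locus is sought that is nonzero at `t`; a generic combination is then
  -- nonzero on all of `T`.
  have h2 : ∀ t, ∃ e : PowSec L 1 σ.locus, t ∈ T → t ∈ e.locus := by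
    intro t
    by_cases ht : t ∈ T
    · obtain ⟨W, hW, e, he, hxW⟩ := PowSec.exists_generator_le hinv (hc t ht)
      obtain ⟨g, hg, hxg⟩ := basicOpen_mono_affine hσa (hc t ht) hxW
      have hloc : (PowSec.ofFun L g).locus ≤ W := by
        refine sSup_le ?_
        rintro _ ⟨Y, h, ε, hε, rfl⟩
        change X.basicOpen (rres h g) ≤ _
        rw [rres, Scheme.basicOpen_res]
        exact inf_le_right.trans hg
      have hxl : t ∈ (PowSec.ofFun L g).locus := by
        rw [PowSec.mem_locus_iff _ hW he hxW]
        change t ∈ X.basicOpen (rres hW g)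
        rw [rres, Scheme.basicOpen_res]
        exact ⟨hxW, hxg⟩
      obtain ⟨ε, hε⟩ := PowSec.exists_of_cover (n := 1) (V := W) (fun _ : Unit => W)
        (fun _ => le_rfl) (le_iSup (fun _ : Unit => W) ()) (fun _ => e) (fun _ => he) (fun _ => 1) (by
          intro i j v hv
          have : v = 1 := (he.res inf_le_left).smul_inj_self (hv.symm.trans (one_smul _ _).symm)
          rw [this, one_pow, one_mul])
      -- A function is a section of `L⁰`, so extending a local generator from `D(g)` does not change
      -- its degree: the result is again a section of `L¹`.
      obtain ⟨K, τ, hτ⟩ := PowSec.exists_extension hinv hσa.isCompact (PowSec.ofFun L g)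
        (ε.restrict hloc)
      have h10 : 1 + 0 * K = 1 := by simp
      revert τ
      rw [h10]
      intro τ hτ
      refine ⟨τ, fun _ => ?_⟩
      have h3 : t ∈ τ.locus ⊓ (PowSec.ofFun L g).locus := by
        rw [hτ, PowSec.locus_restrict hinv]
        refine ⟨?_, hxl⟩
        rw [SetLike.mem_coe, PowSec.mem_locus_iff _ le_rfl he hxW, hε (), X.basicOpen_one]
        exact hxW
      exact h3.1
    · exact ⟨PowSec.sum ∅ 0 fun i : Empty => i.elim, fun h => absurd h ht⟩
  choose e he using h2
  obtain ⟨d, hd⟩ := PowSec.exists_mem_locus_sum hinv f T e he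
  set ε := PowSec.sum T (fun i => scalars f σ.locus (d i)) e with hε
  -- The locus of `ε` has to be that of a section over all of `X`. The extension `τ` may be nonzero
  -- outside the locus of `σ`; the product `τ σ` removes this and accounts for the degree `1 + n K +
  -- n`.
  obtain ⟨K, τ, hτ⟩ := PowSec.exists_extension hinv
    (show IsCompact ((⊤ : X.Opens) : Set X) from isCompact_univ) σ ε
  have hloc : (τ.mul σ).locus = ε.locus := by rw [PowSec.locus_mul hinv, hτ]
  refine ⟨1 + n * K + n, by omega, τ.mul σ, ?_⟩
  rw [hloc]
  refine ⟨PowSec.isAffineOpen_locus hinv hσa ε, hd, ?_⟩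
  apply PowSec.exists_generator hinv (ε.restrict ε.locus_le)
  rw [PowSec.locus_restrict hinv, inf_idem]

/-! ### Valuation rings and integrality -/

/-- If `a` satisfies no monic equation over `B` modulo `J`, a valuation ring of a field over `A/J`
contains the image of `B` but not that of `a`. -/
lemma exists_valuationSubring_notMem {A B : Type} [CommRing A] [CommRing B] (g : B →+* A) (a : A)
    (J : Ideal A) (H : ∀ P : B[X], P.Monic → P.eval₂ g a ∉ J) :
    ∃ (K : Type) (_ : Field K) (φ : A →+* K) (R : ValuationSubring K),
      (∀ j ∈ J, φ j = 0) ∧ (∀ b, φ (g b) ∈ R) ∧ φ a ∉ R := by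
  -- The values at `a` of monic polynomials form a multiplicative set disjoint from `J`. A prime `p`
  -- containing `J` and avoiding it makes `a` non-integral over the image of `B` in the fraction
  -- field of `A / p`, and the integral closure is an intersection of valuation rings.
  let S : Submonoid A :=
    { carrier := {c | ∃ P : B[X], P.Monic ∧ P.eval₂ g a = c}
      one_mem' := ⟨1, Polynomial.monic_one, Polynomial.eval₂_one _ _⟩
      mul_mem' := by
        rintro _ _ ⟨P, hP, rfl⟩ ⟨Q, hQ, rfl⟩
        exact ⟨P * Q, hP.mul hQ, Polynomial.eval₂_mul _ _⟩ }
  obtain ⟨p, hp, hJp, hpS⟩ := Ideal.exists_le_prime_disjoint J S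
    (Set.disjoint_left.mpr fun j hj ⟨P, hP, hPj⟩ => H P hP (hPj ▸ hj))
  let φ : A →+* FractionRing (A ⧸ p) := (algebraMap (A ⧸ p) _).comp (Ideal.Quotient.mk p)
  have hφ : ∀ b, φ b = 0 ↔ b ∈ p := fun b => by
    rw [← Ideal.Quotient.eq_zero_iff_mem]
    exact (injective_iff_map_eq_zero' _).mp (IsFractionRing.injective (A ⧸ p) _) _
  have hint : ¬ IsIntegral (Subring.closure (Set.range (φ.comp g))) (φ a) := by
    rintro ⟨P, hP, hPa⟩
    have hr : Subring.closure (Set.range (φ.comp g)) = (φ.comp g).range := by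
      rw [← RingHom.coe_range, Subring.closure_eq]
    have hl : P.map (algebraMap _ (FractionRing (A ⧸ p))) ∈ Polynomial.lifts (φ.comp g) := by
      rw [Polynomial.lifts_iff_coeff_lifts]
      intro n
      rw [Polynomial.coeff_map]
      have : (P.coeff n : FractionRing (A ⧸ p)) ∈ (φ.comp g).range := hr.le (P.coeff n).2
      exact this
    obtain ⟨Q, hQ, -, hQm⟩ := Polynomial.lifts_and_natDegree_eq_and_monic hl (hP.map _)
    refine Set.disjoint_left.mp hpS ((hφ _).mp ?_) ⟨Q, hQm, rfl⟩
    rw [Polynomial.hom_eval₂, ← Polynomial.eval_map, hQ, Polynomial.eval_map]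
    exact hPa
  have hne : φ a ∉ ⨅ V : {V : ValuationSubring (FractionRing (A ⧸ p)) //
      Set.range (φ.comp g) ⊆ V.toSubring}, V.1.toSubring := by
    rw [iInf_valuationSubring_superset]
    exact hint
  rw [Subring.mem_iInf] at hne
  push Not at hne
  obtain ⟨⟨V, hV⟩, hVa⟩ := hne
  exact ⟨_, inferInstance, φ, V, fun j hj => (hφ j).mpr (hJp hj), fun b => hV ⟨b, rfl⟩, hVa⟩

/-- A finite module over a finite type algebra, all of whose elements satisfy monic equations over
`k[x]` modulo the annihilator, is finite over `k[x]`. -/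
lemma isFGUnder_of_isIntegral {k A M : Type} [Field k] [CommRing A] [AddCommGroup M] [Module k M]
    [Module A M] [Module.Finite A M] (σ : k →+* A) (hσ : σ.FiniteType)
    (hkA : ∀ (c : k) (m : M), c • m = σ c • m) (x : A) (T : M →ₗ[k] M) (hT : ∀ m, T m = x • m)
    (H : ∀ a, ∃ P : k[X][X], P.Monic ∧ ∀ m : M, P.eval₂ (Polynomial.eval₂RingHom σ x) a • m = 0) :
    IsFGUnder T := by
  let J := Module.annihilator A M
  -- Modulo the annihilator, `A` is integral and of finite type over `k[x]`, hence finite; the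
  -- products of module generators with algebra elements spanning `A / J` then generate `M` over
  -- `k[x]`.
  let g : k[X] →+* A := Polynomial.eval₂RingHom σ x
  let q := (Ideal.Quotient.mk J).comp g
  have hq : q.Finite := by
    apply RingHom.IsIntegral.to_finite
    · intro a
      obtain ⟨a, rfl⟩ := Ideal.Quotient.mk_surjective a
      obtain ⟨P, hP, hPa⟩ := H a
      refine ⟨P, hP, ?_⟩
      rw [← Polynomial.hom_eval₂]
      exact Ideal.Quotient.eq_zero_iff_mem.mpr (Module.mem_annihilator.mpr hPa)
    · apply RingHom.FiniteType.of_comp_finiteType (f := Polynomial.C)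
      have : q.comp Polynomial.C = (Ideal.Quotient.mk J).comp σ := by
        ext c
        simp [q, g]
      rw [this]
      exact (RingHom.FiniteType.of_surjective _ Ideal.Quotient.mk_surjective).comp hσ
  let _ := q.toAlgebra
  have hfin : Module.Finite k[X] (A ⧸ J) := hq
  obtain ⟨s, hs⟩ := hfin.fg_top
  obtain ⟨t, ht⟩ := Module.Finite.fg_top (R := A) (M := M)
  classical
  choose c hc using fun y : A ⧸ J => Ideal.Quotient.mk_surjective y
  refine ⟨Finset.image₂ (fun y m => c y • m) s t, fun S hS hx => ?_⟩
  have hg : ∀ (P : k[X]) (m : M), m ∈ S → g P • m ∈ S := by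
    intro P m hm
    induction P using Polynomial.induction_on' with
    | add P Q hP hQ => rw [map_add, add_smul]; exact S.add_mem hP hQ
    | monomial n b =>
      have : ∀ n, x ^ n • m ∈ S := fun n => by
        induction n with
        | zero => rwa [pow_zero, one_smul]
        | succ n ih =>
          rw [pow_succ', mul_smul, ← hT]
          exact hx _ ih
      have h1 : g (Polynomial.monomial n b) = σ b * x ^ n := by simp [g]
      rw [h1, mul_smul, ← hkA]
      exact S.smul_mem _ (this n)
  have key : ∀ m ∈ t, ∀ a : A, a • m ∈ S := by
    intro m hm a
    have h1 : ∀ y : A ⧸ J, ∀ a, Ideal.Quotient.mk J a = y → a • m ∈ S := by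
      intro y
      have hy : y ∈ Submodule.span k[X] (s : Set (A ⧸ J)) := hs ▸ Submodule.mem_top
      have hcongr : ∀ a b : A, Ideal.Quotient.mk J a = Ideal.Quotient.mk J b → a • m = b • m := by
        intro a b hab
        have := Module.mem_annihilator.mp (Ideal.Quotient.eq.mp hab) m
        rwa [sub_smul, sub_eq_zero] at this
      induction hy using Submodule.span_induction with
      | mem y hy =>
        intro a ha
        rw [hcongr a (c y) (ha.trans (hc y).symm)]
        exact hS (Finset.mem_coe.mpr (Finset.mem_image₂_of_mem hy hm))
      | zero =>
        intro a ha
        rw [hcongr a 0 (by rw [ha, map_zero]), zero_smul]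
        exact S.zero_mem
      | add y z _ _ hy hz =>
        intro a ha
        rw [hcongr a (c y + c z) (by rw [ha, map_add, hc, hc]), add_smul]
        exact S.add_mem (hy _ (hc y)) (hz _ (hc z))
      | smul P y _ hy =>
        intro a ha
        rw [hcongr a (g P * c y) (by
          rw [ha, map_mul, hc, Algebra.smul_def]
          rfl), mul_smul]
        exact hg _ _ (hy _ (hc y))
    exact h1 _ a rfl
  rw [eq_top_iff]
  rintro m -
  have hm : m ∈ Submodule.span A (t : Set M) := ht ▸ Submodule.mem_top
  suffices h : ∀ a : A, a • m ∈ S by simpa using h 1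
  induction hm using Submodule.span_induction with
  | mem m hm => exact key m hm
  | zero => intro a; rw [smul_zero]; exact S.zero_mem
  | add m m' _ _ h h' => intro a; rw [smul_add]; exact S.add_mem (h a) (h' a)
  | smul b m _ h => intro a; rw [← mul_smul]; exact h _

/-! ### Centres of valuations on proper schemes -/

lemma top_le_preimage {R : Type} [CommRing R] [IsLocalRing R] (i : Spec (CommRingCat.of R) ⟶ X)
    {W : X.Opens} (hW : i (IsLocalRing.closedPoint R) ∈ W) : ⊤ ≤ i ⁻¹ᵁ W :=
  ((IsLocalRing.closedPoint_mem_iff (R := R) (i ⁻¹ᵁ W)).mp hW).ge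

/-- Pulling back functions to the spectrum of a local ring. -/
def pullLocal {R : Type} [CommRing R] [IsLocalRing R] (i : Spec (CommRingCat.of R) ⟶ X)
    (W : X.Opens) (hW : i (IsLocalRing.closedPoint R) ∈ W) : Γ(X, W) →+* R :=
  (i.appLE W ⊤ (top_le_preimage i hW) ≫ (Scheme.ΓSpecIso (CommRingCat.of R)).hom).hom

lemma pullLocal_rres {R : Type} [CommRing R] [IsLocalRing R] (i : Spec (CommRingCat.of R) ⟶ X)
    {W W' : X.Opens} (h : W' ≤ W) (hW' : i (IsLocalRing.closedPoint R) ∈ W') (a : Γ(X, W)) :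
    pullLocal i W' hW' (rres h a) = pullLocal i W (h hW') a := by
  have := Scheme.Hom.map_appLE i (top_le_preimage i hW') (homOfLE h).op
  have h2 := ConcreteCategory.congr_hom this a
  exact congrArg (Scheme.ΓSpecIso (CommRingCat.of R)).hom h2

lemma mem_basicOpen_of_isUnit_pullLocal {R : Type} [CommRing R] [IsLocalRing R]
    (i : Spec (CommRingCat.of R) ⟶ X) {W : X.Opens} (hW : i (IsLocalRing.closedPoint R) ∈ W)
    (a : Γ(X, W)) (ha : IsUnit (pullLocal i W hW a)) :
    i (IsLocalRing.closedPoint R) ∈ X.basicOpen a := by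
  have h1 : IsUnit (i.appLE W ⊤ (top_le_preimage i hW) a) := by
    have h2 := ha.map (Scheme.ΓSpecIso (CommRingCat.of R)).inv.hom
    have h3 : (Scheme.ΓSpecIso (CommRingCat.of R)).inv.hom (pullLocal i W hW a) =
        i.appLE W ⊤ (top_le_preimage i hW) a :=
      ConcreteCategory.congr_hom (Scheme.ΓSpecIso (CommRingCat.of R)).hom_inv_id _
    rwa [h3] at h2
  have h2 := Scheme.basicOpen_appLE i ⊤ W (top_le_preimage i hW) a
  rw [Scheme.basicOpen_of_isUnit _ h1] at h2
  have h3 : IsLocalRing.closedPoint R ∈ (⊤ : (Spec (CommRingCat.of R)).Opens) := trivial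
  rw [h2] at h3
  exact h3.2

lemma pullLocal_comp {R S : Type} [CommRing R] [IsLocalRing R] [CommRing S] [IsLocalRing S]
    (φ : R →+* S) (i : Spec (CommRingCat.of R) ⟶ X) {W : X.Opens}
    (hW : i (IsLocalRing.closedPoint R) ∈ W)
    (hW' : (Spec.map (CommRingCat.ofHom φ) ≫ i) (IsLocalRing.closedPoint S) ∈ W) (a : Γ(X, W)) :
    pullLocal (Spec.map (CommRingCat.ofHom φ) ≫ i) W hW' a = φ (pullLocal i W hW a) := by
  have h1 := Scheme.Hom.appLE_comp_appLE (Spec.map (CommRingCat.ofHom φ)) i W ⊤ ⊤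
    (top_le_preimage i hW) le_rfl
  have h2 := ConcreteCategory.congr_hom h1 a
  have h3 := ConcreteCategory.congr_hom (Scheme.ΓSpecIso_naturality (CommRingCat.ofHom φ))
    (i.appLE W ⊤ (top_le_preimage i hW) a)
  refine Eq.trans ?_ h3
  refine congrArg (Scheme.ΓSpecIso (CommRingCat.of S)).hom (h2.symm.trans ?_)
  have h4 : (Spec.map (CommRingCat.ofHom φ)).appLE ⊤ ⊤ le_rfl =
    (Spec.map (CommRingCat.ofHom φ)).appTop := Scheme.Hom.appLE_eq_app _
  exact ConcreteCategory.congr_hom h4 _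

lemma pullLocal_fromSpec {K : Type} [CommRing K] [IsLocalRing K] {V : X.Opens} (hV : IsAffineOpen V)
    (φ : Γ(X, V) →+* K) (hW : (Spec.map (CommRingCat.ofHom φ) ≫ hV.fromSpec)
      (IsLocalRing.closedPoint K) ∈ V) (a : Γ(X, V)) :
    pullLocal (Spec.map (CommRingCat.ofHom φ) ≫ hV.fromSpec) V hW a = φ a := by
  have h0 : (⊤ : (Spec Γ(X, V)).Opens) ≤ hV.fromSpec ⁻¹ᵁ V := hV.fromSpec_preimage_self.ge
  have h1 := Scheme.Hom.appLE_comp_appLE (Spec.map (CommRingCat.ofHom φ)) hV.fromSpec V ⊤ ⊤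
    h0 le_rfl
  have h2 : hV.fromSpec.appLE V ⊤ h0 = (Scheme.ΓSpecIso Γ(X, V)).inv := by
    rw [Scheme.Hom.appLE, hV.fromSpec_app_self, Category.assoc, ← Functor.map_comp]
    convert Category.comp_id _
    exact (Spec Γ(X, V)).presheaf.map_id _
  have h4 : (Spec.map (CommRingCat.ofHom φ)).appLE ⊤ ⊤ le_rfl =
    (Spec.map (CommRingCat.ofHom φ)).appTop := Scheme.Hom.appLE_eq_app _
  have h5 : (Spec.map (CommRingCat.ofHom φ) ≫ hV.fromSpec).appLE V ⊤ (top_le_preimage _ hW) ≫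
      (Scheme.ΓSpecIso (CommRingCat.of K)).hom = CommRingCat.ofHom φ := by
    rw [← h1, h2, h4, ← Scheme.ΓSpecIso_inv_naturality, Category.assoc, Iso.inv_hom_id,
      Category.comp_id]
  exact ConcreteCategory.congr_hom h5 a

lemma fromSpec_mem {K : Type} [CommRing K] [IsLocalRing K] {V : X.Opens} (hV : IsAffineOpen V)
    (φ : Γ(X, V) →+* K) : (Spec.map (CommRingCat.ofHom φ) ≫ hV.fromSpec)
      (IsLocalRing.closedPoint K) ∈ V := by
  have h : hV.fromSpec (Spec.map (CommRingCat.ofHom φ) (IsLocalRing.closedPoint K)) ∈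
      Set.range hV.fromSpec := ⟨_, rfl⟩
  rw [hV.range_fromSpec] at h
  exact h

/-- The valuative criterion: a valuation ring of a field over an affine open subset of a proper
scheme has a centre. -/
lemma exists_center (f : X ⟶ Spec (CommRingCat.of ℂ)) [UniversallyClosed f] {V : X.Opens}
    (hV : IsAffineOpen V) {K : Type} [Field K] (φ : Γ(X, V) →+* K) (R : ValuationSubring K)
    (hR : ∀ c, φ (scalars f V c) ∈ R) :
    ∃ (ξ z : X) (χ : ∀ W : X.Opens, ξ ∈ W → Γ(X, W) →+* K) (hξ : ξ ∈ V),
      (∀ a, χ V hξ a = φ a) ∧ (∀ W : X.Opens, z ∈ W → ξ ∈ W) ∧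
      (∀ (W W' : X.Opens) (h : W' ≤ W) (hξ : ξ ∈ W') (a : Γ(X, W)),
        χ W' hξ (rres h a) = χ W (h hξ) a) ∧
      (∀ (W : X.Opens) (hξ : ξ ∈ W) (a : Γ(X, W)), ξ ∈ X.basicOpen a ↔ χ W hξ a ≠ 0) ∧
      (∀ (W : X.Opens) (_ : z ∈ W) (hξ : ξ ∈ W) (a : Γ(X, W)), χ W hξ a ∈ R ∧
        (χ W hξ a ≠ 0 → (χ W hξ a)⁻¹ ∈ R → z ∈ X.basicOpen a)) := by
  let i := Spec.map (CommRingCat.ofHom φ) ≫ hV.fromSpec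
  let ρ : ℂ →+* R := (φ.comp (scalars f V)).codRestrict R.toSubring hR
  have hsq : i ≫ f = Spec.map (CommRingCat.ofHom (algebraMap R K)) ≫
      Spec.map (CommRingCat.ofHom ρ) := by
    have h1 := IsAffineOpen.SpecMap_appLE_fromSpec f
      (isAffineOpen_top (Spec (CommRingCat.of ℂ))) hV (le_top : V ≤ f ⁻¹ᵁ ⊤)
    rw [IsAffineOpen.fromSpec_top, Scheme.isoSpec_Spec_inv] at h1
    rw [Category.assoc, ← h1, ← Spec.map_comp, ← Spec.map_comp, ← Spec.map_comp]
    congr 1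
  have hex : ValuativeCriterion.Existence f := by
    have := UniversallyClosed.eq_valuativeCriterion
    have h2 : (ValuativeCriterion.Existence ⊓ @QuasiCompact) f := by
      rw [← this]; infer_instance
    exact h2.1
  -- The lift `l` given by the valuative criterion sends the closed point of `Spec R` to the centre
  -- `z`, and the generic point to `ξ`, which specialises to `z`.
  obtain ⟨l, hl'⟩ : ∃ l : Spec (CommRingCat.of R) ⟶ X,
      Spec.map (CommRingCat.ofHom (algebraMap R K)) ≫ l = i := by
    obtain ⟨⟨l, hl, -⟩⟩ := (hex ⟨R, K, i, Spec.map (CommRingCat.ofHom ρ), ⟨hsq⟩⟩).exists_lift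
    exact ⟨l, hl⟩
  have hspec : ∀ W : X.Opens, l (IsLocalRing.closedPoint R) ∈ W →
      i (IsLocalRing.closedPoint K) ∈ W := by
    intro W hW
    rw [← hl']
    exact top_le_preimage l hW trivial
  have hcomp : ∀ (i) (_ : Spec.map (CommRingCat.ofHom (algebraMap R K)) ≫ l = i) (W : X.Opens) (hW : l (IsLocalRing.closedPoint R) ∈ W) (hW') (a : Γ(X, W)),
      pullLocal i W hW' a = pullLocal l W hW a := by
    rintro _ rfl W hW hW' a
    exact pullLocal_comp (algebraMap R K) l hW hW' a
  refine ⟨i (IsLocalRing.closedPoint K), l (IsLocalRing.closedPoint R), pullLocal i,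
    fromSpec_mem hV φ, pullLocal_fromSpec hV φ _, hspec, fun W W' h hξ a => pullLocal_rres i h hξ a,
    fun W hξ a => ⟨fun h => ?_, fun h => mem_basicOpen_of_isUnit_pullLocal i hξ a h.isUnit⟩,
    fun W hz hξ a => ⟨?_, fun h0 hinv => ?_⟩⟩
  · rw [← pullLocal_rres i (X.basicOpen_le a) h]
    exact ((isUnit_rres_basicOpen a).map _).ne_zero
  · rw [hcomp i hl' W hz]
    exact (pullLocal l W hz a).2
  · apply mem_basicOpen_of_isUnit_pullLocal l hz
    rw [hcomp i hl' W hz] at h0 hinv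
    refine IsUnit.of_mul_eq_one ⟨_, hinv⟩ (Subtype.ext ?_)
    exact mul_inv_cancel₀ h0

lemma exists_pow_mem_annihilator {F : X.Modules} (hF : IsCoherent F) {V : X.Opens}
    (hV : IsAffineOpen V) (g : Γ(X, V)) (hg : VanishesOn F (X.basicOpen g)) :
    ∃ n : ℕ, ∀ m : Γ(F, V), g ^ n • m = 0 := by
  have hfin := hF.finite V hV
  obtain ⟨t, ht⟩ := hfin.fg_top
  choose n hn using fun m : Γ(F, V) => (hF.isLocalizing V hV g).exists_pow m (hg _ le_rfl _)
  refine ⟨∑ m ∈ t, n m, fun m => ?_⟩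
  have hm : m ∈ Submodule.span Γ(X, V) (t : Set Γ(F, V)) := ht ▸ Submodule.mem_top
  induction hm using Submodule.span_induction with
  | mem m hm =>
    rw [← Nat.sub_add_cancel (Finset.single_le_sum (f := n) (fun _ _ => Nat.zero_le _) hm), pow_add,
      mul_smul, hn, smul_zero]
  | zero => rw [smul_zero]
  | add m m' _ _ h h' => rw [smul_add, h, h', add_zero]
  | smul b m _ h => rw [smul_comm, h, smul_zero]

lemma finiteType_scalars (f : X ⟶ Spec (CommRingCat.of ℂ)) [LocallyOfFiniteType f] {V : X.Opens}
    (hV : IsAffineOpen V) : (scalars f V).FiniteType := by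
  have h1 := f.finiteType_appLE (isAffineOpen_top _) hV (le_top : V ≤ f ⁻¹ᵁ ⊤)
  have h2 : ((Scheme.ΓSpecIso (CommRingCat.of ℂ)).inv).hom.FiniteType :=
    RingHom.FiniteType.of_surjective _
      (ConcreteCategory.bijective_of_isIso (Scheme.ΓSpecIso (CommRingCat.of ℂ)).inv).2
  exact h1.comp h2

/-- On a proper scheme, a coherent sheaf supported in `V₀ ∪ V₁` is finite over `ℂ[x]` on `V₀`, if
`x` has an inverse `y` on `V₁` near the points of `V₁` outside `V₀`. -/
theorem isFGUnder_mulLin (f : X ⟶ Spec (CommRingCat.of ℂ)) [UniversallyClosed f]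
    [LocallyOfFiniteType f] {F : X.Modules} (hF : IsCoherent F) {V₀ V₁ : X.Opens}
    (hV₀ : IsAffineOpen V₀) (x : Γ(X, V₀)) (y : Γ(X, V₁))
    (hxy : rres (inf_le_left : V₀ ⊓ V₁ ≤ V₀) x * rres inf_le_right y = 1)
    (hy : X.basicOpen y ≤ V₀) (hs : SupportedIn F (V₀ ⊔ V₁)) : IsFGUnder (mulLin f F x) := by
  let _ : Module Γ(X, V₀) (Sec f F V₀) := inferInstanceAs (Module Γ(X, V₀) Γ(F, V₀))
  have _ : Module.Finite Γ(X, V₀) (Sec f F V₀) := hF.finite V₀ hV₀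
  refine isFGUnder_of_isIntegral (scalars f V₀) (finiteType_scalars f hV₀) (fun _ _ => rfl) x
    (mulLin f F x) (fun _ => rfl) fun a => ?_
  -- Otherwise a valuation ring contains `φ x` but not `φ a`. Its centre `z` is not in `V₀`, where
  -- `a` would have integral value. If it were in `V₁`, the value of `y` would have the integral
  -- inverse `φ x`, so `z` would lie in `D(y) ≤ V₀`. Hence `F` vanishes near `z`, and so near its
  -- generization `ξ`; a power of a function `g` nonzero at `ξ` annihilates `F` and is killed by
  -- `φ`, a contradiction.
  by_contra hcon
  obtain ⟨K, _, φ, R, hJ, hR, ha⟩ := exists_valuationSubring_notMem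
    (Polynomial.eval₂RingHom (scalars f V₀) x) a (Module.annihilator Γ(X, V₀) (Sec f F V₀))
    (fun P hP hmem => hcon ⟨P, hP, Module.mem_annihilator.mp hmem⟩)
  have hx : φ x ∈ R := by simpa using hR Polynomial.X
  obtain ⟨ξ, z, χ, hξ, hφ, hgen, hres, hbas, hint⟩ := exists_center f hV₀ φ R
    (fun c => by simpa using hR (Polynomial.C c))
  have hz₀ : z ∉ V₀ := fun hz => ha (by rw [← hφ]; exact (hint V₀ hz hξ a).1)
  have hz₁ : z ∉ V₁ := by
    intro hz
    have hξ₁ := hgen V₁ hz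
    have h1 : χ V₀ hξ x * χ V₁ hξ₁ y = 1 := by
      rw [← hres V₀ (V₀ ⊓ V₁) inf_le_left ⟨hξ, hξ₁⟩, ← hres V₁ (V₀ ⊓ V₁) inf_le_right ⟨hξ, hξ₁⟩,
        ← map_mul, hxy, map_one]
    refine hz₀ (hy ((hint V₁ hz hξ₁ y).2 (right_ne_zero_of_mul_eq_one h1) ?_))
    rw [← eq_inv_of_mul_eq_one_left h1, hφ]
    exact hx
  obtain ⟨W, hzW, hW⟩ := hs z fun h => h.elim hz₀ hz₁
  obtain ⟨g, hgW, hξg⟩ := basicOpen_mono_affine hV₀ hξ (hgen W hzW)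
  obtain ⟨n, hn⟩ := exists_pow_mem_annihilator hF hV₀ g fun V hV => hW V (hV.trans hgW)
  have h1 := hJ (g ^ n) (Module.mem_annihilator.mpr hn)
  rw [map_pow, ← hφ] at h1
  exact (hbas V₀ hξ g).mp hξg (eq_zero_of_pow_eq_zero h1)

/-- The sections of a coherent sheaf supported in an affine open subset of a proper scheme are
finite dimensional. -/
lemma finiteDimensional_of_supportedIn (f : X ⟶ Spec (CommRingCat.of ℂ)) [UniversallyClosed f]
    [LocallyOfFiniteType f] {F : X.Modules} (hF : IsCoherent F) {V : X.Opens}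
    (hV : IsAffineOpen V) (hs : SupportedIn F V) : FiniteDimensional ℂ (Sec f F V) := by
  -- The degenerate chart `V₀ = V₁ = V`, `x = y = 1`: generation under the identity is generation
  -- over `ℂ`.
  obtain ⟨s, h⟩ := isFGUnder_mulLin f hF hV (1 : Γ(X, V)) (1 : Γ(X, V))
    (by rw [rres_one]; exact one_mul 1) (X.basicOpen_le _) (by rwa [sup_idem])
  exact ⟨⟨s, h _ Submodule.subset_span fun a ha => by rwa [mulLin_one]⟩⟩

/-! ### Closed sets of dimension at most one -/

section topology

variable {T : Type*} [TopologicalSpace T]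

/-- The closure of a point of a subset, as an irreducible closed set. -/
def pointClosure {Z : Set T} (z : Z) : IrreducibleCloseds Z where
  carrier := closure {z}
  isIrreducible' := isIrreducible_singleton.closure
  isClosed' := isClosed_closure

lemma pointClosure_lt [T0Space T] {Z : Set T} {a b : Z} (h : (a : T) ⤳ b) (hne : (a : T) ≠ b) :
    pointClosure b < pointClosure a := by
  have h1 : a ⤳ b := Topology.IsInducing.subtypeVal.specializes_iff.mp h
  refine lt_of_le_of_ne (specializes_iff_closure_subset.mp h1) fun heq => hne ?_
  have h2 : b ⤳ a := specializes_iff_closure_subset.mpr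
    (congrArg (fun s : IrreducibleCloseds Z => (s : Set Z)) heq).ge
  exact congrArg Subtype.val (h1.antisymm h2).eq

/-- Irreducible closed sets have unique generic points, so chains of such sets are chains of
specialisations; dimensions are used below only in this form. -/
lemma topologicalKrullDim_nonpos_iff [QuasiSober T] [T0Space T] {Z : Set T} (hZ : IsClosed Z) :
    topologicalKrullDim Z ≤ 0 ↔ ∀ a ∈ Z, ∀ b ∈ Z, a ⤳ b → a = b := by
  rw [topologicalKrullDim, Order.krullDim_nonpos_iff_forall_isMax]
  constructor
  · intro H a ha b hb hab
    by_contra hne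
    exact (H (pointClosure ⟨b, hb⟩)).not_lt (pointClosure_lt (a := ⟨a, ha⟩) hab hne)
  · intro H s t hst
    have : QuasiSober Z := hZ.isClosedEmbedding_subtypeVal.quasiSober
    obtain ⟨x, hx⟩ := QuasiSober.sober s.isIrreducible' s.isClosed'
    obtain ⟨y, hy⟩ := QuasiSober.sober t.isIrreducible' t.isClosed'
    have hyx : y ⤳ x := hy.specializes (hst hx.mem)
    have h1 := H y y.2 x x.2 (Topology.IsInducing.subtypeVal.specializes_iff.mpr hyx)
    have h2 : y = x := Subtype.ext h1
    intro z hz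
    have h3 : y ⤳ z := hy.specializes hz
    rw [h2] at h3
    exact h3.mem_closed s.isClosed' hx.mem

lemma eq_or_eq_of_topologicalKrullDim_le_one [T0Space T] {Z : Set T}
    (hZ : topologicalKrullDim Z ≤ 1) {a b c : T} (ha : a ∈ Z) (hb : b ∈ Z) (hc : c ∈ Z)
    (hab : a ⤳ b) (hbc : b ⤳ c) : a = b ∨ b = c := by
  rw [topologicalKrullDim, Order.krullDim_le_one_iff] at hZ
  by_contra! h
  obtain h1 | h1 := hZ (pointClosure ⟨b, hb⟩)
  · exact h1.not_lt (pointClosure_lt (a := ⟨b, hb⟩) (b := ⟨c, hc⟩) hbc h.2)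
  · exact h1.not_lt (pointClosure_lt (a := ⟨a, ha⟩) (b := ⟨b, hb⟩) hab h.1)

/-- Finitely many points whose closures fill a closed set. -/
lemma exists_finset_specializes [NoetherianSpace T] [QuasiSober T] {Z : Set T} (hZ : IsClosed Z) :
    ∃ S : Finset T, (∀ s ∈ S, s ∈ Z) ∧ ∀ z ∈ Z, ∃ s ∈ S, s ⤳ z := by
  classical
  obtain ⟨S, hS, hcl, hirr, rfl⟩ := NoetherianSpace.exists_finite_set_isClosed_irreducible hZ
  choose g hg using fun t : S => QuasiSober.sober (hirr t t.2) (hcl t t.2)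
  have := hS.fintype
  refine ⟨Finset.univ.image g, fun s hs => ?_, fun z hz => ?_⟩
  · obtain ⟨t, -, rfl⟩ := Finset.mem_image.mp hs
    exact ⟨t, t.2, (hg t).mem⟩
  · obtain ⟨t, ht, hzt⟩ := hz
    exact ⟨g ⟨t, ht⟩, Finset.mem_image_of_mem _ (Finset.mem_univ _), (hg ⟨t, ht⟩).specializes hzt⟩

lemma exists_finset_of_dim_zero [NoetherianSpace T] [QuasiSober T] {Z : Set T} (hZ : IsClosed Z)
    (H : ∀ a ∈ Z, ∀ b ∈ Z, a ⤳ b → a = b) : ∃ S : Finset T, Z ⊆ S := by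
  obtain ⟨S, hS, h⟩ := exists_finset_specializes hZ
  refine ⟨S, fun z hz => ?_⟩
  obtain ⟨s, hs, hsz⟩ := h z hz
  rw [← H s (hS s hs) z hz hsz]
  exact hs

/-- `S` consists of generic points of irreducible pieces of `Z`. A specialisation `a ⤳ b` outside
`V` extends to `s ⤳ a ⤳ b` with `s ∈ S ⊆ V`; as `a ≠ s`, it must be trivial. -/
lemma exists_finset_of_dim_one [NoetherianSpace T] [QuasiSober T] {Z : Set T} (hZ : IsClosed Z)
    (H : ∀ a ∈ Z, ∀ b ∈ Z, ∀ c ∈ Z, a ⤳ b → b ⤳ c → a = b ∨ b = c) :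
    ∃ S : Finset T, ∀ V : Set T, IsOpen V → (S : Set T) ⊆ V →
      ∃ S' : Finset T, Z \ V ⊆ S' := by
  obtain ⟨S, hS, h⟩ := exists_finset_specializes hZ
  refine ⟨S, fun V hV hSV => exists_finset_of_dim_zero (hZ.sdiff hV) ?_⟩
  rintro a ⟨ha, haV⟩ b ⟨hb, -⟩ hab
  obtain ⟨s, hs, hsa⟩ := h a ha
  obtain h1 | h1 := H s (hS s hs) a ha b hb hsa hab
  · exact absurd (hSV (h1 ▸ Finset.mem_coe.mpr hs)) haV
  · exact h1

end topology

/-! ### The support of a coherent sheaf -/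

section support

variable {M : X.Modules}

lemma vanishesOn_of_res (hM : IsLocalizing M) {V W : X.Opens} (hV : IsAffineOpen V) (h : W ≤ V)
    (H : ∀ m : Γ(M, V), res M h m = 0) : VanishesOn M W := by
  intro Y hY t
  apply section_ext
  intro x hx
  obtain ⟨g, hgY, hxg⟩ := basicOpen_mono_affine hV (h (hY hx)) hx
  refine ⟨X.basicOpen g, hgY, hxg, ?_⟩
  rw [res_zero]
  obtain ⟨n, y, hy⟩ := (hM V hV g).exists_lift (res M hgY t)
  have h1 : res M (X.basicOpen_le g) y = 0 := by
    rw [← res_res M h (hgY.trans hY), H, res_zero]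
  rw [h1] at hy
  have hu := (isUnit_rres_basicOpen g).pow n
  exact (hu.smul_eq_zero).mp hy.symm

/-- If the stalk vanishes, each of finitely many generators dies on a basic neighbourhood of the
point, and all of them die on the basic open set of the product. This replaces stalks by open
neighbourhoods. -/
lemma mem_support_iff (hM : IsCoherent M) {x : X} :
    x ∈ support M ↔ ∀ W : X.Opens, x ∈ W → ¬ VanishesOn M W := by
  constructor
  · intro hx W hxW hW
    have hx' : Nontrivial (M.presheaf.stalk x) := hx
    obtain ⟨t, ht⟩ := exists_ne (0 : M.presheaf.stalk x)
    obtain ⟨U, hU, m, s, rfl⟩ := TopCat.Presheaf.exists_le_germ_eq M.presheaf t hxW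
    apply ht
    rw [hW U hU s]
    exact map_zero _
  · intro H
    by_contra hx
    have hx' : Subsingleton (M.presheaf.stalk x) := not_nontrivial_iff_subsingleton.mp hx
    obtain ⟨_, ⟨V, hV, rfl⟩, hxV, -⟩ :=
      X.isBasis_affineOpens.exists_subset_of_mem_open (Set.mem_univ x) isOpen_univ
    have hfin := hM.finite V hV
    obtain ⟨S, hS⟩ := hfin.fg_top
    have key : ∀ m : Γ(M, V), ∃ g : Γ(X, V), x ∈ X.basicOpen g ∧ res M (X.basicOpen_le g) m = 0 := by
      intro m
      obtain ⟨W, hxW, iU, iV, hW⟩ := TopCat.Presheaf.germ_eq M.presheaf x hxV hxV m 0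
        (Subsingleton.elim _ _)
      obtain ⟨g, hgW, hxg⟩ := basicOpen_mono_affine hV hxV hxW
      refine ⟨g, hxg, ?_⟩
      have h1 : res M (leOfHom iU) m = 0 := hW.trans (map_zero _)
      rw [← res_res M (leOfHom iU) hgW, h1, res_zero]
    choose g hxg hg using key
    classical
    refine H (X.basicOpen (∏ m ∈ S, g m)) ?_ (vanishesOn_of_res hM.isLocalizing hV
      (X.basicOpen_le _) fun m => ?_)
    · have h1 := map_prod (X.evaluation V x hxV).hom g S
      rw [← Scheme.evaluation_ne_zero_iff_mem_basicOpen X x hxV]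
      intro h0
      have h2 := h1.symm.trans h0
      obtain ⟨m, -, hm⟩ := Finset.prod_eq_zero_iff.mp h2
      exact (Scheme.evaluation_ne_zero_iff_mem_basicOpen X x hxV (g m)).mpr (hxg m) hm
    · have hm : m ∈ Submodule.span Γ(X, V) (S : Set Γ(M, V)) := hS ▸ Submodule.mem_top
      induction hm using Submodule.span_induction with
      | mem m hm =>
        have hle : X.basicOpen (∏ m ∈ S, g m) ≤ X.basicOpen (g m) := by
          rw [← Finset.mul_prod_erase S g hm, Scheme.basicOpen_mul]
          exact inf_le_left
        rw [← res_res M (X.basicOpen_le (g m)) hle, hg, res_zero]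
      | zero => exact res_zero _ _
      | add m m' _ _ h h' => rw [res_add, h, h', add_zero]
      | smul b m _ h => rw [res_smul, h, smul_zero]

lemma isClosed_support (hM : IsCoherent M) : IsClosed (support M) := by
  rw [← isOpen_compl_iff, isOpen_iff_forall_mem_open]
  intro x hx
  have : ¬ ∀ W : X.Opens, x ∈ W → ¬ VanishesOn M W := fun h => hx ((mem_support_iff hM).mpr h)
  push Not at this
  obtain ⟨W, hxW, hW⟩ := this
  exact ⟨W, fun y hy h => (mem_support_iff hM).mp h W hy hW, W.isOpen, hxW⟩

lemma supportedIn_iff (hM : IsCoherent M) {V : X.Opens} :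
    SupportedIn M V ↔ support M ⊆ V := by
  constructor
  · intro h x hx
    by_contra hxV
    obtain ⟨W, hxW, hW⟩ := h x hxV
    exact (mem_support_iff hM).mp hx W hxW hW
  · intro h x hx
    have : ¬ ∀ W : X.Opens, x ∈ W → ¬ VanishesOn M W := fun h' => hx (h ((mem_support_iff hM).mpr h'))
    push Not at this
    exact this

lemma isZero_iff : IsZero M ↔ VanishesOn M ⊤ := by
  rw [IsZero.iff_id_eq_zero]
  constructor
  · intro h V _ t
    exact congrArg (fun φ : M ⟶ M => φ.app V t) h
  · intro h
    ext V t
    exact (h V le_top _).trans (h V le_top _).symm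

end support

/-! ### Charts -/

/-- Two affine open sets on which `L` is trivial, with functions `x` and `y` that are inverse to
each other on the intersection and relate the two trivialisations of a power of `L`. -/
structure Chart (L : X.Modules) where
  /-- The first open set. -/
  V₀ : X.Opens
  /-- The second open set. -/
  V₁ : X.Opens
  hV₀ : IsAffineOpen V₀
  hV₁ : IsAffineOpen V₁
  /-- A generator on the first open set. -/
  e₀ : Γ(L, V₀)
  he₀ : IsGenerator L e₀
  /-- A generator on the second open set. -/
  e₁ : Γ(L, V₁)
  he₁ : IsGenerator L e₁
  /-- The function cutting out the intersection on the first open set. -/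
  x : Γ(X, V₀)
  /-- The function cutting out the intersection on the second open set. -/
  y : Γ(X, V₁)
  hxy : rres (inf_le_left : V₀ ⊓ V₁ ≤ V₀) x * rres inf_le_right y = 1
  hx : X.basicOpen x ≤ V₁
  hy : X.basicOpen y ≤ V₀
  /-- The quotient of the two generators. -/
  u : Γ(X, V₀ ⊓ V₁)
  hu : res L inf_le_right e₁ = u • res L inf_le_left e₀
  /-- The power of `L`. -/
  n : ℕ
  hn : 1 ≤ n
  /-- A unit on the first open set. -/
  α : Γ(X, V₀)
  hα : IsUnit α
  /-- A unit on the second open set. -/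
  β : Γ(X, V₁)
  hβ : IsUnit β
  hun : u ^ n = rres inf_le_left α * (rres inf_le_left x * rres inf_le_right β)

/-- Every closed set without chains of three points lies in a chart. -/
lemma IsAmple.exists_chart [X.IsSeparated] [IsLocallyNoetherian X] [CompactSpace X]
    {L : X.Modules} (hL : IsAmple L) (f : X ⟶ Spec (CommRingCat.of ℂ)) {Z : Set X}
    (hZ : IsClosed Z)
    (H : ∀ a ∈ Z, ∀ b ∈ Z, ∀ c ∈ Z, a ⤳ b → b ⤳ c → a = b ∨ b = c) :
    ∃ C : Chart L, Z ⊆ (C.V₀ ⊔ C.V₁ : X.Opens) := by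
  have : IsNoetherian X := {}
  -- The section `σ` is chosen nonzero at the generic points of `Z`. Only finitely many points of
  -- `Z` remain outside its locus, and `τ` is chosen nonzero at these.
  obtain ⟨S, hS⟩ := exists_finset_of_dim_one hZ H
  obtain ⟨n₀, hn₀, σ, hσ, hSσ, e₀, he₀⟩ := hL.exists_powSec f S
  obtain ⟨S', hS'⟩ := hS σ.locus σ.locus.isOpen hSσ
  obtain ⟨n₁, hn₁, τ, hτ, hSτ, e₁, he₁⟩ := hL.exists_powSec f S'
  obtain ⟨u, hu⟩ := he₀.exists_eq_smul (inf_le_left : σ.locus ⊓ τ.locus ≤ _)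
    (res L inf_le_right e₁)
  have hσu := (σ.isUnit_coord le_top le_rfl he₀).pow n₁
  have hτu := (τ.isUnit_coord le_top le_rfl he₁).pow n₀
  -- `σ ^ n₁` and `τ ^ n₀` are sections of the same power `n = n₀ n₁`, with coordinates `a₀`, `a₁`
  -- in `e₀` and `b₀`, `b₁` in `e₁`. So `x = a₁ / a₀` and `y = b₀ / b₁` are the two quotients of
  -- these sections, and `uⁿ = a₁ / b₁ = a₀ · x · b₁⁻¹`, which explains `α` and `β`.
  set a₀ := σ.coord le_top he₀ ^ n₁ with ha₀
  set a₁ := τ.coord le_top he₀ ^ n₀ with ha₁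
  set b₀ := σ.coord le_top he₁ ^ n₁ with hb₀
  set b₁ := τ.coord le_top he₁ ^ n₀ with hb₁
  obtain ⟨a', ha'⟩ := hσu.exists_right_inv
  obtain ⟨b', hb'⟩ := hτu.exists_right_inv
  have h0 : rres inf_le_left a₀ = u ^ (n₀ * n₁) * rres inf_le_right b₀ := by
    have := σ.coord_smul le_top (he₀.res inf_le_left) (he₁.res inf_le_right) u hu
    rw [ha₀, hb₀, rres_pow, rres_pow, σ.rres_coord, σ.rres_coord, this, mul_pow, pow_mul]
  have h1 : rres inf_le_left a₁ = u ^ (n₀ * n₁) * rres inf_le_right b₁ := by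
    have := τ.coord_smul le_top (he₀.res inf_le_left) (he₁.res inf_le_right) u hu
    rw [ha₁, hb₁, rres_pow, rres_pow, τ.rres_coord, τ.rres_coord, this, mul_pow, mul_comm n₀,
      pow_mul]
  have ha'' : rres (inf_le_left : σ.locus ⊓ τ.locus ≤ _) a₀ * rres inf_le_left a' = 1 := by
    rw [← rres_mul, ha', rres_one]
  have hb'' : rres (inf_le_right : σ.locus ⊓ τ.locus ≤ _) b₁ * rres inf_le_right b' = 1 := by
    rw [← rres_mul, hb', rres_one]
  refine ⟨{
    V₀ := σ.locus
    V₁ := τ.locus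
    hV₀ := hσ
    hV₁ := hτ
    e₀ := e₀
    he₀ := he₀
    e₁ := e₁
    he₁ := he₁
    x := a₁ * a'
    y := b₀ * b'
    hxy := ?_
    hx := ?_
    hy := ?_
    u := u
    hu := hu
    n := n₀ * n₁
    hn := Nat.mul_pos hn₀ hn₁
    α := a₀
    hα := hσu
    β := b'
    hβ := IsUnit.of_mul_eq_one b₁ (by rw [mul_comm, hb'])
    hun := ?_ }, ?_⟩
  · rw [rres_mul, rres_mul, h1]
    calc _ = (u ^ (n₀ * n₁) * rres inf_le_right b₀) * rres inf_le_left a' *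
          (rres inf_le_right b₁ * rres inf_le_right b') := by ring
      _ = 1 := by rw [hb'', ← h0, ha'', one_mul]
  · rw [Scheme.basicOpen_mul]
    refine inf_le_left.trans ?_
    rw [ha₁, Scheme.basicOpen_pow X _ hn₀, ← τ.locus_inf]
    exact inf_le_left
  · rw [Scheme.basicOpen_mul]
    refine inf_le_left.trans ?_
    rw [hb₀, Scheme.basicOpen_pow X _ hn₁, ← σ.locus_inf]
    exact inf_le_left
  · rw [rres_mul, h1]
    calc _ = u ^ (n₀ * n₁) * (rres inf_le_left a₀ * rres inf_le_left a') *
          (rres inf_le_right b₁ * rres inf_le_right b') := by rw [ha'', hb'', mul_one, mul_one]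
      _ = _ := by ring
  · intro z hz
    by_cases h : z ∈ σ.locus
    · exact Or.inl h
    · exact Or.inr (hSτ z (hS' ⟨hz, h⟩))

namespace Chart

variable {L : X.Modules} (C : Chart L) (f : X ⟶ Spec (CommRingCat.of ℂ)) {F : X.Modules}

lemma basicOpen_x : X.basicOpen C.x = C.V₀ ⊓ C.V₁ := by
  apply le_antisymm (le_inf (X.basicOpen_le _) C.hx)
  have h1 : X.basicOpen (rres (inf_le_left : C.V₀ ⊓ C.V₁ ≤ _) C.x) = C.V₀ ⊓ C.V₁ :=
    X.basicOpen_of_isUnit (IsUnit.of_mul_eq_one _ C.hxy)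
  rw [← h1, rres, Scheme.basicOpen_res]
  exact inf_le_right

lemma basicOpen_y : X.basicOpen C.y = C.V₀ ⊓ C.V₁ := by
  apply le_antisymm (le_inf C.hy (X.basicOpen_le _))
  have h1 : X.basicOpen (rres (inf_le_right : C.V₀ ⊓ C.V₁ ≤ _) C.y) = C.V₀ ⊓ C.V₁ :=
    X.basicOpen_of_isUnit (IsUnit.of_mul_eq_one _ (by rw [mul_comm]; exact C.hxy))
  rw [← h1, rres, Scheme.basicOpen_res]
  exact inf_le_right

lemma mulLin_pow {U : X.Opens} (g : Γ(X, U)) (k : ℕ) :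
    mulLin f F (g ^ k) = (mulLin f F g) ^ k := by
  induction k with
  | zero =>
    ext t
    rw [pow_zero, pow_zero, mulLin_one]
    rfl
  | succ k ih =>
    ext t
    rw [pow_succ, pow_succ, ← ih, mulLin_mul]
    rfl

/-- The sections over the two open sets form a chart in the sense of linear algebra. -/
lemma isChart [UniversallyClosed f] [LocallyOfFiniteType f] (hF : IsCoherent F)
    (hs : SupportedIn F (C.V₀ ⊔ C.V₁)) :
    IsChart (mulLin f F C.x) (mulLin f F C.y)
      (mulLin f F (rres (inf_le_left : C.V₀ ⊓ C.V₁ ≤ _) C.x))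
      (mulLin f F (rres (inf_le_right : C.V₀ ⊓ C.V₁ ≤ _) C.y))
      (resLin f F inf_le_left) (resLin f F inf_le_right) where
  fgA := isFGUnder_mulLin f hF C.hV₀ C.x C.y C.hxy C.hy hs
  fgB := by
    refine isFGUnder_mulLin f hF C.hV₁ C.y C.x ?_ C.hx (by rwa [sup_comm])
    have h := congrArg (rres (le_of_eq (inf_comm _ _) : C.V₁ ⊓ C.V₀ ≤ C.V₀ ⊓ C.V₁)) C.hxy
    rw [rres_mul, rres_rres, rres_rres, rres_one] at h
    rw [mul_comm]
    exact h
  tt' m := by rw [← mulLin_mul, C.hxy, mulLin_one]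
  t't m := by rw [← mulLin_mul, mul_comm, C.hxy, mulLin_one]
  hφ a := resLin_mulLin f F _ _ a
  hψ b := resLin_mulLin f F _ _ b
  kerφ a ha := by
    obtain ⟨n, hn⟩ := hF.isLocalizing.exists_pow_inf le_rfl C.hV₀ C.x
      (D := C.V₀ ⊓ C.V₁) (by rw [C.basicOpen_x, inf_left_idem]) a ha
    rw [rres_self] at hn
    exact ⟨n, by rw [← mulLin_pow]; exact hn⟩
  kerψ b hb := by
    obtain ⟨n, hn⟩ := hF.isLocalizing.exists_pow_inf le_rfl C.hV₁ C.y
      (D := C.V₀ ⊓ C.V₁) (by rw [C.basicOpen_y, inf_left_comm, inf_idem]) b hb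
    rw [rres_self] at hn
    exact ⟨n, by rw [← mulLin_pow]; exact hn⟩
  surjφ m := by
    obtain ⟨n, y, hy⟩ := hF.isLocalizing.exists_lift_inf le_rfl C.hV₀ C.x
      (D := C.V₀ ⊓ C.V₁) (by rw [C.basicOpen_x, inf_left_idem]) m
    exact ⟨n, y, by rw [← mulLin_pow]; exact hy⟩
  surjψ m := by
    obtain ⟨n, y, hy⟩ := hF.isLocalizing.exists_lift_inf le_rfl C.hV₁ C.y
      (D := C.V₀ ⊓ C.V₁) (by rw [C.basicOpen_y, inf_left_comm, inf_idem]) m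
    exact ⟨n, y, by rw [← mulLin_pow]; exact hy⟩

/-- Multiplication by a unit. -/
def unitEquiv (F : X.Modules) {U : X.Opens} {a : Γ(X, U)} (ha : IsUnit a) :
    Sec f F U ≃ₗ[ℂ] Sec f F U :=
  LinearEquiv.ofLinearMap (mulLin f F a) (mulLin f F ↑ha.unit⁻¹)
    (by
      ext t
      rw [LinearMap.comp_apply, ← mulLin_mul, ha.mul_val_inv, mulLin_one]
      rfl)
    (by
      ext t
      rw [LinearMap.comp_apply, ← mulLin_mul, ha.val_inv_mul, mulLin_one]
      rfl)

lemma isUnit_u : IsUnit C.u := by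
  obtain ⟨v, hv⟩ := C.he₁.exists_eq_smul (inf_le_right : C.V₀ ⊓ C.V₁ ≤ _)
    (res L inf_le_left C.e₀)
  refine IsUnit.of_mul_eq_one v ((C.he₁.res inf_le_right).smul_inj_self ?_)
  rw [one_smul, mul_smul, ← hv, ← C.hu]

/-- The Euler characteristics of the twists of a coherent sheaf supported in a chart. -/
theorem exists_linear [UniversallyClosed f] [LocallyOfFiniteType f] [X.IsSeparated]
    [IsLocallyNoetherian X] (hL : IsInvertible L) {m : ℕ} {U : Fin m → X.Opens}
    (hU : IsAffineCover U) (hF : IsCoherent F) (hs : SupportedIn F (C.V₀ ⊔ C.V₁)) :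
    ∃ r c : ℤ, (∀ k, eulerChar f U (twist L F k) = r * k + c) ∧ 0 ≤ r ∧
      (r = 0 → FiniteDimensional ℂ (Sec f F C.V₀) ∧ FiniteDimensional ℂ (Sec f F C.V₁)) := by
  have H := C.isChart f hF hs
  -- The transition function `u` has a pole along `y = 0`; `a` extends `y ^ M u` to `V₁`.
  obtain ⟨M, a, ha⟩ : ∃ (M : ℕ) (a : Γ(X, C.V₁)), rres inf_le_right a =
      rres (inf_le_right : C.V₀ ⊓ C.V₁ ≤ _) C.y ^ M * C.u :=
    (isCoherent_structureSheaf X).isLocalizing.exists_lift_inf le_rfl C.hV₁ C.y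
      (D := C.V₀ ⊓ C.V₁) (by rw [C.basicOpen_y, inf_left_comm, inf_idem]) C.u
  set uu := unitEquiv f F C.isUnit_u
  have huu' : ∀ t, mulLin f F C.u (uu.symm t) = t := uu.apply_symm_apply
  have hu'u : ∀ t, uu.symm (mulLin f F C.u t) = t := uu.symm_apply_apply
  have hut' : ∀ t, mulLin f F C.u (mulLin f F (rres inf_le_right C.y) t) =
      mulLin f F (rres inf_le_right C.y) (mulLin f F C.u t) := fun t => by
    rw [← mulLin_mul, mul_comm, mulLin_mul]
  have hay : ∀ b, mulLin f F a (mulLin f F C.y b) = mulLin f F C.y (mulLin f F a b) := fun t => by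
    rw [← mulLin_mul, mul_comm, mulLin_mul]
  have haψ : ∀ b, resLin f F (inf_le_right : C.V₀ ⊓ C.V₁ ≤ _) (mulLin f F a b) =
      mulLin f F C.u ((mulLin f F (rres inf_le_right C.y) ^ M) (resLin f F inf_le_right b)) :=
    fun b => by rw [resLin_mulLin, ha, mul_comm, mulLin_mul, mulLin_pow]
  have h1 := H.index_pow (u := mulLin f F C.u) (u' := uu.symm.toLinearMap) huu' hu'u hut'
    (mulLin f F a) M hay haψ
  -- Up to the units `α` and `β`, the power `uⁿ` is `x`. So `n` times the slope is minus the index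
  -- of `y`, which gives its sign and the case of slope zero.
  have h2 := H.mul_slope (u := mulLin f F C.u) (u' := uu.symm.toLinearMap) huu' hu'u hut'
    (mulLin f F a) M hay haψ C.n (unitEquiv f F C.hα)
    (unitEquiv f F (C.hα.map (X.presheaf.map (homOfLE (inf_le_left : C.V₀ ⊓ C.V₁ ≤ _)).op).hom))
    (unitEquiv f F C.hβ) (fun a => resLin_mulLin f F _ _ a) (fun b => by
      change (mulLin f F C.u ^ C.n) _ = mulLin f F (rres inf_le_left C.α) (mulLin f F _
        (resLin f F _ (mulLin f F C.β b)))
      rw [← mulLin_pow, C.hun, mulLin_mul, mulLin_mul, resLin_mulLin])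
  have h3 := H.fgB.index_nonpos
  have hn : (0 : ℤ) < C.n := by exact_mod_cast C.hn
  refine ⟨(mulLin f F a).index - (mulLin f F C.y ^ M).index,
    ((resLin f F (inf_le_left : C.V₀ ⊓ C.V₁ ≤ _)).coprod
      (-resLin f F (inf_le_right : C.V₀ ⊓ C.V₁ ≤ _))).index, fun k => ?_, ?_, ?_⟩
  · rw [eulerChar_twist f hU hF.isLocalizing hL C.hV₀ C.hV₁ hs C.he₀ C.he₁ C.u C.hu, chartD,
      mulLin_pow]
    exact h1 k
  · have h4 := h3.1
    by_contra hlt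
    rw [not_le] at hlt
    nlinarith
  · intro h0
    rw [h0, zero_mul] at h2
    have := h3.2 (by omega)
    exact ⟨H.finiteDimensional_left, this⟩

lemma chartD_map {G F : X.Modules} (i : G ⟶ F) {V₀ V₁ : X.Opens} (u : Γ(X, V₀ ⊓ V₁))
    (a : Γ(G, V₀)) (b : Γ(G, V₁)) :
    i.app (V₀ ⊓ V₁) (chartD f G u (a, b) : Γ(G, V₀ ⊓ V₁)) =
      (chartD f F u (i.app V₀ a, i.app V₁ b) : Γ(F, V₀ ⊓ V₁)) := by
  change i.app _ (res G inf_le_left a + -(u • res G inf_le_right b)) =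
    res F inf_le_left (i.app V₀ a) + -(u • res F inf_le_right (i.app V₁ b))
  rw [map_add, map_neg, Scheme.Modules.Hom.app_smul, app_res, app_res]

/-- The Euler characteristic is additive on short exact sequences supported in a chart. -/
theorem eulerChar_add [UniversallyClosed f] [LocallyOfFiniteType f] [X.IsSeparated]
    [IsLocallyNoetherian X] (hL : IsInvertible L) {m : ℕ} {U : Fin m → X.Opens}
    (hU : IsAffineCover U) {G F Q : X.Modules} {i : G ⟶ F} {π : F ⟶ Q} (h : IsSES i π)
    (hG : IsCoherent G) (hF : IsCoherent F) (hQ : IsCoherent Q)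
    (hsG : SupportedIn G (C.V₀ ⊔ C.V₁)) (hsF : SupportedIn F (C.V₀ ⊔ C.V₁))
    (hsQ : SupportedIn Q (C.V₀ ⊔ C.V₁)) (k : ℕ) :
    eulerChar f U (twist L F k) = eulerChar f U (twist L G k) + eulerChar f U (twist L Q k) := by
  have hfred : ∀ {E : X.Modules} (_ : IsCoherent E) (_ : SupportedIn E (C.V₀ ⊔ C.V₁)),
      IsFredholm (chartD f E (C.u ^ k)) := by
    intro E hE hsE
    have hut' : ∀ t, mulLin f E (C.u ^ k) (mulLin f E (rres inf_le_right C.y) t) =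
        mulLin f E (rres inf_le_right C.y) (mulLin f E (C.u ^ k) t) := fun t => by
      rw [← mulLin_mul, mul_comm, mulLin_mul]
    exact ((C.isChart f hE hsE).comp_aut (u := mulLin f E (C.u ^ k))
      (u' := (unitEquiv f E (C.isUnit_u.pow k)).symm.toLinearMap)
      (unitEquiv f E (C.isUnit_u.pow k)).apply_symm_apply
      (unitEquiv f E (C.isUnit_u.pow k)).symm_apply_apply hut').isFredholm
  rw [eulerChar_twist f hU hF.isLocalizing hL C.hV₀ C.hV₁ hsF C.he₀ C.he₁ C.u C.hu,
    eulerChar_twist f hU hG.isLocalizing hL C.hV₀ C.hV₁ hsG C.he₀ C.he₁ C.u C.hu,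
    eulerChar_twist f hU hQ.isLocalizing hL C.hV₀ C.hV₁ hsQ C.he₀ C.he₁ C.u C.hu]
  let I : ∀ W : X.Opens, Sec f G W →ₗ[ℂ] Sec f F W := fun W =>
    { toFun := fun t => (i.app W (show Γ(G, W) from t) : Γ(F, W))
      map_add' := fun a b => map_add (appLin i W) a b
      map_smul' := fun c a => (appLin i W).map_smul (scalars f W c) a }
  let P : ∀ W : X.Opens, Sec f F W →ₗ[ℂ] Sec f Q W := fun W =>
    { toFun := fun t => (π.app W (show Γ(F, W) from t) : Γ(Q, W))
      map_add' := fun a b => map_add (appLin π W) a b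
      map_smul' := fun c a => (appLin π W).map_smul (scalars f W c) a }
  have hI : ∀ W, Function.Injective (I W) := h.inj
  have hP : ∀ W, IsAffineOpen W → Function.Surjective (P W) := fun W hW =>
    h.surjective hG.isLocalizing hF.isLocalizing hW
  have hIP : ∀ W (t : Sec f F W), P W t = 0 ↔ ∃ s, I W s = t := fun W t =>
    ⟨fun ht => h.exact W t ht, by rintro ⟨s, rfl⟩; exact h.comp W s⟩
  have hV := isAffineOpen_inf C.hV₀ C.hV₁
  -- Sections over the affine sets `V₀`, `V₁` and `V₀ ∩ V₁` are exact, so the two-term complex of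
  -- `F` is an extension of that of `Q` by that of `G`.
  refine index_add_of_exact ((I C.V₀).prodMap (I C.V₁)) ((P C.V₀).prodMap (P C.V₁))
    (I (C.V₀ ⊓ C.V₁)) (P (C.V₀ ⊓ C.V₁)) ((hI _).prodMap (hI _))
    ((hP _ C.hV₀).prodMap (hP _ C.hV₁)) ?_ (hI _) (hP _ hV) (hIP _) _ _ _ ?_ ?_
    (hfred hG hsG) (hfred hQ hsQ)
  · rintro ⟨a, b⟩
    rw [LinearMap.prodMap_apply, Prod.mk_eq_zero, hIP, hIP]
    constructor
    · rintro ⟨⟨s, hs⟩, t, ht⟩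
      exact ⟨(s, t), Prod.ext hs ht⟩
    · rintro ⟨⟨s, t⟩, hst⟩
      exact ⟨⟨s, congrArg Prod.fst hst⟩, t, congrArg Prod.snd hst⟩
  · exact fun a => (chartD_map f i (C.u ^ k) a.1 a.2).symm
  · exact fun a => chartD_map f π (C.u ^ k) a.1 a.2

end Chart

section

variable {L F : X.Modules} (f : X ⟶ Spec (CommRingCat.of ℂ))

/-! ### Dimension of the support and growth of the Euler characteristic -/

lemma mulLin_eval₂ {V : X.Opens} (g : Γ(X, V)) (P : ℂ[X]) :
    mulLin f F (P.eval₂ (scalars f V) g) = Polynomial.aeval (mulLin f F g) P := by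
  induction P using Polynomial.induction_on' with
  | add p q hp hq =>
    rw [Polynomial.eval₂_add, map_add, ← hp, ← hq]
    ext t
    exact mulLin_add f F _ _ t
  | monomial n c =>
    rw [Polynomial.eval₂_monomial, Polynomial.aeval_monomial, ← Chart.mulLin_pow]
    ext t
    rw [mulLin_mul]
    rfl

/-- If the sections over an affine open set form a finite-dimensional space, then the support has
dimension zero there. -/
lemma eq_of_specializes_of_finiteDimensional (hF : IsCoherent F) {V : X.Opens}
    (hV : IsAffineOpen V) [FiniteDimensional ℂ (Sec f F V)] {a b : X} (ha : a ∈ support F)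
    (hb : b ∈ V) (hab : a ⤳ b) : a = b := by
  by_contra hne
  have hba : ¬ b ⤳ a := fun h => hne (hab.antisymm h).eq
  rw [specializes_iff_forall_open] at hba
  push Not at hba
  obtain ⟨W, hW, haW, hbW⟩ := hba
  have haV : a ∈ V := hab.mem_open V.isOpen hb
  obtain ⟨g, hgW, hag⟩ := basicOpen_mono_affine hV (W := ⟨W, hW⟩) haV haW
  have hbg : b ∉ X.basicOpen g := fun h => hbW (hgW h)
  set T := mulLin f F g
  have hT : IsIntegral ℂ T := Algebra.IsIntegral.isIntegral T
  -- Write the minimal polynomial of multiplication by `g` as `Xⁿ Q` with `Q(0) ≠ 0`, and put `h =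
  -- Q(g)`. As `gⁿ h` kills `F` and `g` is nonzero at the support point `a`, the function `h`
  -- vanishes at `a`, hence at `b`. But `g` vanishes at `b`, so `h` takes the value `Q(0)` there.
  obtain ⟨Q, hPQ, hQ⟩ := Polynomial.exists_eq_pow_rootMultiplicity_mul_and_not_dvd (minpoly ℂ T)
    (minpoly.ne_zero hT) 0
  rw [map_zero, sub_zero] at hPQ hQ
  set n := (minpoly ℂ T).rootMultiplicity 0
  have hQ0 : Q.coeff 0 ≠ 0 := fun h => hQ (Polynomial.X_dvd_iff.mpr h)
  set h : Γ(X, V) := Q.eval₂ (scalars f V) g with hh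
  have hkill : ∀ m : Γ(F, V), (g ^ n * h) • m = 0 := by
    intro m
    have h1 : g ^ n * h = (minpoly ℂ T).eval₂ (scalars f V) g := by
      rw [hPQ, Polynomial.eval₂_mul, Polynomial.eval₂_X_pow]
    have h2 := LinearMap.congr_fun (mulLin_eval₂ (F := F) f g (minpoly ℂ T)) m
    rw [minpoly.aeval, ← h1] at h2
    exact h2
  have hah : a ∉ X.basicOpen h := by
    intro hah
    refine (mem_support_iff hF).mp ha (X.basicOpen (g ^ n * h)) ?_
      (vanishesOn_of_res hF.isLocalizing hV (X.basicOpen_le _) fun m => ?_)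
    · rw [Scheme.basicOpen_mul]
      refine ⟨?_, hah⟩
      rcases Nat.eq_zero_or_pos n with h0 | h0
      · rw [h0, pow_zero]
        exact (X.basicOpen_of_isUnit isUnit_one).ge haV
      · rw [Scheme.basicOpen_pow X _ h0]
        exact hag
    · have h1 := congrArg (res F (X.basicOpen_le (g ^ n * h))) (hkill m)
      rw [res_smul, res_zero] at h1
      exact (isUnit_rres_basicOpen _).smul_eq_zero.mp h1
  have hbh : b ∉ X.basicOpen h := fun hb' => hah (hab.mem_open (X.basicOpen h).isOpen hb')
  have h3 : h + -(g * Q.divX.eval₂ (scalars f V) g) = scalars f V (Q.coeff 0) := by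
    have h6 := congrArg (Polynomial.eval₂ (scalars f V) g) (Polynomial.divX_mul_X_add Q)
    rw [Polynomial.eval₂_add, Polynomial.eval₂_mul, Polynomial.eval₂_X, Polynomial.eval₂_C] at h6
    rw [hh, ← h6]
    ring
  have h4 : b ∈ X.basicOpen (h + -(g * Q.divX.eval₂ (scalars f V) g)) := by
    rw [h3]
    exact (X.basicOpen_of_isUnit ((isUnit_iff_ne_zero.mpr hQ0).map (scalars f V))).ge hb
  rcases X.basicOpen_add_le _ _ h4 with h5 | h5
  · exact hbh h5
  · rw [← neg_mul, mul_comm, Scheme.basicOpen_mul] at h5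
    refine hbg ?_
    have := h5.2
    rwa [← neg_one_mul, Scheme.basicOpen_mul, X.basicOpen_of_isUnit isUnit_one.neg, inf_eq_right.mpr
      (X.basicOpen_le _)] at this

variable [X.IsSeparated] [IsLocallyNoetherian X] [UniversallyClosed f] [LocallyOfFiniteType f]
  {m : ℕ} {U : Fin m → X.Opens}

omit [X.IsSeparated] [IsLocallyNoetherian X] in
lemma isZero_of_subsingleton (hF : IsCoherent F) {V : X.Opens} (hV : IsAffineOpen V)
    (hs : SupportedIn F V) (h : ∀ t : Γ(F, V), t = 0) : IsZero F := by
  rw [isZero_iff]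
  have hFV : VanishesOn F V := vanishesOn_of_res hF.isLocalizing hV le_rfl fun t => by
    rw [h t, res_zero]
  intro W _ t
  apply section_ext
  intro x hx
  obtain ⟨Y, hxY, hY⟩ : ∃ Y : X.Opens, x ∈ Y ∧ VanishesOn F Y := by
    by_cases hxV : x ∈ V
    · exact ⟨V, hxV, hFV⟩
    · exact hs x hxV
  exact ⟨W ⊓ Y, inf_le_left, ⟨hx, hxY⟩, (hY _ inf_le_right _).trans (hY _ inf_le_right _).symm⟩

/-- The Euler characteristic of a sheaf with zero-dimensional support. -/
theorem eulerChar_of_dimSupport_nonpos [CompactSpace X] (hL : IsAmple L) (hU : IsAffineCover U)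
    (hF : IsCoherent F) (hd : dimSupport F ≤ 0) :
    ∃ d : ℕ, (∀ k, eulerChar f U (twist L F k) = d) ∧ (d = 0 → IsZero F) := by
  have : IsNoetherian X := {}
  have hZ := isClosed_support hF
  obtain ⟨S, hS⟩ := exists_finset_of_dim_zero hZ ((topologicalKrullDim_nonpos_iff hZ).mp hd)
  obtain ⟨n, hn, σ, hV, hSV, e, he⟩ := hL.exists_powSec f S
  set V := σ.locus
  have hs : SupportedIn F V := (supportedIn_iff hF).mpr fun x hx => hSV x (hS hx)
  have hfd := finiteDimensional_of_supportedIn f hF hV hs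
  let E : Sec f F V ≃ₗ[ℂ] Sec f F (V ⊓ V) :=
    LinearEquiv.ofBijective (resLin f F inf_le_left) (res_bijective_of_eq F _ (le_inf le_rfl le_rfl))
  have hfd' : FiniteDimensional ℂ (Sec f F (V ⊓ V)) := E.finiteDimensional
  refine ⟨Module.finrank ℂ (Sec f F V), fun k => ?_, fun h0 => ?_⟩
  -- With `V₀ = V₁ = V` and `u = 1` the index is `2 d - d`, where `d` is the dimension of the space
  -- of sections over `V`.
  · rw [eulerChar_twist f hU hF.isLocalizing hL.1 hV hV (by rwa [sup_idem]) he he 1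
      (one_smul _ _).symm k, LinearMap.index_eq_of_finiteDimensional, Module.finrank_prod,
      ← E.finrank_eq]
    push_cast
    ring
  · have := Module.finrank_zero_iff.mp h0
    exact isZero_of_subsingleton hF hV hs fun t => this.elim (α := Sec f F V) t 0

/-- The Hilbert polynomial of a coherent sheaf with support of dimension at most one. -/
theorem exists_hilbert [CompactSpace X] (hL : IsAmple L) (hU : IsAffineCover U)
    (hF : IsCoherent F) (H : ∀ a ∈ support F, ∀ b ∈ support F, ∀ c ∈ support F,
      a ⤳ b → b ⤳ c → a = b ∨ b = c) :
    ∃ r c : ℤ, (∀ k, eulerChar f U (twist L F k) = r * k + c) ∧ 0 ≤ r ∧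
      (r = 0 ↔ dimSupport F ≤ 0) ∧ (dimSupport F ≤ 0 → 0 ≤ c ∧ (c = 0 → IsZero F)) := by
  have hZ := isClosed_support hF
  obtain ⟨C, hC⟩ := hL.exists_chart f hZ H
  obtain ⟨r, c, hrc, hr, h0⟩ := C.exists_linear f hL.1 hU hF ((supportedIn_iff hF).mpr hC)
  -- For zero-dimensional support χ is constant in `k`; comparing it with `r k + c` at `k = 0` and
  -- `k = 1` gives `r = 0` and `c = d`.
  have key : dimSupport F ≤ 0 → r = 0 ∧ 0 ≤ c ∧ (c = 0 → IsZero F) := by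
    intro hd
    obtain ⟨d, hd, hd'⟩ := eulerChar_of_dimSupport_nonpos f hL hU hF hd
    have h1 := (hrc 0).symm.trans (hd 0)
    have h2 := (hrc 1).symm.trans (hd 1)
    push_cast at h1 h2
    rw [mul_zero, zero_add] at h1
    rw [mul_one] at h2
    refine ⟨by omega, by omega, fun hc => hd' (by omega)⟩
  refine ⟨r, c, hrc, hr, ⟨fun hr0 => ?_, fun hd => (key hd).1⟩, fun hd => (key hd).2⟩
  obtain ⟨h1, h2⟩ := h0 hr0
  refine (topologicalKrullDim_nonpos_iff hZ).mpr fun a ha b hb hab => ?_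
  rcases hC hb with hb' | hb'
  · exact eq_of_specializes_of_finiteDimensional f hF C.hV₀ ha hb' hab
  · exact eq_of_specializes_of_finiteDimensional f hF C.hV₁ ha hb' hab

/-- Additivity of the Euler characteristic. -/
theorem IsSES.eulerChar_eq_add [CompactSpace X] (hL : IsAmple L) (hU : IsAffineCover U)
    {G Q : X.Modules} {i : G ⟶ F} {π : F ⟶ Q} (h : IsSES i π) (hG : IsCoherent G)
    (hF : IsCoherent F) (hQ : IsCoherent Q) (hGF : support G ⊆ support F)
    (hQF : support Q ⊆ support F)
    (H : ∀ a ∈ support F, ∀ b ∈ support F, ∀ c ∈ support F, a ⤳ b → b ⤳ c → a = b ∨ b = c)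
    (k : ℕ) :
    eulerChar f U (twist L F k) = eulerChar f U (twist L G k) + eulerChar f U (twist L Q k) := by
  obtain ⟨C, hC⟩ := hL.exists_chart f (isClosed_support hF) H
  exact C.eulerChar_add f hL.1 hU h hG hF hQ ((supportedIn_iff hG).mpr (hGF.trans hC))
    ((supportedIn_iff hF).mpr hC) ((supportedIn_iff hQ).mpr (hQF.trans hC)) k

end

section

/-! ### Projective schemes are proper -/

lemma algebraMap_homogeneousSubmodule_zero_surjective (σ : Type) :
    Function.Surjective (algebraMap ℂ (MvPolynomial.homogeneousSubmodule σ ℂ 0)) := by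
  rintro ⟨p, hp⟩
  have h : p ∈ (1 : Submodule ℂ (MvPolynomial σ ℂ)) := by
    rwa [← MvPolynomial.homogeneousSubmodule_zero]
  obtain ⟨c, hc⟩ := Submodule.mem_one.mp h
  exact ⟨c, Subtype.ext hc⟩

/-- `Proj` is proper over the spectrum of the degree 0 part, over which the polynomial ring is of
finite type. The degree 0 part consists of constants, so the remaining map to `Spec ℂ` is a closed
immersion. -/
lemma isProper_projSpaceToSpec (n : ℕ) : IsProper (projSpaceToSpec n) := by
  have h1 : Algebra.FiniteType (MvPolynomial.homogeneousSubmodule (Fin (n + 1)) ℂ 0)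
      (MvPolynomial (Fin (n + 1)) ℂ) := by
    have : IsScalarTower ℂ (MvPolynomial.homogeneousSubmodule (Fin (n + 1)) ℂ 0)
        (MvPolynomial (Fin (n + 1)) ℂ) :=
      ⟨fun c a p => smul_mul_assoc c (a : MvPolynomial (Fin (n + 1)) ℂ) p⟩
    exact Algebra.FiniteType.of_restrictScalars_finiteType ℂ _ _
  have h2 : IsClosedImmersion (Spec.map (CommRingCat.ofHom
      (algebraMap ℂ (MvPolynomial.homogeneousSubmodule (Fin (n + 1)) ℂ 0)))) :=
    IsClosedImmersion.spec_of_surjective _ (algebraMap_homogeneousSubmodule_zero_surjective _)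
  rw [projSpaceToSpec]
  infer_instance

lemma IsProjective.isProper {f : X ⟶ Spec (CommRingCat.of ℂ)} (hf : IsProjective f) :
    IsProper f := by
  obtain ⟨n, i, hi, rfl⟩ := hf
  have := isProper_projSpaceToSpec n
  infer_instance

lemma isSeparated_of_isProper (f : X ⟶ Spec (CommRingCat.of ℂ)) [IsProper f] :
    X.IsSeparated := by
  constructor
  rw [← terminal.comp_from f]
  infer_instance

lemma compactSpace_of_isProper (f : X ⟶ Spec (CommRingCat.of ℂ)) [IsProper f] :
    CompactSpace X :=
  QuasiCompact.compactSpace_of_compactSpace f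

lemma isLocallyNoetherian_of_isProper (f : X ⟶ Spec (CommRingCat.of ℂ)) [IsProper f] :
    IsLocallyNoetherian X := by
  have : IsLocallyNoetherian (Spec (CommRingCat.of ℂ)) :=
    have : IsNoetherianRing (CommRingCat.of ℂ) := inferInstanceAs (IsNoetherianRing ℂ)
    inferInstance
  exact LocallyOfFiniteType.isLocallyNoetherian f

/-! ### Supports of subsheaves and quotients -/

variable {F G Q : X.Modules}

lemma support_subset_of_mono (hG : IsCoherent G) (hF : IsCoherent F) (i : G ⟶ F) [Mono i] :
    support G ⊆ support F := by
  intro x hx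
  rw [mem_support_iff hF]
  intro W hxW hW
  refine (mem_support_iff hG).mp hx W hxW fun V hV t => ?_
  apply app_injective_of_mono i V
  rw [hW V hV (i.app V t), map_zero]

lemma support_subset_of_epi (hF : IsCoherent F) (hQ : IsCoherent Q) (π : F ⟶ Q) [Epi π] :
    support Q ⊆ support F := by
  intro x hx
  rw [mem_support_iff hF]
  intro W hxW hW
  refine (mem_support_iff hQ).mp hx W hxW fun V hV t => ?_
  apply section_ext
  intro y hy
  obtain ⟨Y, hYV, hyY, s, hs⟩ := exists_local_lift_of_epi π t y hy
  refine ⟨Y, hYV, hyY, ?_⟩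
  rw [← hs, hW Y (hYV.trans hV) s, map_zero, res_zero]

lemma dimSupport_nonpos_of_subset (hF : IsCoherent F) (hQ : IsCoherent Q)
    (h : support Q ⊆ support F) (hd : dimSupport F ≤ 0) : dimSupport Q ≤ 0 := by
  rw [dimSupport, topologicalKrullDim_nonpos_iff (isClosed_support hF)] at hd
  exact (topologicalKrullDim_nonpos_iff (isClosed_support hQ)).mpr
    fun a ha b hb => hd a (h ha) b (h hb)

lemma dimSupport_nonpos_of_isZero (hF : IsCoherent F) (h : IsZero F) : dimSupport F ≤ 0 :=
  (topologicalKrullDim_nonpos_iff (isClosed_support hF)).mpr fun _ ha _ _ _ =>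
    absurd (isZero_iff.mp h) ((mem_support_iff hF).mp ha ⊤ trivial)

/-- The image, realised as the kernel of the cokernel, is the quotient of `𝒪_X` by the coherent
kernel of `s`. -/
lemma isCoherent_image [IsLocallyNoetherian X] (hF : IsCoherent F) (s : structureSheaf X ⟶ F) :
    IsCoherent (kernel (cokernel.π s)) :=
  (isSES_image s).isCoherent_right
    (isCoherent_kernel s (isCoherent_structureSheaf X) hF.isLocalizing).isLocalizing
    (isCoherent_structureSheaf X)

lemma isCoherent_cokernel [IsLocallyNoetherian X] (hF : IsCoherent F)
    (s : structureSheaf X ⟶ F) : IsCoherent (cokernel s) :=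
  (isSES_kernel (cokernel.π s)).isCoherent_right (isCoherent_image hF s).isLocalizing hF

end

/-! ### Stability of pairs -/

section

variable (f : X ⟶ Spec (CommRingCat.of ℂ)) {m : ℕ} {U : Fin m → X.Opens} {L F : X.Modules}

/-- `rk` is a chosen coefficient; two consecutive large values of `k` determine it. -/
lemma rk_eq {r c : ℤ} (h : ∀ k, eulerChar f U (twist L F k) = r * k + c) :
    rk f U L F = r := by
  have hex : ∃ r c : ℚ, ∀ᶠ k : ℕ in atTop, chi f U L F k = r * k + c :=
    ⟨r, c, Eventually.of_forall fun k => by rw [chi, h]; push_cast; rfl⟩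
  rw [rk, dif_pos hex]
  obtain ⟨c', hc'⟩ := hex.choose_spec
  obtain ⟨N, hN⟩ := eventually_atTop.mp hc'
  have h1 := hN N le_rfl
  have h2 := hN (N + 1) (Nat.le_succ N)
  rw [chi, h] at h1 h2
  push_cast at h1 h2
  linarith

lemma chi_eq {r c : ℤ} (h : ∀ k, eulerChar f U (twist L F k) = r * k + c) (k : ℕ) :
    chi f U L F k = r * k + c := by
  rw [chi, h]
  push_cast
  rfl

end

/-- A rational polynomial with positive leading coefficient and positive degree is unbounded. -/
lemma tendsto_eval_natCast {q : ℚ[X]} (hd : 1 ≤ q.natDegree) (hq : 0 < q.leadingCoeff) :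
    Tendsto (fun k : ℕ => q.eval (k : ℚ)) atTop atTop :=
  (q.tendsto_atTop_of_leadingCoeff_nonneg (Polynomial.natDegree_pos_iff_degree_pos.mp hd)
    hq.le).comp tendsto_natCast_atTop_atTop

section

variable {f : X ⟶ Spec (CommRingCat.of ℂ)} {m : ℕ} {U : Fin m → X.Opens} {L F : X.Modules}
  {s : structureSheaf X ⟶ F} {q : ℚ[X]}

lemma IsStable.isSemistable (h : IsStable f U L q F s) : IsSemistable f U L q F s where
  pure := h.pure
  slope G i hi := (h.slope G i hi).mono fun _ => le_of_lt
  slope_section G i hi hs := (h.slope_section G i hi hs).mono fun _ => le_of_lt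

lemma IsPair.specializes (hFs : IsPair F s) : ∀ a ∈ support F, ∀ b ∈ support F,
    ∀ c ∈ support F, a ⤳ b → b ⤳ c → a = b ∨ b = c :=
  fun _ ha _ hb _ hc => eq_or_eq_of_topologicalKrullDim_le_one hFs.dim_eq.le ha hb hc

variable [X.IsSeparated] [IsLocallyNoetherian X] [UniversallyClosed f] [LocallyOfFiniteType f]
  [CompactSpace X]

/-- The data entering the slope inequalities for a proper subsheaf. -/
lemma exists_hilbert_subsheaf (hL : IsAmple L) (hU : IsAffineCover U) (hFs : IsPair F s)
    (hF : IsPure F) {G Q : X.Modules} (i : G ⟶ F) (π : F ⟶ Q) (h : IsSES i π) [Mono i] [Epi π]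
    (hG : IsCoherent G) (hG0 : ¬ IsZero G) (hQ : IsCoherent Q) :
    ∃ rF cF rG cG : ℤ, (∀ k, eulerChar f U (twist L F k) = rF * k + cF) ∧
      (∀ k, eulerChar f U (twist L G k) = rG * k + cG) ∧ 0 < rG ∧ rG ≤ rF ∧
      (rG = rF ↔ dimSupport Q ≤ 0) ∧ (dimSupport Q ≤ 0 → ¬ IsZero Q → cG < cF) := by
  have H := hFs.specializes
  have hGF := support_subset_of_mono hG hFs.coherent i
  have hQF := support_subset_of_epi hFs.coherent hQ π
  obtain ⟨rG, cG, hχG, hrG, hrG0, -⟩ := exists_hilbert f hL hU hG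
    fun a ha b hb c hc => H a (hGF ha) b (hGF hb) c (hGF hc)
  obtain ⟨rQ, cQ, hχQ, hrQ, hrQ0, hcQ⟩ := exists_hilbert f hL hU hQ
    fun a ha b hb c hc => H a (hQF ha) b (hQF hb) c (hQF hc)
  have hadd := h.eulerChar_eq_add f hL hU hG hFs.coherent hQ hGF hQF H
  -- Purity enters here: the subsheaf has support of dimension 1, so its rank is nonzero and the
  -- quotients by `rk` have their intended meaning.
  have hrG1 : rG ≠ 0 := fun h0 => by
    have := hrG0.mp h0
    rw [hF G i inferInstance hG hG0] at this
    exact absurd this (by decide)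
  refine ⟨rG + rQ, cG + cQ, rG, cG, fun k => ?_, hχG, by omega, by omega, ?_, fun hd h0 => ?_⟩
  · rw [hadd, hχG, hχQ]
    ring
  · rw [← hrQ0]
    omega
  · obtain ⟨h1, h2⟩ := hcQ hd
    have : cQ ≠ 0 := fun hc => h0 (h2 hc)
    omega

/-- After division by the ranks both sides begin with `k`, so the first inequality only asks that
`q(k)` exceed a constant. If `s` factors through `G`, then `F/G` is a quotient of the cokernel of
`s`: the ranks are equal, `q` cancels, and the constant terms differ by the length of `F/G`, which
is positive since `G ≠ F`. -/
lemma isStable_of_isPureWithFiniteCokernel (hL : IsAmple L) (hU : IsAffineCover U)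
    (hd : 1 ≤ q.natDegree) (hq : 0 < q.leadingCoeff) (hFs : IsPair F s)
    (h : IsPureWithFiniteCokernel F s) : IsStable f U L q F s := by
  obtain ⟨hF, hs⟩ := h
  have key : ∀ {G : X.Modules} (i : G ⟶ F), IsProperSubsheaf i →
      ∃ rF cF rG cG : ℤ, (∀ k, eulerChar f U (twist L F k) = rF * k + cF) ∧
      (∀ k, eulerChar f U (twist L G k) = rG * k + cG) ∧ 0 < rG ∧ rG ≤ rF ∧
      (FactorsThrough s i → rG = rF ∧ cG < cF) := by
    intro G i hi
    have := hi.mono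
    have hQ := (isSES_cokernel i).isCoherent_right hi.coherent.isLocalizing hFs.coherent
    obtain ⟨rF, cF, rG, cG, h1, h2, h3, h4, h5, h6⟩ := exists_hilbert_subsheaf (f := f) hL hU hFs hF
      i (cokernel.π i) (isSES_cokernel i) hi.coherent hi.ne_zero hQ
    refine ⟨rF, cF, rG, cG, h1, h2, h3, h4, ?_⟩
    rintro ⟨t, ht⟩
    have hw : s ≫ cokernel.π i = 0 := by
      rw [← ht, Category.assoc, cokernel.condition, comp_zero]
    have : Epi (cokernel.desc s (cokernel.π i) hw) :=
      epi_of_epi_fac (cokernel.π_desc s (cokernel.π i) hw)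
    have hc := isCoherent_cokernel hFs.coherent s
    have hdim := dimSupport_nonpos_of_subset hc hQ
      (support_subset_of_epi hc hQ (cokernel.desc s (cokernel.π i) hw)) hs
    refine ⟨h5.mpr hdim, h6 hdim fun h0 => hi.ne_top ?_⟩
    have := Preadditive.epi_of_isZero_cokernel i h0
    exact isIso_of_mono_of_epi i
  refine ⟨hF, fun G i hi => ?_, fun G i hi hsi => ?_⟩
  · obtain ⟨rF, cF, rG, cG, h1, h2, h3, h4, -⟩ := key i hi
    have h3' : (0 : ℚ) < rG := by exact_mod_cast h3
    have h4' : (0 : ℚ) < rF := by exact_mod_cast h3.trans_le h4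
    filter_upwards [(tendsto_eval_natCast hd hq).eventually_gt_atTop
      ((cG / rG) * rF - cF : ℚ)] with k hk
    rw [rk_eq f h1, rk_eq f h2, chi_eq f h1, chi_eq f h2, lt_div_iff₀ h4', add_div,
      mul_div_cancel_left₀ _ h3'.ne']
    linarith
  · obtain ⟨rF, cF, rG, cG, h1, h2, h3, -, h5⟩ := key i hi
    obtain ⟨h6, h7⟩ := h5 hsi
    have h3' : (0 : ℚ) < rG := by exact_mod_cast h3
    have h7' : (cG : ℚ) < cF := by exact_mod_cast h7
    refine Eventually.of_forall fun k => ?_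
    rw [rk_eq f h1, rk_eq f h2, chi_eq f h1, chi_eq f h2, ← h6]
    exact div_lt_div_of_pos_right (by linarith) h3'

/-- Test on `G = im s`. If the cokernel is not zero-dimensional, then `r(G) < r(F)`, and clearing
denominators turns the inequality into `q(k) (r(F) - r(G)) ≤ c(F) r(G) - c(G) r(F)`, which fails
because `q(k)` is unbounded. -/
lemma IsSemistable.isPureWithFiniteCokernel (hL : IsAmple L) (hU : IsAffineCover U)
    (hd : 1 ≤ q.natDegree) (hq : 0 < q.leadingCoeff) (hFs : IsPair F s)
    (h : IsSemistable f U L q F s) : IsPureWithFiniteCokernel F s := by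
  refine ⟨h.pure, ?_⟩
  by_contra hs
  have hG := isCoherent_image hFs.coherent s
  have hQ := isCoherent_cokernel hFs.coherent s
  have hfac : Abelian.factorThruImage s ≫ kernel.ι (cokernel.π s) = s := Abelian.image.fac s
  have hG0 : ¬ IsZero (kernel (cokernel.π s)) := fun h0 => hFs.ne_zero <| by
    rw [← hfac, h0.eq_zero_of_src (kernel.ι (cokernel.π s)), comp_zero]
  -- If the image were all of `F`, the cokernel would be zero, and the zero sheaf satisfies
  -- `dimSupport ≤ 0`.
  have hi : IsProperSubsheaf (kernel.ι (cokernel.π s)) := by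
    refine ⟨inferInstance, hG, hG0, fun hiso => hs (dimSupport_nonpos_of_isZero hQ ?_)⟩
    have h1 : cokernel.π s = 0 := by
      rw [← cancel_epi (kernel.ι (cokernel.π s)), kernel.condition, comp_zero]
    rw [IsZero.iff_id_eq_zero, ← cancel_epi (cokernel.π s), h1, zero_comp, zero_comp]
  obtain ⟨rF, cF, rG, cG, h1, h2, h3, h4, h5, -⟩ := exists_hilbert_subsheaf (f := f) hL hU hFs
    h.pure _ _ (isSES_kernel (cokernel.π s)) hG hG0 hQ
  have h6 : rG < rF := lt_of_le_of_ne h4 fun h0 => hs (h5.mp h0)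
  have h3' : (0 : ℚ) < rG := by exact_mod_cast h3
  have h6' : (rG : ℚ) < rF := by exact_mod_cast h6
  have h4' : (0 : ℚ) < rF := h3'.trans h6'
  obtain ⟨k, hk, hk'⟩ := ((h.slope_section _ _ hi ⟨_, hfac⟩).and
    ((tendsto_eval_natCast hd hq).eventually_gt_atTop
      ((cF * rG - cG * rF) / (rF - rG) : ℚ))).exists
  rw [rk_eq f h1, rk_eq f h2, chi_eq f h1, chi_eq f h2, div_le_div_iff₀ h3' h4'] at hk
  rw [div_lt_iff₀ (by linarith)] at hk'
  linarith

/-- For `q` of positive degree, (semi)stability means purity and zero-dimensional cokernel. -/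
theorem isSemistable_iff_and_isStable_iff (hL : IsAmple L) (hU : IsAffineCover U)
    (hd : 1 ≤ q.natDegree) (hq : 0 < q.leadingCoeff) (hFs : IsPair F s) :
    (IsSemistable f U L q F s ↔ IsStable f U L q F s) ∧
      (IsStable f U L q F s ↔ IsPureWithFiniteCokernel F s) :=
  ⟨⟨fun h => isStable_of_isPureWithFiniteCokernel hL hU hd hq hFs
      (h.isPureWithFiniteCokernel hL hU hd hq hFs), IsStable.isSemistable⟩,
    fun h => h.isSemistable.isPureWithFiniteCokernel hL hU hd hq hFs,
    isStable_of_isPureWithFiniteCokernel hL hU hd hq hFs⟩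

end

lemma natDegree_linearPoly {c : ℚ × ℚ} (h : 0 < c.1) : (linearPoly c).natDegree = 1 :=
  Polynomial.natDegree_linear h.ne'

lemma leadingCoeff_linearPoly {c : ℚ × ℚ} (h : 0 < c.1) : (linearPoly c).leadingCoeff = c.1 :=
  Polynomial.leadingCoeff_linear h.ne'

lemma eventually_fst_pos : ∀ᶠ c : ℚ × ℚ in atTop, 0 < c.1 :=
  (eventually_ge_atTop ((1, 0) : ℚ × ℚ)).mono fun _ hc => zero_lt_one.trans_le hc.1

end LimitPairs

end

/-! ### The theorem -/

theorem mainTheorem9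
    (X : AlgebraicGeometry.Scheme.{0})
    (f : X ⟶ AlgebraicGeometry.Spec (CommRingCat.of ℂ))
    (hsmooth : AlgebraicGeometry.SmoothOfRelativeDimension 3 f)
    (hproj : LimitPairs.IsProjective f)
    (L : X.Modules) (hL : LimitPairs.IsAmple L)
    (m : ℕ) (U : Fin m → X.Opens) (hU : LimitPairs.IsAffineCover U) :
    -- limit semistability, limit stability and conditions (i), (ii) coincide
    (∀ (F : X.Modules) (s : LimitPairs.structureSheaf X ⟶ F), LimitPairs.IsPair F s →
      (LimitPairs.IsLimitSemistable f U L F s ↔ LimitPairs.IsLimitStable f U L F s) ∧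
      (LimitPairs.IsLimitStable f U L F s ↔ LimitPairs.IsPureWithFiniteCokernel F s)) ∧
    -- the limit along degree one polynomials is reached uniformly in the pair
    (∀ᶠ c : ℚ × ℚ in Filter.atTop,
      ∀ (F : X.Modules) (s : LimitPairs.structureSheaf X ⟶ F), LimitPairs.IsPair F s →
        (LimitPairs.IsSemistable f U L (LimitPairs.linearPoly c) F s ↔
          LimitPairs.IsStable f U L (LimitPairs.linearPoly c) F s) ∧
        (LimitPairs.IsStable f U L (LimitPairs.linearPoly c) F s ↔
          LimitPairs.IsPureWithFiniteCokernel F s)) ∧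
    -- the limit is already achieved by every `q` of degree at least two
    (∀ q : Polynomial ℚ, 2 ≤ q.natDegree → 0 < q.leadingCoeff →
      ∀ (F : X.Modules) (s : LimitPairs.structureSheaf X ⟶ F), LimitPairs.IsPair F s →
        (LimitPairs.IsSemistable f U L q F s ↔ LimitPairs.IsStable f U L q F s) ∧
        (LimitPairs.IsStable f U L q F s ↔ LimitPairs.IsPureWithFiniteCokernel F s)) := by
  have := hproj.isProper
  have := LimitPairs.isSeparated_of_isProper f
  have := LimitPairs.compactSpace_of_isProper f
  have := LimitPairs.isLocallyNoetherian_of_isProper f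
  have key : ∀ᶠ c : ℚ × ℚ in Filter.atTop,
      ∀ (F : X.Modules) (s : LimitPairs.structureSheaf X ⟶ F), LimitPairs.IsPair F s →
        (LimitPairs.IsSemistable f U L (LimitPairs.linearPoly c) F s ↔
          LimitPairs.IsStable f U L (LimitPairs.linearPoly c) F s) ∧
        (LimitPairs.IsStable f U L (LimitPairs.linearPoly c) F s ↔
          LimitPairs.IsPureWithFiniteCokernel F s) := by
    -- The threshold `a > 0` does not depend on the pair, and `b` may be arbitrary.
    filter_upwards [LimitPairs.eventually_fst_pos] with c hc F s hFs
    exact LimitPairs.isSemistable_iff_and_isStable_iff hL hU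
      (LimitPairs.natDegree_linearPoly hc).ge
      (by rwa [LimitPairs.leadingCoeff_linearPoly hc]) hFs
  refine ⟨fun F s hFs => ⟨eventually_congr (key.mono fun c hc => (hc F s hFs).1), ?_⟩, key,
    fun q hd hq F s hFs => LimitPairs.isSemistable_iff_and_isStable_iff hL hU
      (one_le_two.trans hd) hq hFs⟩
  -- Conditions (i) and (ii) do not involve `q`, and on the nontrivial filter `atTop` a constant
  -- statement holds eventually exactly when it holds.
  exact (eventually_congr (key.mono fun c hc => (hc F s hFs).2)).trans eventually_const
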